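/- Notation. Let $e(x)=e^{2\pi i x}$. Let $F$ be a holomorphic Hecke cusp form of weight $k_0$ for $SL(2,\mathbb{Z})$ with normalised Fourier coefficients $\lambda_F(n)$, so that $F(z)=\sum_{n\ge 1}\lambda_F(n)n^{(k_0-1)/2}e(nz)$ and $\lambda_F(1)=1$. Let $W\ge 0$ be a smooth function supported in $[1,2]$ with $\int W=1$, and let $U$ be a smooth function supported in $[1/2,3]$ with $U=1$ on $[1,2]$; assume $|W^{(j)}|,|U^{(j)}|\le B_j$ for all $j\ge 0$. For a character $\psi$ modulo $q$ put $$S_\psi(a,b;cq)=\sum_{\substack{x \bmod cq\\ (x,cq)=1}}\psi(x)\,e\!\left(\frac{ax+b\bar x}{cq}\right),$$ and let $J_\nu$ be the Bessel function of order $\nu$. For real $t,N,H,K>0$ and a finite set of primes $\mathcal{Q}$ let $$\mathcal{O}=\sum_{\substack{k\ge 1\\ k\ \mathrm{odd}}} W\!\left(\frac{k-1}{K}\right)\sum_{q\in\mathcal{Q}}\ \sum_{\substack{\psi \bmod q\\ \psi(-1)=-1}}\ \sum_{m,\ell\ge 1}\lambda_F(m)\psi(\ell)U\!\left(\frac{m\ell^2}{N}\right)\sum_{\substack{N<n\le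 2N\\ h\in\mathbb{Z}}}(n+h)^{it}\,W\!\left(\frac hH\right)\sum_{c\ge 1}\frac{i^{-k}S_\psi(n+h,m;cq)}{cq}\,J_{k-1}\!\left(\frac{4\pi\sqrt{m(n+h)}}{cq}\right).$$ Proposition. Let $0<\delta<1/42$. There is $\varepsilon_0>0$, depending only on $\delta$, such that the following holds. Let $A>0$, $t>1$ and $t^{2/3-2\delta}<N\le A\,t^{1+\varepsilon_0}$, and put $$H=\frac{N}{t^{1/3}},\qquad K=\min\{t^{1/3-2\delta},\,N t^{-1/3-2\delta}\},\qquad Q=N^{3/5}\,t^{1/15+2\delta/5}\,K^{-6/5}.$$ Let $\mathcal{Q}$ be any set of prime numbers contained in $[Q,2Q]$. Then $$|\mathcal{O}|\le C\,\sqrt N\,H\,Q^2\,K\,t^{1/3-\delta},$$ where $C$ depends only on $\delta$, $F$, $A$ and the bounds $(B_j)_{j\ge0}$. -/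

import Mathlib

open Complex UpperHalfPlane
open scoped MatrixGroups ContDiff

noncomputable section

namespace OffDiagonal

/-- The additive character `e(x) = exp(2πix)`. -/
def e (x : ℝ) : ℂ := Complex.exp (2 * Real.pi * Complex.I * x)

/-! ### Hecke cusp forms of full level -/

/-- The Hecke operator
`(Tₙ f)(z) = n^(k-1) ∑_{ad = n} d^(-k) ∑_{0 ≤ b < d} f((az + b)/d)` in weight `k` and level one. -/
def heckeOp (k : ℤ) (n : ℕ) (f : ℍ → ℂ) (z : ℍ) : ℂ :=
  (n : ℂ) ^ (k - 1) * ∑ p ∈ n.divisorsAntidiagonal, (p.2 : ℂ) ^ (-k) *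
    ∑ b ∈ Finset.range p.2, f (ofComplex (((p.1 : ℂ) * (z : ℂ) + (b : ℂ)) / (p.2 : ℂ)))

/-- `F` is a Hecke cusp form: an eigenfunction of all Hecke operators `Tₙ`, `n ≥ 1`, normalised so
that its first Fourier coefficient is `1`. -/
structure IsHeckeCuspForm {k₀ : ℤ} (F : CuspForm 𝒮ℒ k₀) : Prop where
  coeff_one : (qExpansion 1 F).coeff 1 = 1
  eigen : ∀ n : ℕ, 1 ≤ n → ∃ μ : ℂ, ∀ z : ℍ, heckeOp k₀ n F z = μ * F z

/-- The normalised Fourier coefficients `λ_F(n)`, so that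
`F(z) = ∑_{n ≥ 1} λ_F(n) n^((k₀-1)/2) e(nz)`. -/
def fourierCoeff {k₀ : ℤ} (F : CuspForm 𝒮ℒ k₀) (n : ℕ) : ℂ :=
  (qExpansion 1 F).coeff n / (((n : ℝ) ^ (((k₀ : ℝ) - 1) / 2) : ℝ) : ℂ)

/-! ### Weight functions -/

/-- A smooth function `W ≥ 0` supported in `[1, 2]` with `∫ W = 1` and `|W⁽ʲ⁾| ≤ Bⱼ`. -/
structure IsBump (B : ℕ → ℝ) (W : ℝ → ℝ) : Prop where
  smooth : ContDiff ℝ ∞ W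
  nonneg : ∀ x, 0 ≤ W x
  supp : Function.support W ⊆ Set.Icc 1 2
  integral : ∫ x, W x = 1
  deriv_le : ∀ (j : ℕ) (x : ℝ), |iteratedDeriv j W x| ≤ B j

/-- A smooth function `U` supported in `[1/2, 3]` with `U = 1` on `[1, 2]` and `|U⁽ʲ⁾| ≤ Bⱼ`. -/
structure IsPlateau (B : ℕ → ℝ) (U : ℝ → ℝ) : Prop where
  smooth : ContDiff ℝ ∞ U
  supp : Function.support U ⊆ Set.Icc (1 / 2) 3
  eq_one : ∀ x ∈ Set.Icc (1 : ℝ) 2, U x = 1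
  deriv_le : ∀ (j : ℕ) (x : ℝ), |iteratedDeriv j U x| ≤ B j

/-! ### Kloosterman sums and Bessel functions -/

/-- The Kloosterman sum `S_ψ(a, b; M) = ∑_{x mod M, (x, M) = 1} ψ(x) e((a x + b x̄)/M)` twisted by
a character `ψ` modulo `q`, where `q ∣ M`. -/
def kloosterman {q : ℕ} (ψ : DirichletCharacter ℂ q) (a b : ℤ) (M : ℕ) : ℂ :=
  ∑ x ∈ (Finset.range M).filter (fun x => Nat.Coprime x M),
    ψ (x : ZMod q) * e (((a : ℝ) * x + (b : ℝ) * (((x : ZMod M)⁻¹).val : ℝ)) / M)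

/-- The Bessel function `J_ν` of integral order `ν ≥ 0`, by Bessel's integral
`J_ν(x) = (1/π) ∫_0^π cos(νθ - x sin θ) dθ`. -/
def besselJ (ν : ℕ) (x : ℝ) : ℝ :=
  (1 / Real.pi) * ∫ θ in (0 : ℝ)..Real.pi, Real.cos (ν * θ - x * Real.sin θ)

/-! ### The off-diagonal -/

/-- The `c`-th term `i^(-k) S_ψ(r, m; cq) / (cq) · J_{k-1}(4π √(mr) / (cq))`. -/
def peterssonTerm {q : ℕ} (ψ : DirichletCharacter ℂ q) (k : ℕ) (r : ℤ) (m c : ℕ) : ℂ :=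
  Complex.I ^ (-(k : ℤ)) * kloosterman ψ r m (c * q) / ((c * q : ℕ) : ℂ) *
    (besselJ (k - 1) (4 * Real.pi * Real.sqrt (m * r) / (c * q)) : ℂ)

/-- The direct off-diagonal `𝒪`. The sums over `k`, `m`, `ℓ`, `h` have finite support
because of the weights `W` and `U`; the sum over `c` converges absolutely for every `k ≥ 3`,
and `k = 1` has weight `W 0 = 0`. -/
def offDiag {k₀ : ℤ} (F : CuspForm 𝒮ℒ k₀) (W U : ℝ → ℝ) (𝒬 : Finset ℕ) (t N H K : ℝ) : ℂ :=
  ∑' k : ℕ, if Odd k then (W (((k : ℝ) - 1) / K) : ℂ) *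
    ∑ q ∈ 𝒬, ∑ᶠ (ψ : DirichletCharacter ℂ q) (_ : ψ.Odd),
      ∑' (m : ℕ+) (l : ℕ+), fourierCoeff F m * ψ ((l : ℕ) : ZMod q) *
        (U ((m : ℝ) * (l : ℝ) ^ 2 / N) : ℂ) *
        ∑ n ∈ Finset.Ioc ⌊N⌋₊ ⌊2 * N⌋₊, ∑' h : ℤ,
          (((n : ℤ) + h : ℤ) : ℂ) ^ (Complex.I * (t : ℂ)) * (W ((h : ℝ) / H) : ℂ) *
            ∑' c : ℕ+, peterssonTerm ψ k ((n : ℤ) + h) m c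
  else 0

/-! ### The choice of the parameters -/

/-- `H = N / t^(1/3)`. -/
def paramH (t N : ℝ) : ℝ := N / t ^ (1 / 3 : ℝ)

/-- `K = min {t^(1/3 - 2δ), N t^(-1/3 - 2δ)}`. -/
def paramK (δ t N : ℝ) : ℝ := min (t ^ (1 / 3 - 2 * δ)) (N * t ^ (-(1 / 3) - 2 * δ))

/-- `Q = N^(3/5) t^(1/15 + 2δ/5) K^(-6/5)`. -/
def paramQ (δ t N : ℝ) : ℝ :=
  N ^ (3 / 5 : ℝ) * t ^ (1 / 15 + 2 * δ / 5) * paramK δ t N ^ (-(6 / 5) : ℝ)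

end OffDiagonal

end

/-! Sort the sum by the modulus `M = c q` and open the Kloosterman sum. For fixed `ℓ`, the sum over
odd `ψ` of `ψ(ℓ)ψ(x)` vanishes unless `ℓ x ≡ ±1 mod q`, so its total mass over `x mod c q` is at
most `c q`, which the factor `1/(c q)` cancels (`sum_norm_sum_oddCharacters_le`). No cancellation in
Kloosterman sums is needed: it suffices to bound, uniformly in `x`, a sum over `m`, `h`, `n` and `k`
in which `m` and `r = n + h` carry additive phases.

Write `k = 2j + 1`; then `i^(-k)` supplies the sign `(-1)^j`. By Bessel's integral the average of
`(-1)^j J_{2j}(z)` against `W(2j/K)` is a superposition of `exp(iσz)`, `|σ| ≤ 1`, of bounded total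
mass. Two uses of the Bessel recurrence with partial summation give instead `z²` times such a
superposition of mass `O(K⁻⁴)`. So `exp(iσz)` replaces the Bessel functions, with a gain once `z` is
smaller than `K²` (`exists_norm_sum_bessel_le`).

The phase in `r` is then `t log r + β r + κ √r`. Van der Corput's second derivative test bounds the
sum over `n` by `√t + N/√t`, uniformly in `β`, provided `κ √r` is small against `t`. As a function
of `m` this sum varies on the scale `M/ℓ`. The sum over `m` uses only that `y^(k₀/2) |F(x + iy)|` is
bounded: writing the coefficients as integrals over a horizontal line bounds any additive twist by
the `L¹` norm of a trigonometric polynomial, which is controlled by the size and variation of its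
coefficients (`exists_norm_smooth_twisted_sum_le`).

A modulus `M` thus contributes `H (√t + N/√t) N M^(-1/2) min(1, N/(M K²))` up to a constant. With
`min(1, x) ≤ x^s`, `1/2 < s ≤ 1`, the sum over `c` converges and the `O(Q)` moduli `q` give `H (√t +
N/√t) N Q^(1/2) X^s`, `X = N/(Q K²)` (`exists_norm_offDiag_le`). The definition of `Q` makes the
case `s = 1` equal to the target times `1 + N/t`. This settles `N ≤ t`; for `N ≥ t` one has `X ≥
t^(1/15)`, and `s = 3/4` saves the power of `t` that absorbs `N/t`. -/

namespace OffDiagonal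

/-! ### The additive character -/

lemma e_add (x y : ℝ) : e (x + y) = e x * e y := by
  simp only [e, ← Complex.exp_add]; congr 1; push_cast; ring

lemma norm_e (x : ℝ) : ‖e x‖ = 1 := by
  have : e x = Complex.exp (((2 * Real.pi * x : ℝ) : ℂ) * Complex.I) := by
    simp only [e]; congr 1; push_cast; ring
  rw [this, Complex.norm_exp_ofReal_mul_I]

lemma e_int (n : ℤ) : e n = 1 := by
  simp only [e]
  rw [Complex.exp_eq_one_iff]
  exact ⟨n, by push_cast; ring⟩

lemma e_zero : e 0 = 1 := by simpa using e_int 0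

lemma e_neg (x : ℝ) : e (-x) = (starRingEnd ℂ) (e x) := by
  simp only [e, ← Complex.exp_conj]
  congr 1
  simp only [map_mul, Complex.conj_I, Complex.conj_ofReal, map_ofNat]
  push_cast
  ring

lemma e_eq (x : ℝ) : e x = Real.cos (2 * Real.pi * x) + Real.sin (2 * Real.pi * x) * Complex.I := by
  have : e x = Complex.exp (((2 * Real.pi * x : ℝ) : ℂ) * Complex.I) := by
    simp only [e]; congr 1; push_cast; ring
  rw [this, Complex.exp_mul_I, Complex.ofReal_cos, Complex.ofReal_sin]

lemma continuous_e : Continuous e := by unfold e; fun_prop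

/-- This is `1/(1 - e(g)) = 1/2 + (i/2) cot(πg)`. The constant real part and the monotone cotangent
are what the Kusmin-Landau argument exploits. -/
lemma one_sub_e_inv {g : ℝ} (hg : Real.sin (Real.pi * g) ≠ 0) :
    (1 - e g) * (1 / 2 + ((Real.cos (Real.pi * g) / (2 * Real.sin (Real.pi * g)) : ℝ) : ℂ) *
      Complex.I) = 1 := by
  have h1 : Real.cos (2 * Real.pi * g) = 1 - 2 * Real.sin (Real.pi * g) ^ 2 := by
    rw [show 2 * Real.pi * g = 2 * (Real.pi * g) by ring, Real.cos_two_mul, Real.cos_sq']; ring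
  have h2 : Real.sin (2 * Real.pi * g) = 2 * Real.sin (Real.pi * g) * Real.cos (Real.pi * g) := by
    rw [show 2 * Real.pi * g = 2 * (Real.pi * g) by ring, Real.sin_two_mul]
  rw [e_eq, h1, h2]
  have h3 := Real.sin_sq_add_cos_sq (Real.pi * g)
  set s := Real.sin (Real.pi * g)
  set c := Real.cos (Real.pi * g)
  have hy : 2 * s * (c / (2 * s)) = c := by field_simp
  generalize c / (2 * s) = y at hy
  have hy' : (2 * s * y : ℂ) = c := by exact_mod_cast hy
  have h3' : (s ^ 2 + c ^ 2 : ℂ) = 1 := by exact_mod_cast h3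
  push_cast
  linear_combination h3' + (s * Complex.I + c) * hy' - 2 * s * c * y * Complex.I_sq

lemma norm_one_sub_e_sq (g : ℝ) : ‖1 - e g‖ ^ 2 = 4 * Real.sin (Real.pi * g) ^ 2 := by
  have h1 : Real.cos (2 * Real.pi * g) = 1 - 2 * Real.sin (Real.pi * g) ^ 2 := by
    rw [show 2 * Real.pi * g = 2 * (Real.pi * g) by ring, Real.cos_two_mul, Real.cos_sq']; ring
  have h3 := Real.sin_sq_add_cos_sq (2 * Real.pi * g)
  rw [← Complex.normSq_eq_norm_sq, e_eq, Complex.normSq_apply]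
  simp only [Complex.sub_re, Complex.one_re, Complex.add_re, Complex.ofReal_re, Complex.mul_re,
    Complex.I_re, Complex.ofReal_im, Complex.I_im, Complex.sub_im, Complex.one_im, Complex.add_im,
    Complex.mul_im]
  nlinarith

/-! ### Exponential sums -/

lemma two_mul_le_sin_pi {κ g : ℝ} (hκ : 0 < κ) (h1 : κ ≤ g) (h2 : g ≤ 1 - κ) :
    2 * κ ≤ Real.sin (Real.pi * g) := by
  have hpi := Real.pi_pos
  rcases le_total g (1 / 2) with h | h
  · have := Real.mul_le_sin (x := Real.pi * g) (by nlinarith) (by nlinarith)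
    calc 2 * κ ≤ 2 * g := by linarith
      _ = 2 / Real.pi * (Real.pi * g) := by field_simp
      _ ≤ _ := this
  · have := Real.mul_le_sin (x := Real.pi * (1 - g)) (by nlinarith) (by nlinarith)
    rw [show Real.pi * (1 - g) = Real.pi - Real.pi * g by ring, Real.sin_pi_sub] at this
    calc 2 * κ ≤ 2 * (1 - g) := by linarith
      _ = 2 / Real.pi * (Real.pi - Real.pi * g) := by field_simp
      _ ≤ _ := this

/-- The Kusmin-Landau inequality when the differences of the phase lie in `[κ, 1 - κ]`. -/
lemma kusmin_landau_zero {κ : ℝ} (hκ : 0 < κ) (f : ℕ → ℝ) (n : ℕ)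
    (hmono : ∀ i, i + 1 < n → f (i + 1) - f i ≤ f (i + 2) - f (i + 1))
    (hlow : ∀ i < n, κ ≤ f (i + 1) - f i) (hup : ∀ i < n, f (i + 1) - f i ≤ 1 - κ) :
    ‖∑ i ∈ Finset.range n, e (f i)‖ ≤ 1 / κ := by
  rcases Nat.eq_zero_or_pos n with rfl | hn
  · simp; positivity
  set g : ℕ → ℝ := fun i => f (i + 1) - f i with hg
  set y : ℕ → ℝ := fun i => Real.cos (Real.pi * g i) / (2 * Real.sin (Real.pi * g i)) with hy
  -- `c i = 1/(1 - e(g i))`, so `e(f i)` is a difference `e(f i) - e(f (i + 1))` times `c i`.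
  -- Successive `c i` differ only in the imaginary part `y i`, which is decreasing, so their total
  -- variation telescopes.
  set c : ℕ → ℂ := fun i => 1 / 2 + ((y i : ℝ) : ℂ) * Complex.I with hc
  have hsin : ∀ i < n, 2 * κ ≤ Real.sin (Real.pi * g i) := fun i hi =>
    two_mul_le_sin_pi hκ (hlow i hi) (hup i hi)
  have hterm : ∀ i < n, e (f i) = (e (f i) - e (f (i + 1))) * c i := by
    intro i hi
    have h1 := one_sub_e_inv (g := g i) (by have := hsin i hi; linarith [hκ])
    have h2 : e (f (i + 1)) = e (f i) * e (g i) := by rw [← e_add]; simp [hg]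
    rw [h2]
    calc e (f i) = e (f i) * ((1 - e (g i)) * c i) := by rw [hc, hy]; rw [h1, mul_one]
      _ = _ := by ring
  have hyb : ∀ i < n, |y i| ≤ 1 / (4 * κ) := by
    intro i hi
    have hs := hsin i hi
    rw [hy]; simp only
    rw [abs_div, abs_of_pos (a := 2 * Real.sin (Real.pi * g i)) (by linarith)]
    rw [div_le_div_iff₀ (by linarith) (by linarith)]
    nlinarith [Real.abs_cos_le_one (Real.pi * g i), abs_nonneg (Real.cos (Real.pi * g i))]
  have hcb : ∀ i < n, ‖c i‖ ≤ 1 / (4 * κ) := by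
    intro i hi
    have hs := hsin i hi
    have h1 := one_sub_e_inv (g := g i) (by linarith [hκ])
    have h2 : ‖1 - e (g i)‖ * ‖c i‖ = 1 := by rw [← norm_mul]; rw [hc, hy]; simp only; rw [h1]; simp
    have h3 : 4 * κ ≤ ‖1 - e (g i)‖ := by
      have := norm_one_sub_e_sq (g i)
      nlinarith [norm_nonneg (1 - e (g i))]
    rw [le_div_iff₀ (by linarith)]
    nlinarith [norm_nonneg (c i)]
  have hymono : ∀ i, i + 1 < n → y (i + 1) ≤ y i := by
    intro i hi
    have hs := hsin i (by omega)
    have hs' := hsin (i + 1) hi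
    have hm : g i ≤ g (i + 1) := hmono i hi
    rw [hy]; simp only
    rw [div_le_div_iff₀ (by linarith) (by linarith)]
    have : 0 ≤ Real.sin (Real.pi * g (i + 1) - Real.pi * g i) := by
      apply Real.sin_nonneg_of_nonneg_of_le_pi
      · nlinarith [Real.pi_pos]
      · have := hlow i (by omega); have := hup (i + 1) hi
        have h5 : g (i + 1) - g i ≤ 1 := by simp only [hg]; linarith
        nlinarith [Real.pi_pos]
    rw [Real.sin_sub] at this
    nlinarith
  obtain ⟨m, rfl⟩ : ∃ m, n = m + 1 := ⟨n - 1, by omega⟩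
  -- Abel summation, keeping the boundary term at `k + 1` on the left so that the induction closes.
  have key : ∀ k ≤ m, ‖∑ i ∈ Finset.range (k + 1), e (f i) + e (f (k + 1)) * c k‖
      ≤ 1 / (4 * κ) + (y 0 - y k) := by
    intro k
    induction k with
    | zero =>
      intro _
      have : ∑ i ∈ Finset.range 1, e (f i) + e (f 1) * c 0 = e (f 0) * c 0 := by
        rw [Finset.sum_range_one]
        have := hterm 0 (by omega)
        simp only [zero_add] at this
        linear_combination this
      rw [zero_add, this, norm_mul, norm_e]
      simpa using hcb 0 (by omega)
    | succ k ih =>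
      intro hk
      have ih := ih (by omega)
      have h1 := hterm (k + 1) (by omega)
      have h2 : ∑ i ∈ Finset.range (k + 1 + 1), e (f i) + e (f (k + 1 + 1)) * c (k + 1)
          = (∑ i ∈ Finset.range (k + 1), e (f i) + e (f (k + 1)) * c k)
            + e (f (k + 1)) * (c (k + 1) - c k) := by
        rw [Finset.sum_range_succ]
        linear_combination h1
      rw [h2]
      refine (norm_add_le _ _).trans ?_
      have h3 : ‖e (f (k + 1)) * (c (k + 1) - c k)‖ = y k - y (k + 1) := by
        rw [norm_mul, norm_e, one_mul]
        have : c (k + 1) - c k = ((y (k + 1) - y k : ℝ) : ℂ) * Complex.I := by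
          simp only [hc]; push_cast; ring
        rw [this, norm_mul, Complex.norm_I, mul_one, Complex.norm_real, Real.norm_eq_abs,
          abs_of_nonpos (by linarith [hymono k (by omega)])]
        ring
      rw [h3]; linarith
  have hk := key m le_rfl
  have h1 : ‖∑ i ∈ Finset.range (m + 1), e (f i)‖ ≤
      ‖∑ i ∈ Finset.range (m + 1), e (f i) + e (f (m + 1)) * c m‖ + ‖e (f (m + 1)) * c m‖ := by
    have := norm_sub_le (∑ i ∈ Finset.range (m + 1), e (f i) + e (f (m + 1)) * c m)
      (e (f (m + 1)) * c m)
    simpa using this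
  rw [norm_mul, norm_e, one_mul] at h1
  have h2 := hcb m (by omega)
  have h3 := abs_le.1 (hyb 0 (by omega))
  have h4 := abs_le.1 (hyb m (by omega))
  -- Four quarters: the initial `c 0`, the two values of `|y|`, and the boundary term `c m`.
  have h5 : 1 / κ = 4 * (1 / (4 * κ)) := by field_simp
  rw [h5]; linarith

/-- The Kusmin-Landau inequality. -/
lemma kusmin_landau {κ : ℝ} (hκ : 0 < κ) (j : ℤ) (f : ℕ → ℝ) (n : ℕ)
    (hmono : ∀ i, i + 1 < n → f (i + 1) - f i ≤ f (i + 2) - f (i + 1))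
    (hlow : ∀ i < n, j + κ ≤ f (i + 1) - f i) (hup : ∀ i < n, f (i + 1) - f i ≤ j + 1 - κ) :
    ‖∑ i ∈ Finset.range n, e (f i)‖ ≤ 1 / κ := by
  have h := kusmin_landau_zero hκ (fun i => f i - j * i) n
    (fun i hi => by have := hmono i hi; push_cast; linarith)
    (fun i hi => by have := hlow i hi; push_cast; linarith)
    (fun i hi => by have := hup i hi; push_cast; linarith)
  have h2 : ∀ i : ℕ, e (f i - j * i) = e (f i) := by
    intro i
    rw [show f i - j * i = f i + ((-(j * i) : ℤ) : ℝ) by push_cast; ring, e_add, e_int, mul_one]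
  simpa [h2] using h

lemma kusmin_landau_Ico {κ : ℝ} (hκ : 0 < κ) (j : ℤ) (f : ℕ → ℝ) (a b : ℕ)
    (hmono : ∀ i, a ≤ i → i + 1 < b → f (i + 1) - f i ≤ f (i + 2) - f (i + 1))
    (hlow : ∀ i, a ≤ i → i < b → j + κ ≤ f (i + 1) - f i)
    (hup : ∀ i, a ≤ i → i < b → f (i + 1) - f i ≤ j + 1 - κ) :
    ‖∑ i ∈ Finset.Ico a b, e (f i)‖ ≤ 1 / κ := by
  rw [Finset.sum_Ico_eq_sum_range]
  exact kusmin_landau hκ j (fun i => f (a + i)) (b - a)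
    (fun i hi => hmono (a + i) (by omega) (by omega))
    (fun i hi => hlow (a + i) (by omega) (by omega))
    (fun i hi => hup (a + i) (by omega) (by omega))

lemma add_mul_le_of_diff_ge {g : ℕ → ℝ} {lam : ℝ} {n : ℕ}
    (hg : ∀ i < n, lam ≤ g (i + 1) - g i) {i j : ℕ} (hij : i ≤ j) (hj : j ≤ n) :
    g i + lam * ((j : ℝ) - i) ≤ g j := by
  induction j, hij using Nat.le_induction with
  | base => simp
  | succ j hij ih =>
    have := ih (by omega)
    have := hg j (by omega)
    push_cast; linarith

lemma le_add_mul_of_diff_le {g : ℕ → ℝ} {lam : ℝ} {n : ℕ}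
    (hg : ∀ i < n, g (i + 1) - g i ≤ lam) : g n ≤ g 0 + lam * n := by
  induction n with
  | zero => simp
  | succ j ih =>
    have := ih (fun i hi => hg i (by omega))
    have := hg j (by omega)
    push_cast; linarith

/-- A sequence that grows by at least `lam` at each step stays in a window of width `w` for at most
`w/lam + 1` indices. -/
lemma card_filter_le_of_diff_ge {g : ℕ → ℝ} {lam : ℝ} (hlam : 0 < lam) {n : ℕ}
    (hg : ∀ i < n, lam ≤ g (i + 1) - g i) (S : Finset ℕ) (hS : ∀ i ∈ S, i < n) {a w : ℝ}
    (hw : 0 ≤ w) (hSg : ∀ i ∈ S, a ≤ g i ∧ g i ≤ a + w) : (S.card : ℝ) ≤ w / lam + 1 := by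
  rcases S.eq_empty_or_nonempty with rfl | hne
  · simp; positivity
  have h1 := S.min'_mem hne
  have h2 := S.max'_mem hne
  have h3 : S ⊆ Finset.Icc (S.min' hne) (S.max' hne) := fun i hi =>
    Finset.mem_Icc.2 ⟨S.min'_le i hi, S.le_max' i hi⟩
  have hle : S.min' hne ≤ S.max' hne := S.min'_le _ h2
  have h4 := Finset.card_le_card h3
  rw [Nat.card_Icc] at h4
  have h5 := add_mul_le_of_diff_ge hg hle (hS _ h2).le
  have h6 := hSg _ h1
  have h7 := hSg _ h2
  have h8 : (S.card : ℝ) ≤ (S.max' hne : ℝ) - S.min' hne + 1 := by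
    have : S.card + S.min' hne ≤ S.max' hne + 1 := by omega
    have : (S.card : ℝ) + S.min' hne ≤ S.max' hne + 1 := by exact_mod_cast this
    linarith
  have h9 : ((S.max' hne : ℝ) - S.min' hne) ≤ w / lam := by
    rw [le_div_iff₀ hlam]; nlinarith
  linarith

/-- Van der Corput's second derivative test, in terms of second differences. -/
lemma van_der_corput {lam mu : ℝ} (hlam : 0 < lam) (f : ℕ → ℝ) (n : ℕ)
    (hlow : ∀ i < n, lam ≤ (f (i + 2) - f (i + 1)) - (f (i + 1) - f i))
    (hup : ∀ i < n, (f (i + 2) - f (i + 1)) - (f (i + 1) - f i) ≤ mu) :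
    ‖∑ i ∈ Finset.range n, e (f i)‖ ≤ (mu * n + 2) * (2 + 3 / √lam) := by
  classical
  rcases Nat.eq_zero_or_pos n with rfl | hn
  · simp; positivity
  set g : ℕ → ℝ := fun i => f (i + 1) - f i with hg
  have hg1 : ∀ i < n, lam ≤ g (i + 1) - g i := hlow
  have hg2 : ∀ i < n, g (i + 1) - g i ≤ mu := hup
  have hgmono : ∀ i j, i ≤ j → j ≤ n → g i ≤ g j := by
    intro i j hij hj
    have := add_mul_le_of_diff_ge hg1 hij hj
    have h0 : (0 : ℝ) ≤ (j : ℝ) - i := by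
      have : (i : ℝ) ≤ j := by exact_mod_cast hij
      linarith
    nlinarith
  -- Balances the Kusmin-Landau bound `1/κ` against the `κ/lam` indices whose difference lies within
  -- `κ` of an integer.
  set κ := √lam with hκdef
  have hκ : 0 < κ := Real.sqrt_pos.2 hlam
  have hκlam : κ / lam = 1 / κ := by
    rw [div_eq_div_iff hlam.ne' hκ.ne', one_mul]; exact Real.mul_self_sqrt hlam.le
  -- Group the indices by the integer part of the first difference `g`. As `g` grows by at most `mu
  -- n` in total, there are at most `mu n + 2` groups.
  have hmaps : ∀ i ∈ Finset.range n, ⌊g i⌋ ∈ Finset.Icc ⌊g 0⌋ ⌊g n⌋ := by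
    intro i hi
    have hi := Finset.mem_range.1 hi
    exact Finset.mem_Icc.2 ⟨Int.floor_le_floor (hgmono 0 i (by omega) hi.le),
      Int.floor_le_floor (hgmono i n hi.le le_rfl)⟩
  rw [← Finset.sum_fiberwise_of_maps_to hmaps]
  have hper : ∀ j ∈ Finset.Icc ⌊g 0⌋ ⌊g n⌋,
      ‖∑ i ∈ Finset.range n with ⌊g i⌋ = j, e (f i)‖ ≤ 2 + 3 / κ := by
    intro j _
    set S := (Finset.range n).filter (fun i => ⌊g i⌋ = j)
    have hSn : ∀ i ∈ S, i < n := fun i hi => Finset.mem_range.1 (Finset.mem_filter.1 hi).1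
    have hSj : ∀ i ∈ S, (j : ℝ) ≤ g i ∧ g i < j + 1 := by
      intro i hi
      have := (Finset.mem_filter.1 hi).2
      exact Int.floor_eq_iff.1 this
    set P : ℕ → Prop := fun i => (j : ℝ) + κ ≤ g i ∧ g i ≤ j + 1 - κ
    rw [← Finset.sum_filter_add_sum_filter_not S P]
    have hmid : ‖∑ i ∈ S with P i, e (f i)‖ ≤ 1 / κ := by
      set T := S.filter P with hT
      rcases T.eq_empty_or_nonempty with h0 | hne
      · rw [h0]; simp; positivity
      -- Since `g` is monotone, the indices with `g` away from the integers form one interval, as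
      -- Kusmin-Landau requires.
      have hTIco : T = Finset.Ico (T.min' hne) (T.max' hne + 1) := by
        ext i
        constructor
        · intro hi
          exact Finset.mem_Ico.2 ⟨T.min'_le i hi, Nat.lt_succ_of_le (T.le_max' i hi)⟩
        · intro hi
          obtain ⟨ha, hb⟩ := Finset.mem_Ico.1 hi
          have hb : i ≤ T.max' hne := Nat.lt_succ_iff.1 hb
          have hm := T.min'_mem hne
          have hM := T.max'_mem hne
          replace hm := Finset.mem_filter.1 hm
          replace hM := Finset.mem_filter.1 hM
          have hMn := hSn _ hM.1
          have e1 : g (T.min' hne) ≤ g i := hgmono _ _ ha (by omega)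
          have e2 : g i ≤ g (T.max' hne) := hgmono _ _ hb (by omega)
          have e3 := hSj _ hm.1
          have e4 := hSj _ hM.1
          rw [hT, Finset.mem_filter]
          refine ⟨Finset.mem_filter.2 ⟨Finset.mem_range.2 (by omega), ?_⟩, ?_, ?_⟩
          · exact Int.floor_eq_iff.2 ⟨by linarith, by linarith⟩
          · linarith [hm.2.1]
          · linarith [hM.2.2]
      rw [hTIco]
      have hmem : ∀ i, T.min' hne ≤ i → i < T.max' hne + 1 → i ∈ T := fun i ha hb => by
        rw [hTIco]; exact Finset.mem_Ico.2 ⟨ha, hb⟩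
      refine kusmin_landau_Ico hκ j f _ _ ?_ ?_ ?_
      · intro i ha hb
        have := hSn i (Finset.mem_filter.1 (hmem i ha (by omega))).1
        have := hlow i this
        linarith
      · intro i ha hb
        exact (Finset.mem_filter.1 (hmem i ha hb)).2.1
      · intro i ha hb
        exact (Finset.mem_filter.1 (hmem i ha hb)).2.2
    have hout : ‖∑ i ∈ S with ¬P i, e (f i)‖ ≤ 2 * (κ / lam + 1) := by
      refine (norm_sum_le _ _).trans ?_
      simp only [norm_e, Finset.sum_const, nsmul_eq_mul, mul_one]
      have hsub : S.filter (fun i => ¬P i) ⊆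
          S.filter (fun i => g i ≤ j + κ) ∪ S.filter (fun i => j + 1 - κ ≤ g i) := by
        intro i hi
        obtain ⟨hiS, hiP⟩ := Finset.mem_filter.1 hi
        by_contra hcon
        simp only [Finset.mem_union, Finset.mem_filter, hiS, true_and, not_or, not_le] at hcon
        exact hiP ⟨hcon.1.le, hcon.2.le⟩
      have c1 := card_filter_le_of_diff_ge hlam hg1 (S.filter (fun i => g i ≤ j + κ))
        (fun i hi => hSn i (Finset.mem_filter.1 hi).1) (a := j) (w := κ) hκ.le
        (fun i hi => ⟨(hSj i (Finset.mem_filter.1 hi).1).1, (Finset.mem_filter.1 hi).2⟩)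
      have c2 := card_filter_le_of_diff_ge hlam hg1 (S.filter (fun i => j + 1 - κ ≤ g i))
        (fun i hi => hSn i (Finset.mem_filter.1 hi).1) (a := j + 1 - κ) (w := κ) hκ.le
        (fun i hi => ⟨(Finset.mem_filter.1 hi).2, by
          have := (hSj i (Finset.mem_filter.1 hi).1).2; linarith⟩)
      have c3 := (Finset.card_le_card hsub).trans (Finset.card_union_le _ _)
      have c4 : ((S.filter (fun i => ¬P i)).card : ℝ) ≤
        (S.filter (fun i => g i ≤ j + κ)).card + (S.filter (fun i => j + 1 - κ ≤ g i)).card := by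
        exact_mod_cast c3
      linarith
    refine (norm_add_le _ _).trans ?_
    rw [hκlam] at hout
    have : 3 / κ = 3 * (1 / κ) := by ring
    linarith
  refine (norm_sum_le _ _).trans ((Finset.sum_le_sum hper).trans ?_)
  rw [Finset.sum_const, nsmul_eq_mul, Int.card_Icc]
  gcongr
  have hle : ⌊g 0⌋ ≤ ⌊g n⌋ := Int.floor_le_floor (hgmono 0 n (by omega) le_rfl)
  have h1 : (((⌊g n⌋ + 1 - ⌊g 0⌋).toNat : ℤ) : ℝ) = (⌊g n⌋ : ℝ) + 1 - ⌊g 0⌋ := by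
    rw [Int.toNat_of_nonneg (by omega)]; push_cast; ring
  have h2 : (((⌊g n⌋ + 1 - ⌊g 0⌋).toNat : ℕ) : ℝ) = (⌊g n⌋ : ℝ) + 1 - ⌊g 0⌋ := by
    rw [← h1]; norm_cast
  rw [h2]
  have := le_add_mul_of_diff_le hg2
  linarith [Int.floor_le (g n), Int.lt_floor_add_one (g 0)]

/-- The second difference is `log(1 - 1/(r+1)²)`; apply `1 - 1/x ≤ log x ≤ x - 1`. -/
lemma log_second_diff {r : ℝ} (hr : 0 < r) :
    1 / (r + 1) ^ 2 ≤ -(Real.log (r + 2) - 2 * Real.log (r + 1) + Real.log r) ∧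
    -(Real.log (r + 2) - 2 * Real.log (r + 1) + Real.log r) ≤ 1 / r ^ 2 := by
  have h0 : Real.log (r * (r + 2) / (r + 1) ^ 2) =
      Real.log (r + 2) - 2 * Real.log (r + 1) + Real.log r := by
    rw [Real.log_div (by positivity) (by positivity), Real.log_mul (by positivity) (by positivity),
      Real.log_pow]
    push_cast; ring
  rw [← h0]
  have hx : 0 < r * (r + 2) / (r + 1) ^ 2 := by positivity
  constructor
  · have := Real.log_le_sub_one_of_pos hx
    have h2 : r * (r + 2) / (r + 1) ^ 2 - 1 = -(1 / (r + 1) ^ 2) := by field_simp; ring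
    linarith
  · have := Real.one_sub_inv_le_log_of_pos hx
    have h2 : 1 - (r * (r + 2) / (r + 1) ^ 2)⁻¹ = -(1 / (r * (r + 2))) := by field_simp; ring
    have h3 : 1 / (r * (r + 2)) ≤ 1 / r ^ 2 := by
      apply one_div_le_one_div_of_le <;> nlinarith
    linarith

/-- Rationalising twice gives the exact value `-2/((a+b)(b+c)(a+c))`, and each factor is at least
`2√r`. -/
lemma sqrt_second_diff {r : ℝ} (hr : 0 < r) :
    |√(r + 2) - 2 * √(r + 1) + √r| ≤ 1 / (4 * (r * √r)) := by
  set a := √(r + 2)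
  set b := √(r + 1)
  set c := √r with hc
  have ha2 : a ^ 2 = r + 2 := Real.sq_sqrt (by linarith)
  have hb2 : b ^ 2 = r + 1 := Real.sq_sqrt (by linarith)
  have hc2 : c ^ 2 = r := Real.sq_sqrt (by linarith)
  have hcb : c ≤ b := Real.sqrt_le_sqrt (by linarith)
  have hca : c ≤ a := Real.sqrt_le_sqrt (by linarith)
  have h1 : a - b = 1 / (a + b) := by
    rw [eq_div_iff (by positivity)]; nlinarith
  have h2 : b - c = 1 / (b + c) := by
    rw [eq_div_iff (by positivity)]; nlinarith
  have h3 : a - c = 2 / (a + c) := by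
    rw [eq_div_iff (by positivity)]; nlinarith
  have h4 : a - 2 * b + c = -(2 / ((a + b) * (b + c) * (a + c))) := by
    have : a - 2 * b + c = (a - b) - (b - c) := by ring
    rw [this, h1, h2, div_sub_div _ _ (by positivity) (by positivity)]
    have : 1 * (b + c) - (a + b) * 1 = -(a - c) := by ring
    rw [this, h3]; field_simp
  rw [h4, abs_neg, abs_of_pos (by positivity), div_le_div_iff₀ (by positivity) (by positivity),
    ← hc2]
  have h5 : (2 * c) * (2 * c) * (2 * c) ≤ (a + b) * (b + c) * (a + c) := by
    gcongr <;> linarith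
  nlinarith

/-- The exponential sum with phase `t log r + β r + κ √r` over a segment of length `≤ 2N` near `N`. -/
lemma exp_sum_log_phase {t N r₀ β κ : ℝ} {n : ℕ} (ht : 1 ≤ t) (hN : 1 ≤ N) (htN : √t ≤ N)
    (hr₀ : N ≤ r₀) (hn : (n : ℝ) ≤ 2 * N) (hrn : r₀ + n ≤ 5 * N) (hκ : |κ| * √(5 * N) ≤ t / 2) :
    ‖∑ i ∈ Finset.range n, Complex.exp (Complex.I *
      ((t * Real.log (r₀ + i) + β * (r₀ + i) + κ * √(r₀ + i) : ℝ) : ℂ))‖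
      ≤ 132 * (√t + N / √t) := by
  -- The minus sign makes the second differences positive, since the logarithm is concave;
  -- conjugation undoes it. The term `β r` disappears from second differences.
  set f : ℕ → ℝ := fun i =>
    -(t * Real.log (r₀ + i) + β * (r₀ + i) + κ * √(r₀ + i)) / (2 * Real.pi) with hf
  have hpi3 := Real.pi_gt_three
  have hpi4 := Real.pi_lt_d2
  have h1 : ∀ i : ℕ, Complex.exp (Complex.I *
      ((t * Real.log (r₀ + i) + β * (r₀ + i) + κ * √(r₀ + i) : ℝ) : ℂ)) =
      (starRingEnd ℂ) (e (f i)) := by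
    intro i
    rw [← e_neg]
    simp only [e, hf]
    congr 1
    push_cast
    field_simp
  simp_rw [h1]
  rw [← map_sum, RCLike.norm_conj]
  have hsd : ∀ i < n, t / (2 * (6 * N) ^ 2) ≤
      2 * Real.pi * ((f (i + 2) - f (i + 1)) - (f (i + 1) - f i)) ∧
      2 * Real.pi * ((f (i + 2) - f (i + 1)) - (f (i + 1) - f i)) ≤ 9 / 8 * t / N ^ 2 := by
    intro i hi
    set r : ℝ := r₀ + i with hr
    have hrN : N ≤ r := by linarith
    have hr5 : r ≤ 5 * N := by
      have : (i : ℝ) ≤ n := by exact_mod_cast hi.le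
      linarith
    have hr0 : 0 < r := by linarith
    have e1 : 2 * Real.pi * ((f (i + 2) - f (i + 1)) - (f (i + 1) - f i)) =
        t * -(Real.log (r + 2) - 2 * Real.log (r + 1) + Real.log r)
          - κ * (√(r + 2) - 2 * √(r + 1) + √r) := by
      simp only [hf]
      push_cast
      rw [show r₀ + ((i : ℝ) + 2) = r + 2 by rw [hr]; ring,
        show r₀ + ((i : ℝ) + 1) = r + 1 by rw [hr]; ring]
      field_simp
      ring
    rw [e1]
    obtain ⟨l1, l2⟩ := log_second_diff hr0
    have l3 := sqrt_second_diff hr0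
    -- The hypothesis on `κ` keeps the square root term below half of the logarithmic one, so the
    -- second difference stays of order `t/N²`.
    have l4 : |κ * (√(r + 2) - 2 * √(r + 1) + √r)| ≤ t / (8 * r ^ 2) := by
      rw [abs_mul]
      calc |κ| * |√(r + 2) - 2 * √(r + 1) + √r| ≤ |κ| * (1 / (4 * (r * √r))) := by gcongr
        _ = |κ| * √r / (4 * r ^ 2) := by
          rw [mul_one_div, div_eq_div_iff (by positivity) (by positivity)]
          have := Real.sq_sqrt hr0.le
          linear_combination (-4 * |κ| * r) * this
        _ ≤ (t / 2) / (4 * r ^ 2) := by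
          gcongr
          exact (mul_le_mul_of_nonneg_left (Real.sqrt_le_sqrt hr5) (abs_nonneg _)).trans hκ
        _ = _ := by ring_nf
    have l5 := abs_le.1 l4
    have hrr : 1 / (4 * r ^ 2) ≤ 1 / (r + 1) ^ 2 := by
      apply one_div_le_one_div_of_le (by positivity); nlinarith
    have l6 : t / (8 * r ^ 2) ≤ t * (1 / (r + 1) ^ 2) / 2 := by
      have : t / (8 * r ^ 2) = t * (1 / (4 * r ^ 2)) / 2 := by field_simp; norm_num
      rw [this]; gcongr
    constructor
    · have : t / (2 * (6 * N) ^ 2) ≤ t * (1 / (r + 1) ^ 2) / 2 := by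
        have : t * (1 / (r + 1) ^ 2) / 2 = t / (2 * (r + 1) ^ 2) := by field_simp
        rw [this]; gcongr; linarith
      have := mul_le_mul_of_nonneg_left l1 (by linarith : (0 : ℝ) ≤ t)
      linarith
    · have h3 := mul_le_mul_of_nonneg_left l2 (by linarith : (0 : ℝ) ≤ t)
      have : 9 / 8 * t / r ^ 2 ≤ 9 / 8 * t / N ^ 2 := by gcongr
      have h4 : 9 / 8 * t / r ^ 2 = t * (1 / r ^ 2) + t / (8 * r ^ 2) := by ring_nf
      linarith
  set lam := t / (2 * (6 * N) ^ 2) / (2 * Real.pi) with hlam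
  set mu := 9 / 8 * t / N ^ 2 / (2 * Real.pi) with hmu
  have hlam0 : 0 < lam := by positivity
  have hv := van_der_corput (mu := mu) hlam0 f n
    (fun i hi => by
      rw [hlam, div_le_iff₀ (by positivity)]; linarith [(hsd i hi).1])
    (fun i hi => by
      rw [hmu, le_div_iff₀ (by positivity)]; linarith [(hsd i hi).2])
  refine hv.trans ?_
  have hst1 : 1 ≤ √t := by rw [← Real.sqrt_one]; exact Real.sqrt_le_sqrt ht
  have htt : √t ^ 2 = t := Real.sq_sqrt (by linarith)
  have b1 : mu * n ≤ t / N := by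
    calc mu * n ≤ mu * (2 * N) := by gcongr
      _ = (9 / (8 * Real.pi)) * (t / N) := by rw [hmu]; field_simp
      _ ≤ 1 * (t / N) := by
        gcongr
        rw [div_le_one (by positivity)]; linarith
      _ = _ := one_mul _
  -- `lam = t/(144 π N²)` and `144 π < 22²`.
  have b2 : √t / (22 * N) ≤ √lam := by
    apply Real.le_sqrt_of_sq_le
    rw [div_pow, htt, hlam, div_div]
    apply div_le_div_of_nonneg_left (by linarith) (by positivity)
    nlinarith
  have b3 : 3 / √lam ≤ 66 * (N / √t) := by
    calc 3 / √lam ≤ 3 / (√t / (22 * N)) := by gcongr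
      _ = _ := by field_simp; norm_num
  have b4 : t / N ≤ √t := by
    rw [div_le_iff₀ (by linarith)]; nlinarith
  have b5 : (t / N) * (N / √t) = √t := by
    field_simp
    exact htt.symm
  calc (mu * n + 2) * (2 + 3 / √lam) ≤ (t / N + 2) * (2 + 66 * (N / √t)) := by
        gcongr
    _ = 2 * (t / N) + 66 * ((t / N) * (N / √t)) + 4 + 132 * (N / √t) := by ring
    _ ≤ 2 * √t + 66 * √t + 4 * √t + 132 * (N / √t) := by rw [b5]; linarith
    _ ≤ _ := by linarith

/-! ### Trigonometric polynomials -/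

lemma continuous_trigPoly (a : ℕ → ℂ) (n : ℕ) (α : ℝ) :
    Continuous fun u : ℝ => ∑ j ∈ Finset.range n, a j * e (j * (α - u)) := by
  have := continuous_e
  fun_prop

lemma integral_e_int_mul {m : ℤ} (hm : m ≠ 0) (α : ℝ) :
    ∫ u in (0 : ℝ)..1, e (m * (α - u)) = 0 := by
  have h1 : ∀ u : ℝ, e (m * (α - u)) = e (m * α) * Complex.exp (-(2 * Real.pi * Complex.I * m) * u) := by
    intro u
    simp only [e, ← Complex.exp_add]
    congr 1
    push_cast; ring
  simp_rw [h1]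
  have hc : -(2 * Real.pi * Complex.I * m) ≠ 0 := by
    simp [Real.pi_ne_zero, hm]
  rw [intervalIntegral.integral_const_mul, integral_exp_mul_complex hc]
  have : Complex.exp (-(2 * Real.pi * Complex.I * m) * (1 : ℝ)) = 1 := by
    rw [Complex.exp_eq_one_iff]
    exact ⟨-m, by push_cast; ring⟩
  rw [this]
  simp

/-- Parseval's identity, by orthogonality of the integer frequencies. -/
lemma integral_norm_sq_trigPoly (a : ℕ → ℂ) (n : ℕ) (α : ℝ) :
    ∫ u in (0 : ℝ)..1, ‖∑ j ∈ Finset.range n, a j * e (j * (α - u))‖ ^ 2 =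
      ∑ j ∈ Finset.range n, ‖a j‖ ^ 2 := by
  have h0 := continuous_e
  have h1 : ∀ u : ℝ, ((‖∑ j ∈ Finset.range n, a j * e (j * (α - u))‖ ^ 2 : ℝ) : ℂ) =
      ∑ j ∈ Finset.range n, ∑ k ∈ Finset.range n,
        (a j * (starRingEnd ℂ) (a k)) * e (((j : ℤ) - (k : ℤ) : ℤ) * (α - u)) := by
    intro u
    rw [Complex.ofReal_pow, ← Complex.mul_conj', map_sum, Finset.sum_mul_sum]
    refine Finset.sum_congr rfl fun j _ => Finset.sum_congr rfl fun k _ => ?_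
    rw [map_mul, ← e_neg]
    have : e (((j : ℤ) - (k : ℤ) : ℤ) * (α - u)) = e (j * (α - u)) * e (-(k * (α - u))) := by
      rw [← e_add]; congr 1; push_cast; ring
    rw [this]; ring
  have h2 : ((∫ u in (0 : ℝ)..1, ‖∑ j ∈ Finset.range n, a j * e (j * (α - u))‖ ^ 2 : ℝ) : ℂ) =
      ((∑ j ∈ Finset.range n, ‖a j‖ ^ 2 : ℝ) : ℂ) := by
    rw [← intervalIntegral.integral_ofReal]
    simp_rw [h1]
    rw [intervalIntegral.integral_finsetSum]
    · push_cast
      refine Finset.sum_congr rfl fun j hj => ?_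
      rw [intervalIntegral.integral_finsetSum]
      · rw [Finset.sum_eq_single j]
        · simp [e_zero, Complex.mul_conj']
        · intro k _ hk
          have hjk : (j : ℤ) - k ≠ 0 := by omega
          have := integral_e_int_mul hjk α
          push_cast at this
          rw [intervalIntegral.integral_const_mul, this, mul_zero]
        · intro h; exact absurd hj h
      · intro k _
        exact (by fun_prop : Continuous _).intervalIntegrable _ _
    · intro j _
      exact (by fun_prop : Continuous _).intervalIntegrable _ _
  exact_mod_cast h2

lemma integral_inv_one_add_mul_sq {c : ℝ} (hc : 0 < c) :
    ∫ v in (0 : ℝ)..1, (1 + (c * v) ^ 2)⁻¹ ≤ Real.pi / 2 / c := by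
  have := intervalIntegral.integral_comp_mul_left (a := 0) (b := 1)
    (fun x : ℝ => (1 + x ^ 2)⁻¹) hc.ne'
  rw [this, integral_inv_one_add_sq, smul_eq_mul]
  rw [div_eq_inv_mul]
  gcongr
  simp only [mul_zero, Real.arctan_zero, sub_zero]
  exact (Real.arctan_lt_pi_div_two _).le

/-- By Jordan's inequality `|1 - e(v)|` is at least four times the distance of `v` to the nearest
integer, so the integrand is dominated by two arctangent kernels of width about `1/L`. -/
lemma integral_inv_one_add_norm_one_sub_e {L : ℝ} (hL : 0 < L) (α : ℝ) :
    ∫ u in (0 : ℝ)..1, (1 + L ^ 2 * ‖1 - e (α - u)‖ ^ 2)⁻¹ ≤ 1 / L := by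
  have h0 := continuous_e
  set g : ℝ → ℝ := fun v => (1 + L ^ 2 * ‖1 - e v‖ ^ 2)⁻¹ with hg
  have hgc : Continuous g := by
    apply Continuous.inv₀ (by fun_prop)
    intro v; positivity
  have hper : Function.Periodic g 1 := by
    intro v
    simp only [hg, e_add]
    rw [show (1 : ℝ) = ((1 : ℤ) : ℝ) by simp, e_int, mul_one]
  have h1 : ∫ u in (0 : ℝ)..1, g (α - u) = ∫ v in (0 : ℝ)..1, g v := by
    rw [intervalIntegral.integral_comp_sub_left g]
    have := hper.intervalIntegral_add_eq (α - 1) 0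
    simpa using this
  change ∫ u in (0 : ℝ)..1, g (α - u) ≤ 1 / L
  rw [h1]
  have hpos : ∀ x : ℝ, 0 < 1 + x ^ 2 := fun x => by positivity
  have hc1 : Continuous fun v : ℝ => (1 + (4 * L * v) ^ 2)⁻¹ :=
    Continuous.inv₀ (by fun_prop) fun v => (hpos _).ne'
  have hc2 : Continuous fun v : ℝ => (1 + (4 * L * (1 - v)) ^ 2)⁻¹ :=
    Continuous.inv₀ (by fun_prop) fun v => (hpos _).ne'
  have h2 : ∫ v in (0 : ℝ)..1, g v ≤
      ∫ v in (0 : ℝ)..1, ((1 + (4 * L * v) ^ 2)⁻¹ + (1 + (4 * L * (1 - v)) ^ 2)⁻¹) := by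
    apply intervalIntegral.integral_mono_on zero_le_one (hgc.intervalIntegrable _ _)
      ((hc1.add hc2).intervalIntegrable _ _)
    intro v hv
    simp only [hg, norm_one_sub_e_sq, Pi.add_apply]
    have hpi := Real.pi_pos
    rcases le_total v (1 / 2) with h | h
    · have h3 : 2 * v ≤ Real.sin (Real.pi * v) := by
        have := Real.mul_le_sin (x := Real.pi * v) (by nlinarith [hv.1]) (by nlinarith)
        calc 2 * v = 2 / Real.pi * (Real.pi * v) := by field_simp
          _ ≤ _ := this
      have h4 : (1 + L ^ 2 * (4 * Real.sin (Real.pi * v) ^ 2))⁻¹ ≤ (1 + (4 * L * v) ^ 2)⁻¹ := by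
        apply inv_anti₀ (hpos _)
        have : (2 * v) ^ 2 ≤ Real.sin (Real.pi * v) ^ 2 := by
          apply pow_le_pow_left₀ _ h3; linarith [hv.1]
        nlinarith [mul_le_mul_of_nonneg_left this (sq_nonneg L)]
      have := inv_pos.2 (hpos (4 * L * (1 - v)))
      linarith
    · have h3 : 2 * (1 - v) ≤ Real.sin (Real.pi * v) := by
        have := Real.mul_le_sin (x := Real.pi * (1 - v)) (by nlinarith [hv.2]) (by nlinarith)
        rw [show Real.pi * (1 - v) = Real.pi - Real.pi * v by ring, Real.sin_pi_sub] at this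
        calc 2 * (1 - v) = 2 / Real.pi * (Real.pi - Real.pi * v) := by field_simp
          _ ≤ _ := this
      have h4 : (1 + L ^ 2 * (4 * Real.sin (Real.pi * v) ^ 2))⁻¹ ≤
          (1 + (4 * L * (1 - v)) ^ 2)⁻¹ := by
        apply inv_anti₀ (hpos _)
        have : (2 * (1 - v)) ^ 2 ≤ Real.sin (Real.pi * v) ^ 2 := by
          apply pow_le_pow_left₀ _ h3; linarith [hv.2]
        nlinarith [mul_le_mul_of_nonneg_left this (sq_nonneg L)]
      have := inv_pos.2 (hpos (4 * L * v))
      linarith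
  have h3 : ∫ v in (0 : ℝ)..1, (1 + (4 * L * (1 - v)) ^ 2)⁻¹ =
      ∫ v in (0 : ℝ)..1, (1 + (4 * L * v) ^ 2)⁻¹ := by
    have := intervalIntegral.integral_comp_sub_left (a := 0) (b := 1)
      (fun v : ℝ => (1 + (4 * L * v) ^ 2)⁻¹) 1
    simpa using this
  rw [intervalIntegral.integral_add (hc1.intervalIntegrable _ _) (hc2.intervalIntegrable _ _),
    h3] at h2
  have h4 := integral_inv_one_add_mul_sq (c := 4 * L) (by positivity)
  have h5 : Real.pi / 2 / (4 * L) ≤ 1 / 2 / L := by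
    rw [div_le_div_iff₀ (by positivity) hL]
    nlinarith [Real.pi_le_four]
  have : 1 / L = 1 / 2 / L + 1 / 2 / L := by field_simp; norm_num
  linarith

/-- Multiplication by `1 - e(x)` differences the coefficients; their vanishing at `0` and `n`
removes the boundary terms. -/
lemma one_sub_e_mul_trigPoly (d : ℕ → ℂ) (n : ℕ) (h0 : d 0 = 0) (hn : d n = 0) (x : ℝ) :
    (1 - e x) * ∑ j ∈ Finset.range n, d j * e (j * x) =
      e x * ∑ j ∈ Finset.range n, (d (j + 1) - d j) * e (j * x) := by
  have h1 := Finset.sum_range_sub (fun j => d j * e (j * x)) n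
  have h2 : ∀ j : ℕ, e x * ((d (j + 1) - d j) * e (j * x)) =
      (d (j + 1) * e ((j + 1 : ℕ) * x) - d j * e (j * x)) + (1 - e x) * (d j * e (j * x)) := by
    intro j
    have : e ((j + 1 : ℕ) * x) = e (j * x) * e x := by
      rw [← e_add]; congr 1; push_cast; ring
    rw [this]; ring
  rw [Finset.mul_sum, Finset.mul_sum, Finset.sum_congr rfl fun j _ => h2 j,
    Finset.sum_add_distrib, h1]
  simp [h0, hn]

/-- An `L¹` bound for a trigonometric polynomial whose coefficients vary on the scale `L`. -/
lemma integral_norm_trigPoly_le (d : ℕ → ℂ) (n : ℕ) (h0 : d 0 = 0) (hn : d n = 0) (α : ℝ)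
    {L E : ℝ} (hL : 0 < L) (hE : 0 ≤ E)
    (hd : ∑ j ∈ Finset.range n, ‖d j‖ ^ 2 + L ^ 2 * ∑ j ∈ Finset.range n, ‖d (j + 1) - d j‖ ^ 2
      ≤ L * E ^ 2) :
    ∫ u in (0 : ℝ)..1, ‖∑ j ∈ Finset.range n, d j * e (j * (α - u))‖ ≤ E := by
  have he := continuous_e
  set P : ℝ → ℂ := fun u => ∑ j ∈ Finset.range n, d j * e (j * (α - u)) with hP
  set D : ℝ → ℂ := fun u => ∑ j ∈ Finset.range n, (d (j + 1) - d j) * e (j * (α - u)) with hD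
  have hPc : Continuous P := continuous_trigPoly _ _ _
  set w : ℝ → ℝ := fun u => 1 + L ^ 2 * ‖1 - e (α - u)‖ ^ 2 with hw
  have hwc : Continuous w := by fun_prop
  have hw0 : ∀ u, 0 < w u := fun u => by positivity
  have hwi : Continuous fun u => (w u)⁻¹ := hwc.inv₀ fun u => (hw0 u).ne'
  have hPD : ∀ u, w u * ‖P u‖ ^ 2 = ‖P u‖ ^ 2 + L ^ 2 * ‖D u‖ ^ 2 := by
    intro u
    have := congrArg norm (one_sub_e_mul_trigPoly d n h0 hn (α - u))
    rw [norm_mul, norm_mul, norm_e, one_mul] at this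
    change ‖1 - e (α - u)‖ * ‖P u‖ = ‖D u‖ at this
    rw [← this, hw]; ring
  -- Weighted Cauchy-Schwarz in additive form: `‖P‖ ≤ (s/2) w⁻¹ + w ‖P‖²/(2s)`. The integral of
  -- `w⁻¹` is at most `1/L`, and Parseval evaluates that of `w ‖P‖²`. The best choice is `s = L E`;
  -- for `E = 0` let `s → 0`.
  have hmain : ∀ s : ℝ, 0 < s → ∫ u in (0 : ℝ)..1, ‖P u‖ ≤ (s / L + L * E ^ 2 / s) / 2 := by
    intro s hs
    have h1 : ∫ u in (0 : ℝ)..1, ‖P u‖ ≤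
        ∫ u in (0 : ℝ)..1, ((s / 2) * (w u)⁻¹ + (1 / (2 * s)) * (‖P u‖ ^ 2 + L ^ 2 * ‖D u‖ ^ 2)) := by
      apply intervalIntegral.integral_mono_on zero_le_one
        (hPc.norm.intervalIntegrable _ _) ((by fun_prop : Continuous _).intervalIntegrable _ _)
      intro u _
      rw [← hPD]
      have h2 := hw0 u
      have h3 : (s / 2) * (w u)⁻¹ + (1 / (2 * s)) * (w u * ‖P u‖ ^ 2) - ‖P u‖ =
          (s - w u * ‖P u‖) ^ 2 / (2 * s * w u) := by field_simp; ring
      have : 0 ≤ (s - w u * ‖P u‖) ^ 2 / (2 * s * w u) := by positivity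
      linarith
    have hi1 : IntervalIntegrable (fun u => (s / 2) * (w u)⁻¹) MeasureTheory.volume 0 1 :=
      (by fun_prop : Continuous _).intervalIntegrable _ _
    have hi2 : IntervalIntegrable (fun u => (1 / (2 * s)) * (‖P u‖ ^ 2 + L ^ 2 * ‖D u‖ ^ 2))
      MeasureTheory.volume 0 1 := (by fun_prop : Continuous _).intervalIntegrable _ _
    have hi3 : IntervalIntegrable (fun u => ‖P u‖ ^ 2) MeasureTheory.volume 0 1 :=
      (by fun_prop : Continuous _).intervalIntegrable _ _
    have hi4 : IntervalIntegrable (fun u => L ^ 2 * ‖D u‖ ^ 2) MeasureTheory.volume 0 1 :=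
      (by fun_prop : Continuous _).intervalIntegrable _ _
    rw [intervalIntegral.integral_add hi1 hi2, intervalIntegral.integral_const_mul,
      intervalIntegral.integral_const_mul, intervalIntegral.integral_add hi3 hi4,
      intervalIntegral.integral_const_mul, integral_norm_sq_trigPoly,
      integral_norm_sq_trigPoly (fun j => d (j + 1) - d j)] at h1
    have h4 := integral_inv_one_add_norm_one_sub_e hL α
    have h5 : s / 2 * ∫ u in (0 : ℝ)..1, (w u)⁻¹ ≤ s / 2 * (1 / L) := by gcongr
    have h6 := mul_le_mul_of_nonneg_left hd (by positivity : 0 ≤ 1 / (2 * s))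
    have h7 : (s / L + L * E ^ 2 / s) / 2 = s / 2 * (1 / L) + 1 / (2 * s) * (L * E ^ 2) := by
      field_simp
    linarith
  rcases hE.eq_or_lt with rfl | hE
  · apply le_of_forall_pos_le_add
    intro η hη
    have := hmain (2 * L * η) (by positivity)
    refine this.trans (le_of_eq ?_)
    field_simp; ring
  · have := hmain (L * E) (by positivity)
    refine this.trans (le_of_eq ?_)
    field_simp; ring

/-! ### Bessel functions -/

lemma abs_besselJ_le_one (ν : ℕ) (x : ℝ) : |besselJ ν x| ≤ 1 := by
  have hpi := Real.pi_pos
  have h := intervalIntegral.norm_integral_le_of_norm_le_const (a := 0) (b := Real.pi) (C := 1)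
    (f := fun θ => Real.cos (ν * θ - x * Real.sin θ)) (fun θ _ => Real.abs_cos_le_one _)
  rw [besselJ, abs_mul, abs_of_pos (by positivity : 0 < 1 / Real.pi)]
  rw [Real.norm_eq_abs, sub_zero, abs_of_pos hpi, one_mul] at h
  calc 1 / Real.pi * _ ≤ 1 / Real.pi * Real.pi := by gcongr
    _ = 1 := by field_simp

/-- Integrate the derivative of `sin((ν+1)θ - x sin θ)` over `[0, π]`: the boundary values vanish
because `ν` is an integer. -/
lemma besselJ_recurrence (ν : ℕ) (x : ℝ) :
    2 * (ν + 1) * besselJ (ν + 1) x = x * (besselJ ν x + besselJ (ν + 2) x) := by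
  have hd : ∀ θ ∈ Set.uIcc 0 Real.pi,
      HasDerivAt (fun θ : ℝ => Real.sin ((ν + 1) * θ - x * Real.sin θ))
        (Real.cos ((ν + 1) * θ - x * Real.sin θ) * ((ν + 1) * 1 - x * Real.cos θ)) θ := by
    intro θ _
    exact (((hasDerivAt_id θ).const_mul ((ν : ℝ) + 1)).sub
      ((Real.hasDerivAt_sin θ).const_mul x)).sin
  have h1 := intervalIntegral.integral_eq_sub_of_hasDerivAt hd
    ((by fun_prop : Continuous _).intervalIntegrable _ _)
  have h2 : Real.sin (((ν : ℝ) + 1) * Real.pi - x * Real.sin Real.pi) = 0 := by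
    rw [Real.sin_pi, mul_zero, sub_zero]
    exact_mod_cast Real.sin_nat_mul_pi (ν + 1)
  rw [h2] at h1
  simp only [Real.sin_zero, mul_zero, sub_zero] at h1
  have h3 : ∀ θ : ℝ, Real.cos (((ν : ℝ) + 1) * θ - x * Real.sin θ) * ((ν + 1) * 1 - x * Real.cos θ) =
      (ν + 1) * Real.cos (((ν + 1 : ℕ) : ℝ) * θ - x * Real.sin θ) -
      (x / 2) * (Real.cos ((ν : ℝ) * θ - x * Real.sin θ) +
        Real.cos (((ν + 2 : ℕ) : ℝ) * θ - x * Real.sin θ)) := by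
    intro θ
    have e1 : (ν : ℝ) * θ - x * Real.sin θ = ((ν + 1) * θ - x * Real.sin θ) - θ := by ring
    have e2 : ((ν + 2 : ℕ) : ℝ) * θ - x * Real.sin θ = ((ν + 1) * θ - x * Real.sin θ) + θ := by
      push_cast; ring
    have e3 : ((ν + 1 : ℕ) : ℝ) * θ - x * Real.sin θ = (ν + 1) * θ - x * Real.sin θ := by
      push_cast; ring
    rw [e1, e2, e3]
    generalize ((ν : ℝ) + 1) * θ - x * Real.sin θ = a
    rw [Real.cos_sub, Real.cos_add]
    ring
  simp_rw [h3] at h1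
  rw [intervalIntegral.integral_sub ((by fun_prop : Continuous _).intervalIntegrable _ _)
    ((by fun_prop : Continuous _).intervalIntegrable _ _), intervalIntegral.integral_const_mul,
    intervalIntegral.integral_const_mul, intervalIntegral.integral_add
    ((by fun_prop : Continuous _).intervalIntegrable _ _)
    ((by fun_prop : Continuous _).intervalIntegrable _ _)] at h1
  simp only [besselJ]
  linear_combination (2 / Real.pi) * h1

lemma abs_besselJ_succ_le (ν : ℕ) {x : ℝ} (hx : 0 ≤ x) : |besselJ (ν + 1) x| ≤ x := by
  have h := besselJ_recurrence ν x
  have h1 := abs_le.1 (abs_besselJ_le_one ν x)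
  have h2 := abs_le.1 (abs_besselJ_le_one (ν + 2) x)
  have hν : (0 : ℝ) ≤ ν := Nat.cast_nonneg _
  have h3 : |2 * (ν + 1) * besselJ (ν + 1) x| ≤ 2 * x := by
    rw [h, abs_mul, abs_of_nonneg hx]
    have : |besselJ ν x + besselJ (ν + 2) x| ≤ 2 := abs_le.2 ⟨by linarith, by linarith⟩
    nlinarith
  rw [abs_mul, abs_of_pos (by positivity : (0 : ℝ) < 2 * (ν + 1))] at h3
  nlinarith [abs_nonneg (besselJ (ν + 1) x), mul_nonneg hν (abs_nonneg (besselJ (ν + 1) x))]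

/-- Two applications of the recurrence. Quadratic decay at small argument gives absolute convergence
of the sum over `c`. -/
lemma abs_besselJ_add_two_le (ν : ℕ) {x : ℝ} (hx : 0 ≤ x) : |besselJ (ν + 2) x| ≤ x ^ 2 := by
  have h := besselJ_recurrence (ν + 1) x
  have h1 := abs_le.1 (abs_besselJ_succ_le ν hx)
  have h2 := abs_le.1 (abs_besselJ_succ_le (ν + 2) hx)
  have hν : (0 : ℝ) ≤ ν := Nat.cast_nonneg _
  have h3 : |2 * (((ν + 1 : ℕ) : ℝ) + 1) * besselJ (ν + 2) x| ≤ 2 * x ^ 2 := by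
    rw [h, abs_mul, abs_of_nonneg hx]
    have : |besselJ (ν + 1) x + besselJ (ν + 1 + 2) x| ≤ 2 * x :=
      abs_le.2 ⟨by linarith, by linarith⟩
    nlinarith
  rw [abs_mul, abs_of_pos (by positivity)] at h3
  push_cast at h3
  nlinarith [abs_nonneg (besselJ (ν + 2) x), mul_nonneg hν (abs_nonneg (besselJ (ν + 2) x))]

lemma besselJ_even_eq_integral (j : ℕ) (x : ℝ) :
    (2 * Real.pi : ℂ) * besselJ (2 * j) x = ∫ θ in (0 : ℝ)..Real.pi,
      ((starRingEnd ℂ) (e (j * (-(θ / Real.pi)))) * Complex.exp (Complex.I * ((-Real.sin θ * x : ℝ) : ℂ)) +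
        e (j * (-(θ / Real.pi))) * Complex.exp (Complex.I * ((Real.sin θ * x : ℝ) : ℂ))) := by
  have h1 : ∀ θ : ℝ, (starRingEnd ℂ) (e (j * (-(θ / Real.pi)))) *
        Complex.exp (Complex.I * ((-Real.sin θ * x : ℝ) : ℂ)) +
        e (j * (-(θ / Real.pi))) * Complex.exp (Complex.I * ((Real.sin θ * x : ℝ) : ℂ)) =
      ((2 * Real.cos ((2 * j : ℕ) * θ - x * Real.sin θ) : ℝ) : ℂ) := by
    intro θ
    rw [← e_neg, e, e, ← Complex.exp_add, ← Complex.exp_add]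
    push_cast
    rw [Complex.two_cos]
    congr 1 <;> congr 1 <;> field_simp <;> ring
  simp_rw [h1]
  rw [intervalIntegral.integral_ofReal, intervalIntegral.integral_const_mul, besselJ]
  push_cast
  field_simp

/-- Averages against `∑ c_j (-1)^j J_{2j}` are bounded by exponential averages. -/
lemma norm_sum_besselJ_le {ι : Type*} (S : Finset ι) (A : ι → ℂ) (z : ι → ℝ) {b E : ℝ}
    (hb : ∀ σ ∈ Set.Icc (-1 : ℝ) 1, ‖∑ s ∈ S, A s * Complex.exp (Complex.I * ((σ * z s : ℝ) : ℂ))‖ ≤ b)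
    (c : ℕ → ℝ) (n : ℕ)
    (hc : ∫ u in (0 : ℝ)..1, ‖∑ j ∈ Finset.range n, (c j : ℂ) * e (j * (1 / 2 - u))‖ ≤ E) :
    ‖∑ s ∈ S, A s * ((∑ j ∈ Finset.range n, c j * (-1) ^ j * besselJ (2 * j) (z s) : ℝ) : ℂ)‖
      ≤ b * E := by
  have he := continuous_e
  have hpi := Real.pi_pos
  have hb0 : 0 ≤ b := (norm_nonneg _).trans (hb 0 (by simp))
  set w : ℝ → ℂ := fun θ => ∑ j ∈ Finset.range n, (c j : ℂ) * e (j * (1 / 2 - θ / Real.pi)) with hw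
  set G : ℝ → ℂ := fun σ => ∑ s ∈ S, A s * Complex.exp (Complex.I * ((σ * z s : ℝ) : ℂ)) with hG
  -- The sign `(-1)^j` is absorbed as a shift of the trigonometric polynomial by `1/2`. In the
  -- integral below `± sin θ` plays the role of `σ`, so each exponential average is at most `b`.
  have hj : ∀ j : ℕ, e (j * (1 / 2)) = (-1) ^ j := by
    intro j
    induction j with
    | zero => simp [e_zero]
    | succ j ih =>
      rw [show ((j + 1 : ℕ) : ℝ) * (1 / 2) = j * (1 / 2) + 1 / 2 by push_cast; ring, e_add, ih,
        pow_succ]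
      congr 1
      rw [e_eq]
      simp [show 2 * Real.pi * 2⁻¹ = Real.pi by ring]
  have hej : ∀ (j : ℕ) (θ : ℝ), e (j * (1 / 2 - θ / Real.pi)) =
      (-1) ^ j * e (j * (-(θ / Real.pi))) := by
    intro j θ
    rw [← hj, ← e_add]; congr 1; ring
  have hint : (2 * Real.pi : ℂ) * ∑ s ∈ S, A s *
      ((∑ j ∈ Finset.range n, c j * (-1) ^ j * besselJ (2 * j) (z s) : ℝ) : ℂ) =
      ∫ θ in (0 : ℝ)..Real.pi,
        ((starRingEnd ℂ) (w θ) * G (-Real.sin θ) + w θ * G (Real.sin θ)) := by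
    have h1 : ∀ θ : ℝ, (starRingEnd ℂ) (w θ) * G (-Real.sin θ) + w θ * G (Real.sin θ) =
        ∑ s ∈ S, ∑ j ∈ Finset.range n, (A s * (c j * (-1) ^ j)) *
          ((starRingEnd ℂ) (e (j * (-(θ / Real.pi)))) *
              Complex.exp (Complex.I * ((-Real.sin θ * z s : ℝ) : ℂ)) +
            e (j * (-(θ / Real.pi))) * Complex.exp (Complex.I * ((Real.sin θ * z s : ℝ) : ℂ))) := by
      intro θ
      simp only [hw, hG, map_sum, hej, map_mul, map_pow, map_neg, map_one, Complex.conj_ofReal]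
      rw [Finset.sum_mul_sum, Finset.sum_mul_sum, ← Finset.sum_add_distrib,
        Finset.sum_comm (s := S)]
      refine Finset.sum_congr rfl fun j _ => ?_
      rw [← Finset.sum_add_distrib]
      refine Finset.sum_congr rfl fun s _ => ?_
      ring
    simp_rw [h1]
    rw [intervalIntegral.integral_finsetSum, Finset.mul_sum]
    swap
    · intro s _
      exact (by fun_prop : Continuous _).intervalIntegrable _ _
    refine Finset.sum_congr rfl fun s _ => ?_
    rw [intervalIntegral.integral_finsetSum]
    swap
    · intro j _
      exact (by fun_prop : Continuous _).intervalIntegrable _ _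
    simp_rw [intervalIntegral.integral_const_mul, ← besselJ_even_eq_integral]
    push_cast
    rw [Finset.mul_sum, Finset.mul_sum]
    refine Finset.sum_congr rfl fun j _ => ?_
    ring
  have hwE : ∫ θ in (0 : ℝ)..Real.pi, ‖w θ‖ ≤ Real.pi * E := by
    have := intervalIntegral.integral_comp_div (a := 0) (b := Real.pi)
      (fun u : ℝ => ‖∑ j ∈ Finset.range n, (c j : ℂ) * e (j * (1 / 2 - u))‖) hpi.ne'
    rw [zero_div, div_self hpi.ne', smul_eq_mul] at this
    change ∫ θ in (0 : ℝ)..Real.pi, ‖∑ j ∈ Finset.range n, (c j : ℂ) * e (j * (1 / 2 - θ / Real.pi))‖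
      ≤ _
    rw [this]
    gcongr
  have hbound : ‖∫ θ in (0 : ℝ)..Real.pi,
      ((starRingEnd ℂ) (w θ) * G (-Real.sin θ) + w θ * G (Real.sin θ))‖ ≤ 2 * b * (Real.pi * E) := by
    calc _ ≤ ∫ θ in (0 : ℝ)..Real.pi, 2 * b * ‖w θ‖ := by
          apply intervalIntegral.norm_integral_le_of_norm_le hpi.le
          · filter_upwards with θ _
            refine (norm_add_le _ _).trans ?_
            rw [norm_mul, norm_mul, RCLike.norm_conj]
            have h1 := hb (-Real.sin θ) ⟨by linarith [Real.sin_le_one θ],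
              by linarith [Real.neg_one_le_sin θ]⟩
            have h2 := hb (Real.sin θ) ⟨Real.neg_one_le_sin θ, Real.sin_le_one θ⟩
            have h3 := mul_le_mul_of_nonneg_left h1 (norm_nonneg (w θ))
            have h4 := mul_le_mul_of_nonneg_left h2 (norm_nonneg (w θ))
            simp only [hG]
            linarith
          · exact (by fun_prop : Continuous _).intervalIntegrable _ _
      _ ≤ _ := by
        rw [intervalIntegral.integral_const_mul]
        gcongr
  rw [← hint, norm_mul] at hbound
  have h2pi : ‖(2 * Real.pi : ℂ)‖ = 2 * Real.pi := by
    rw [norm_mul, Complex.norm_real, Real.norm_of_nonneg hpi.le]; simp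
  rw [h2pi] at hbound
  have : 2 * Real.pi * (b * E) = 2 * b * (Real.pi * E) := by ring
  rw [← this] at hbound
  exact le_of_mul_le_mul_left hbound (by positivity)

/-- The first differences produced by one use of the Bessel recurrence. -/
noncomputable def besselDiff (c : ℕ → ℝ) (j : ℕ) : ℝ :=
  (c j * (1 / (4 * j + 0)) - c (j + 1) * (1 / (4 * ((j + 1 : ℕ) : ℝ) + 0))) * (1 / (4 * j + 2))

/-- The coefficients produced by using the Bessel recurrence twice. -/
noncomputable def besselShift (c : ℕ → ℝ) : ℕ → ℝ
  | 0 => besselDiff c 0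
  | j + 1 => besselDiff c (j + 1) - besselDiff c j

/-- The recurrence replaces `J_{ν+1}` by `x (J_ν + J_{ν+2})/(2(ν+1))`, and the sign `(-1)^j` turns
the sum of neighbours into a difference of coefficients. Each use thus gains a division by the index
and a difference: for smooth coefficients on the scale `K`, a factor `x/K²`. -/
lemma sum_besselJ_eq_shift (c : ℕ → ℝ) (n : ℕ) (h0 : c 0 = 0) (hn : ∀ j, n ≤ j → c j = 0) (x : ℝ) :
    ∑ j ∈ Finset.range (n + 1), c j * (-1) ^ j * besselJ (2 * j) x =
      x ^ 2 * ∑ j ∈ Finset.range (n + 1), besselShift c j * (-1) ^ j * besselJ (2 * j) x := by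
  set u : ℕ → ℝ := fun j => c j * (1 / (4 * j + 0)) with hu
  have hu0 : u 0 = 0 := by simp [hu, h0]
  have hstep1 : ∀ j, c (j + 1) * besselJ (2 * (j + 1)) x =
      x * u (j + 1) * (besselJ (2 * j + 1) x + besselJ (2 * j + 3) x) := by
    intro j
    have h := besselJ_recurrence (2 * j + 1) x
    rw [show 2 * j + 1 + 1 = 2 * (j + 1) by ring, show 2 * j + 1 + 2 = 2 * j + 3 by ring] at h
    have h4 : besselJ (2 * (j + 1)) x =
        x * (besselJ (2 * j + 1) x + besselJ (2 * j + 3) x) * (1 / (4 * ((j + 1 : ℕ) : ℝ) + 0)) := by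
      rw [← h]; push_cast; field_simp; ring
    rw [h4, hu]; ring
  have hsum1 : ∀ m, ∑ j ∈ Finset.range (m + 1), c j * (-1) ^ j * besselJ (2 * j) x =
      x * (∑ j ∈ Finset.range m, (u j - u (j + 1)) * (-1) ^ j * besselJ (2 * j + 1) x +
        (-1) ^ m * u m * besselJ (2 * m + 1) x) := by
    intro m
    induction m with
    | zero => simp [h0, hu0]
    | succ m ih =>
      rw [Finset.sum_range_succ, ih, Finset.sum_range_succ]
      have := hstep1 m
      rw [show 2 * (m + 1) + 1 = 2 * m + 3 by ring]
      linear_combination (-1) ^ (m + 1) * this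
  have hdiff : ∀ j, besselDiff c j = (u j - u (j + 1)) * (1 / (4 * j + 2)) := fun j => rfl
  have hstep2 : ∀ j, (u j - u (j + 1)) * besselJ (2 * j + 1) x =
      x * besselDiff c j * (besselJ (2 * j) x + besselJ (2 * j + 2) x) := by
    intro j
    have h := besselJ_recurrence (2 * j) x
    have h4 : besselJ (2 * j + 1) x =
        x * (besselJ (2 * j) x + besselJ (2 * j + 2) x) * (1 / (4 * j + 2)) := by
      rw [← h]; push_cast; field_simp; ring
    rw [h4, hdiff]; ring
  have hsum2 : ∀ m, ∑ j ∈ Finset.range (m + 1), (u j - u (j + 1)) * (-1) ^ j * besselJ (2 * j + 1) x =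
      x * (∑ j ∈ Finset.range (m + 1), besselShift c j * (-1) ^ j * besselJ (2 * j) x +
        (-1) ^ m * besselDiff c m * besselJ (2 * m + 2) x) := by
    intro m
    induction m with
    | zero =>
      have := hstep2 0
      simp only [zero_add, Finset.sum_range_one, pow_zero, mul_one, one_mul, mul_zero, besselShift]
        at this ⊢
      rw [this]; ring
    | succ m ih =>
      rw [Finset.sum_range_succ, ih, Finset.sum_range_succ _ (m + 1)]
      have := hstep2 (m + 1)
      simp only [besselShift]
      rw [show 2 * (m + 1) = 2 * m + 2 by ring] at this ⊢
      linear_combination (-1) ^ (m + 1) * this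
  have hun : ∀ j, n ≤ j → u j = 0 := fun j hj => by simp [hu, hn j hj]
  have h1 := hsum1 (n + 1)
  have h2 := hsum2 n
  rw [Finset.sum_range_succ, hn (n + 1) (by omega), hun (n + 1) (by omega), h2, hdiff n,
    hun n le_rfl, hun (n + 1) (by omega)] at h1
  linear_combination h1

/-! ### Finite differences -/

/-- The first `n` finite differences of `f` at points `j ≥ K / 4` are `≤ D / K^(α + i)`. -/
def DiffBound (K D : ℝ) : ℕ → ℕ → (ℕ → ℝ) → Prop
  | 0, α, f => ∀ j : ℕ, K / 4 ≤ j → |f j| ≤ D / K ^ α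
  | n + 1, α, f => (∀ j : ℕ, K / 4 ≤ j → |f j| ≤ D / K ^ α) ∧
      DiffBound K D n (α + 1) (fun j => f (j + 1) - f j)

namespace DiffBound

variable {K D D' : ℝ} {n α β : ℕ} {f g : ℕ → ℝ}

lemma mono_const (hK : 0 < K) (hD : D ≤ D') (h : DiffBound K D n α f) : DiffBound K D' n α f := by
  induction n generalizing α f with
  | zero => intro j hj; exact (h j hj).trans (by gcongr)
  | succ n ih => exact ⟨fun j hj => (h.1 j hj).trans (by gcongr), ih h.2⟩

lemma congr (h : DiffBound K D n α f) (hfg : ∀ j : ℕ, K / 4 ≤ j → f j = g j) :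
    DiffBound K D n α g := by
  induction n generalizing α f g with
  | zero => intro j hj; rw [← hfg j hj]; exact h j hj
  | succ n ih =>
    refine ⟨fun j hj => hfg j hj ▸ h.1 j hj, ih h.2 fun j hj => ?_⟩
    rw [hfg j hj, hfg (j + 1) (by push_cast; linarith)]

lemma of_succ (h : DiffBound K D (n + 1) α f) : DiffBound K D n α f := by
  induction n generalizing α f with
  | zero => exact h.1
  | succ n ih => exact ⟨h.1, ih h.2⟩

lemma shift (h : DiffBound K D n α f) : DiffBound K D n α (fun j => f (j + 1)) := by
  induction n generalizing α f with
  | zero => intro j hj; exact h (j + 1) (by push_cast; linarith)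
  | succ n ih => exact ⟨fun j hj => h.1 (j + 1) (by push_cast; linarith), ih h.2⟩

lemma add (hf : DiffBound K D n α f) (hg : DiffBound K D' n α g) :
    DiffBound K (D + D') n α (fun j => f j + g j) := by
  induction n generalizing α f g with
  | zero =>
    intro j hj
    have := hf j hj; have := hg j hj
    rw [add_div]
    exact (abs_add_le _ _).trans (by linarith)
  | succ n ih =>
    refine ⟨fun j hj => ?_, ?_⟩
    · have := hf.1 j hj; have := hg.1 j hj
      rw [add_div]
      exact (abs_add_le _ _).trans (by linarith)
    · have := ih hf.2 hg.2
      convert this using 2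
      ring

lemma const_mul (a : ℝ) (hf : DiffBound K D n α f) :
    DiffBound K (|a| * D) n α (fun j => a * f j) := by
  induction n generalizing α f with
  | zero =>
    intro j hj
    rw [abs_mul, mul_div_assoc]; exact mul_le_mul_of_nonneg_left (hf j hj) (abs_nonneg _)
  | succ n ih =>
    refine ⟨fun j hj => ?_, ?_⟩
    · rw [abs_mul, mul_div_assoc]; exact mul_le_mul_of_nonneg_left (hf.1 j hj) (abs_nonneg _)
    · have := ih hf.2
      convert this using 2
      ring

/-- Leibniz rule `Δ(fg) = Δf · g(· + 1) + f · Δg`; each difference doubles the constant. -/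
lemma mul (hK : 0 < K) (hD : 0 ≤ D) (hD' : 0 ≤ D') (hf : DiffBound K D n α f)
    (hg : DiffBound K D' n β g) : DiffBound K (2 ^ n * (D * D')) n (α + β) (fun j => f j * g j) := by
  induction n generalizing α β f g with
  | zero =>
    intro j hj
    rw [abs_mul, pow_zero, one_mul, pow_add, mul_div_mul_comm]
    exact mul_le_mul (hf j hj) (hg j hj) (abs_nonneg _) (by positivity)
  | succ n ih =>
    refine ⟨fun j hj => ?_, ?_⟩
    · rw [abs_mul]
      calc |f j| * |g j| ≤ (D / K ^ α) * (D' / K ^ β) :=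
            mul_le_mul (hf.1 j hj) (hg.1 j hj) (abs_nonneg _) (by positivity)
        _ = (1 * (D * D')) / K ^ (α + β) := by rw [pow_add, one_mul, mul_div_mul_comm]
        _ ≤ _ := by gcongr; exact one_le_pow₀ (by norm_num)
    · have h1 := ih hf.2 hg.of_succ.shift
      have h2 := ih hf.of_succ hg.2
      rw [show α + 1 + β = α + β + 1 by ring] at h1
      rw [show α + (β + 1) = α + β + 1 by ring] at h2
      have := h1.add h2
      rw [show 2 ^ n * (D * D') + 2 ^ n * (D * D') = 2 ^ (n + 1) * (D * D') by ring] at this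
      convert this using 2
      ring

/-- The difference of the sequence is `-4` times the product of the sequence with its shift, so the
bounds follow inductively from the product rule. -/
lemma exists_inv (n : ℕ) {b : ℝ} (hb : 0 ≤ b) : ∃ D, 0 ≤ D ∧ ∀ K : ℝ, 0 < K →
    DiffBound K D n 1 (fun j => 1 / (4 * j + b)) := by
  have h0 : ∀ K : ℝ, 0 < K → ∀ j : ℕ, K / 4 ≤ j → |1 / (4 * (j : ℝ) + b)| ≤ 1 / K ^ 1 := by
    intro K hK j hj
    rw [abs_of_pos (by have : 0 < (j : ℝ) := by linarith
                       positivity), pow_one]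
    exact one_div_le_one_div_of_le hK (by linarith)
  induction n with
  | zero => exact ⟨1, zero_le_one, fun K hK => h0 K hK⟩
  | succ n ih =>
    obtain ⟨D, hD, h⟩ := ih
    refine ⟨max 1 (4 * (2 ^ n * (D * D))), by positivity, fun K hK => ⟨fun j hj => ?_, ?_⟩⟩
    · refine (h0 K hK j hj).trans ?_
      gcongr
      exact le_max_left _ _
    · have h1 := ((h K hK).mul hK hD hD (h K hK).shift).const_mul (-4)
      have h2 : |(-4 : ℝ)| * (2 ^ n * (D * D)) ≤ max 1 (4 * (2 ^ n * (D * D))) := by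
        rw [abs_neg, abs_of_pos (by norm_num : (0 : ℝ) < 4)]; exact le_max_right _ _
      have h3 := h1.mono_const hK h2
      refine h3.congr fun j hj => ?_
      have hj0 : 0 < (j : ℝ) := by linarith
      push_cast
      field_simp
      ring

/-- Differencing `F(2j/K)` amounts to replacing `F` by `F(x + 2/K) - F(x)`, whose derivatives are
smaller by `2/K` by the mean value inequality. -/
lemma of_iteratedDeriv {K : ℝ} (hK : 0 < K) {F : ℝ → ℝ} (hF : ContDiff ℝ ∞ F) {D : ℝ} (hD : 0 ≤ D)
    (h : ∀ i ≤ n, ∀ x, |iteratedDeriv i F x| ≤ D / K ^ α) :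
    DiffBound K (2 ^ n * D) n α (fun j => F (2 * j / K)) := by
  induction n generalizing α F D with
  | zero => intro j _; simpa using h 0 le_rfl (2 * j / K)
  | succ n ih =>
    refine ⟨fun j _ => ?_, ?_⟩
    · have := h 0 (by omega) (2 * j / K)
      rw [iteratedDeriv_zero] at this
      refine this.trans ?_
      gcongr
      nlinarith [one_le_pow₀ (by norm_num : (1 : ℝ) ≤ 2) (n := n + 1)]
    · have hG : ContDiff ℝ ∞ (fun x => F (x + 2 / K) - F x) := by fun_prop
      have := ih (α := α + 1) (F := fun x => F (x + 2 / K) - F x) hG (D := 2 * D) (by positivity) ?_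
      · convert this using 1
        · ring
        · funext j
          congr 2
          push_cast; ring_nf
      · intro i hi x
        have hcd : ContDiff ℝ i F := hF.of_le (by exact_mod_cast le_top)
        rw [iteratedDeriv_fun_sub (by fun_prop) (by fun_prop), iteratedDeriv_comp_add_const]
        have hd : Differentiable ℝ (iteratedDeriv i F) :=
          hF.differentiable_iteratedDeriv i (by exact_mod_cast WithTop.coe_lt_top i)
        have := Convex.norm_image_sub_le_of_norm_deriv_le (f := iteratedDeriv i F) (s := Set.univ)
          (x := x) (y := x + 2 / K) (C := D / K ^ α) (fun y _ => hd y)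
          (fun y _ => by
            rw [← iteratedDeriv_succ]; exact h (i + 1) (by omega) y) convex_univ
          (Set.mem_univ _) (Set.mem_univ _)
        rw [Real.norm_eq_abs, Real.norm_eq_abs, add_sub_cancel_left,
          abs_of_pos (by positivity : 0 < 2 / K)] at this
        refine this.trans (le_of_eq ?_)
        rw [pow_succ]
        field_simp

end DiffBound

/-! ### The coefficients of the Bessel sum -/

lemma IsBump.eq_zero_of_lt {B : ℕ → ℝ} {W : ℝ → ℝ} (hW : IsBump B W) {x : ℝ} (hx : x < 1) :
    W x = 0 := by
  by_contra h
  linarith [(hW.supp h).1]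

lemma IsBump.eq_zero_of_gt {B : ℕ → ℝ} {W : ℝ → ℝ} (hW : IsBump B W) {x : ℝ} (hx : 2 < x) :
    W x = 0 := by
  by_contra h
  linarith [(hW.supp h).2]

lemma IsBump.abs_le {B : ℕ → ℝ} {W : ℝ → ℝ} (hW : IsBump B W) (x : ℝ) : |W x| ≤ B 0 := by
  simpa using hW.deriv_le 0 x

lemma IsBump.bound_nonneg {B : ℕ → ℝ} {W : ℝ → ℝ} (hW : IsBump B W) (i : ℕ) : 0 ≤ B i :=
  (abs_nonneg _).trans (hW.deriv_le i 0)

/-- Summation of a bounded sequence supported on `j ≤ X`. -/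
lemma sum_le_of_support {f : ℕ → ℝ} {X b : ℝ} (n : ℕ) (hX : 0 ≤ X) (hb : 0 ≤ b)
    (hf : ∀ j, f j ≤ b) (h0 : ∀ j : ℕ, X < j → f j = 0) :
    ∑ j ∈ Finset.range n, f j ≤ (X + 1) * b := by
  have h1 : ∑ j ∈ Finset.range n, f j ≤ ∑ j ∈ Finset.range n, if (j : ℝ) ≤ X then b else 0 := by
    apply Finset.sum_le_sum
    intro j _
    split_ifs with h
    · exact hf j
    · exact (h0 j (not_le.1 h)).le
  refine h1.trans ?_
  rw [← Finset.sum_filter, Finset.sum_const, nsmul_eq_mul]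
  gcongr
  have h2 : (Finset.range n).filter (fun j : ℕ => (j : ℝ) ≤ X) ⊆ Finset.range (⌊X⌋₊ + 1) := by
    intro j hj
    exact Finset.mem_range.2 (Nat.lt_succ_of_le (Nat.le_floor (Finset.mem_filter.1 hj).2))
  have h3 : (((Finset.range n).filter (fun j : ℕ => (j : ℝ) ≤ X)).card : ℝ) ≤ ⌊X⌋₊ + 1 := by
    have := Finset.card_le_card h2
    rw [Finset.card_range] at this
    exact_mod_cast this
  linarith [Nat.floor_le hX]

/-- The coefficients have size `O(1)`, differences `O(1/K)` and about `K` nonzero terms, so the `L¹`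
bound on the scale `L = K` is independent of `K`. -/
lemma integral_norm_bump_le {B : ℕ → ℝ} {W : ℝ → ℝ} (hW : IsBump B W) {K : ℝ} (hK : 1 ≤ K) {n : ℕ}
    (hn : K < n) :
    ∫ u in (0 : ℝ)..1, ‖∑ j ∈ Finset.range n, ((W (2 * j / K) : ℝ) : ℂ) * e (j * (1 / 2 - u))‖ ≤
      2 * (B 0 + 2 * B 1) := by
  have hK0 : 0 < K := by linarith
  have hB0 := hW.bound_nonneg 0
  have hB1 := hW.bound_nonneg 1
  have hz : ∀ j : ℕ, K < j → W (2 * j / K) = 0 := fun j hj =>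
    hW.eq_zero_of_gt (by rw [lt_div_iff₀ hK0]; linarith)
  have hdiff : ∀ j : ℕ, |W (2 * ((j + 1 : ℕ) : ℝ) / K) - W (2 * j / K)| ≤ 2 * B 1 / K := by
    intro j
    have hd : Differentiable ℝ W := hW.smooth.differentiable (by simp)
    have := Convex.norm_image_sub_le_of_norm_deriv_le (f := W) (s := Set.univ)
          (x := 2 * j / K) (y := 2 * ((j + 1 : ℕ) : ℝ) / K) (C := B 1) (fun y _ => hd y)
          (fun y _ => by rw [← iteratedDeriv_one]; exact hW.deriv_le 1 y) convex_univ
          (Set.mem_univ _) (Set.mem_univ _)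
    have h2 : 2 * ((j + 1 : ℕ) : ℝ) / K - 2 * j / K = 2 / K := by push_cast; ring
    rw [h2, Real.norm_eq_abs, Real.norm_eq_abs, abs_of_pos (by positivity : 0 < 2 / K)] at this
    refine this.trans (le_of_eq (by ring))
  apply integral_norm_trigPoly_le (fun j => ((W (2 * j / K) : ℝ) : ℂ)) n _ _ _ hK0 (by positivity)
  · have h1 := sum_le_of_support (f := fun j : ℕ => ‖((W (2 * j / K) : ℝ) : ℂ)‖ ^ 2) (X := K)
      (b := B 0 ^ 2) n hK0.le (by positivity)
      (fun j => by
        rw [Complex.norm_real, Real.norm_eq_abs]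
        exact pow_le_pow_left₀ (abs_nonneg _) (hW.abs_le _) 2)
      (fun j hj => by simp [hz j hj])
    have h2 := sum_le_of_support
      (f := fun j : ℕ => ‖((W (2 * ((j + 1 : ℕ) : ℝ) / K) : ℝ) : ℂ) - ((W (2 * j / K) : ℝ) : ℂ)‖ ^ 2)
      (X := K) (b := (2 * B 1 / K) ^ 2) n hK0.le (by positivity)
      (fun j => by
        rw [← Complex.ofReal_sub, Complex.norm_real, Real.norm_eq_abs]
        exact pow_le_pow_left₀ (abs_nonneg _) (hdiff j) 2)
      (fun j hj => by
        simp [hz j hj, hz (j + 1) (by push_cast; linarith), -Nat.cast_add])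
    calc _ ≤ (K + 1) * B 0 ^ 2 + K ^ 2 * ((K + 1) * (2 * B 1 / K) ^ 2) := by gcongr
      _ = (K + 1) * (B 0 ^ 2 + 4 * B 1 ^ 2) := by field_simp; ring
      _ ≤ (2 * K) * (B 0 ^ 2 + 4 * B 1 ^ 2) := by gcongr; linarith
      _ ≤ _ := by nlinarith [mul_nonneg hB0 hB1, mul_nonneg hK0.le (mul_nonneg hB0 hB1), mul_nonneg hK0.le (sq_nonneg (B 0)), mul_nonneg hK0.le (sq_nonneg (B 1))]
  · simp [hW.eq_zero_of_lt]
  · simp [hz n hn]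

lemma exists_diffBound_besselDiff (B : ℕ → ℝ) : ∃ D : ℝ, 0 ≤ D ∧ ∀ W : ℝ → ℝ, IsBump B W →
    ∀ K : ℝ, 0 < K → DiffBound K D 2 3 (besselDiff fun j => W (2 * j / K)) := by
  obtain ⟨D₁, hD₁, h₁⟩ := DiffBound.exists_inv 3 le_rfl
  obtain ⟨D₂, hD₂, h₂⟩ := DiffBound.exists_inv 2 (b := 2) (by norm_num)
  set D₀ : ℝ := 2 ^ 3 * (|B 0| + |B 1| + |B 2| + |B 3|) with hD₀
  refine ⟨2 ^ 2 * ((|(-1 : ℝ)| * (2 ^ 3 * (D₀ * D₁))) * D₂), by positivity, fun W hW K hK => ?_⟩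
  have hc : DiffBound K D₀ 3 0 (fun j => W (2 * j / K)) := by
    apply DiffBound.of_iteratedDeriv hK hW.smooth (by positivity)
    intro i hi x
    refine (hW.deriv_le i x).trans ?_
    rw [pow_zero, div_one]
    have h0 := le_abs_self (B 0); have h0' := abs_nonneg (B 0)
    have h1 := le_abs_self (B 1); have h1' := abs_nonneg (B 1)
    have h2 := le_abs_self (B 2); have h2' := abs_nonneg (B 2)
    have h3 := le_abs_self (B 3); have h3' := abs_nonneg (B 3)
    interval_cases i <;> linarith
  -- Three differences are controlled at the start because `besselDiff` consumes one. The orders add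
  -- up to `1 + 1 + 1`: two divisions by the index and one difference.
  have hu := hc.mul hK (by positivity) hD₁ (h₁ K hK)
  have hh := DiffBound.const_mul (-1) hu.2
  have hg := hh.mul hK (by positivity) hD₂ (h₂ K hK)
  refine hg.congr fun j _ => ?_
  simp only [besselDiff]
  ring

/-- The weights obtained after two uses of the Bessel recurrence have `L¹` norm `O(K⁻⁴)`. -/
lemma exists_integral_norm_besselShift_le (B : ℕ → ℝ) : ∃ E : ℝ, 0 ≤ E ∧ ∀ W : ℝ → ℝ, IsBump B W →
    ∀ K : ℝ, 1 ≤ K → ∀ n : ℕ, K + 2 ≤ n →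
    ∫ u in (0 : ℝ)..1, ‖∑ j ∈ Finset.range n,
      ((besselShift (fun j => W (2 * j / K)) j : ℝ) : ℂ) * e (j * (1 / 2 - u))‖ ≤ E / K ^ 4 := by
  obtain ⟨D, hD, hdiff⟩ := exists_diffBound_besselDiff B
  refine ⟨max (28 * |B 0| * 12 ^ 4) (3 * D), by positivity, fun W hW K hK n hn => ?_⟩
  have hK0 : 0 < K := by linarith
  have hB0 := hW.bound_nonneg 0
  set c : ℕ → ℝ := fun j => W (2 * j / K) with hc
  have hz : ∀ j : ℕ, K < j → c j = 0 := fun j hj =>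
    hW.eq_zero_of_gt (by rw [lt_div_iff₀ hK0]; linarith)
  have hz' : ∀ j : ℕ, (j : ℝ) < K / 2 → c j = 0 := fun j hj =>
    hW.eq_zero_of_lt (by rw [div_lt_iff₀ hK0]; linarith)
  have hdz : ∀ j : ℕ, K < j → besselDiff c j = 0 := fun j hj => by
    simp [besselDiff, hz j hj, hz (j + 1) (by push_cast; linarith)]
  have hdz' : ∀ j : ℕ, (j : ℝ) + 1 < K / 2 → besselDiff c j = 0 := fun j hj => by
    simp [besselDiff, hz' j (by linarith), hz' (j + 1) (by push_cast; linarith)]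
  have hsz : ∀ j : ℕ, K + 1 < j → besselShift c j = 0 := by
    intro j hj
    match j, hj with
    | 0, hj => norm_num at hj; linarith
    | j + 1, hj =>
      push_cast at hj
      simp [besselShift, hdz j (by linarith), hdz (j + 1) (by push_cast; linarith)]
  have hcont := continuous_trigPoly (fun j => ((besselShift c j : ℝ) : ℂ)) n (1 / 2)
  -- For `K ≥ 12` one has `K/4 + 3 ≤ K/2`, so every difference below vanishes at `j < K/4`, where
  -- `DiffBound` says nothing. For `K < 12` a bound by a constant suffices.
  rcases lt_or_ge K 12 with h8 | h8
  · have hcb : ∀ j, |c j| ≤ B 0 := fun j => hW.abs_le _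
    have hinv : ∀ j : ℕ, 0 ≤ 1 / (4 * (j : ℝ) + 0) ∧ 1 / (4 * (j : ℝ) + 0) ≤ 1 := by
      intro j
      refine ⟨by positivity, ?_⟩
      -- At `j = 0` the quotient is `1/0 = 0`.
      rcases Nat.eq_zero_or_pos j with rfl | hj
      · simp
      · have : (1 : ℝ) ≤ j := by exact_mod_cast hj
        rw [div_le_one (by positivity)]; linarith
    have hub : ∀ j, |c j * (1 / (4 * (j : ℝ) + 0))| ≤ B 0 := by
      intro j
      rw [abs_mul, abs_of_nonneg (hinv j).1]
      nlinarith [hcb j, hinv j, abs_nonneg (c j)]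
    have hgb : ∀ j, |besselDiff c j| ≤ B 0 := by
      intro j
      simp only [besselDiff]
      rw [abs_mul]
      have h1 := abs_le.1 (hub j)
      have h2 := abs_le.1 (hub (j + 1))
      have h3 : |c j * (1 / (4 * (j : ℝ) + 0)) - c (j + 1) * (1 / (4 * ((j + 1 : ℕ) : ℝ) + 0))| ≤
        2 * B 0 := abs_le.2 ⟨by linarith, by linarith⟩
      have h4 : |1 / (4 * (j : ℝ) + 2)| ≤ 1 / 2 := by
        rw [abs_of_pos (by positivity)]
        apply one_div_le_one_div_of_le <;> norm_num
      nlinarith [abs_nonneg (1 / (4 * (j : ℝ) + 2))]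
    have hsb : ∀ j, |besselShift c j| ≤ 2 * B 0 := by
      intro j
      match j with
      | 0 => have := hgb 0; simp only [besselShift]; linarith
      | j + 1 =>
        have h1 := abs_le.1 (hgb j)
        have h2 := abs_le.1 (hgb (j + 1))
        simp only [besselShift]
        exact abs_le.2 ⟨by linarith, by linarith⟩
    have h1 := sum_le_of_support (f := fun j => |besselShift c j|) n (by positivity : 0 ≤ K + 1)
      (by positivity : 0 ≤ 2 * B 0) hsb (fun j hj => by simp [hsz j hj])
    calc _ ≤ ∫ u in (0 : ℝ)..1, (∑ j ∈ Finset.range n, |besselShift c j|) := by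
          apply intervalIntegral.integral_mono_on zero_le_one
            (hcont.norm.intervalIntegrable _ _) (by simp)
          intro u _
          refine (norm_sum_le _ _).trans (Finset.sum_le_sum fun j _ => ?_)
          rw [norm_mul, norm_e, mul_one, Complex.norm_real, Real.norm_eq_abs]
      _ = ∑ j ∈ Finset.range n, |besselShift c j| := by simp
      _ ≤ 28 * |B 0| := by rw [abs_of_nonneg hB0]; nlinarith
      _ = 28 * |B 0| * 12 ^ 4 / 12 ^ 4 := by ring
      _ ≤ max (28 * |B 0| * 12 ^ 4) (3 * D) / K ^ 4 := by
        gcongr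
        exact le_max_left _ _
  · have hdb := hdiff W hW K hK0
    have h1b : ∀ j : ℕ, |besselDiff c (j + 1) - besselDiff c j| ≤ D / K ^ 4 := by
      intro j
      rcases le_or_gt (K / 4) j with hj | hj
      · exact hdb.2.1 j hj
      · rw [hdz' j (by linarith), hdz' (j + 1) (by push_cast; linarith)]
        simp; positivity
    have h2b : ∀ j : ℕ, |(besselDiff c (j + 2) - besselDiff c (j + 1)) -
        (besselDiff c (j + 1) - besselDiff c j)| ≤ D / K ^ 5 := by
      intro j
      rcases le_or_gt (K / 4) j with hj | hj
      · exact hdb.2.2 j hj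
      · rw [hdz' j (by linarith), hdz' (j + 1) (by push_cast; linarith),
          hdz' (j + 2) (by push_cast; linarith)]
        simp; positivity
    have hs0 : besselShift c 0 = 0 := hdz' 0 (by norm_num; linarith)
    have hs1 : ∀ j, |besselShift c j| ≤ D / K ^ 4 := by
      intro j
      match j with
      | 0 => rw [hs0]; simp; positivity
      | j + 1 => exact h1b j
    have hs2 : ∀ j, |besselShift c (j + 1) - besselShift c j| ≤ D / K ^ 5 := by
      intro j
      match j with
      | 0 =>
        rw [hs0]
        simp only [besselShift]
        rw [hdz' 0 (by norm_num; linarith), hdz' 1 (by norm_num; linarith)]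
        simp; positivity
      | j + 1 => exact h2b j
    refine (integral_norm_trigPoly_le (fun j => ((besselShift c j : ℝ) : ℂ)) n
      (by simp [hs0]) (by simp [hsz n (by linarith)]) _ hK0 (E := 3 * D / K ^ 4) (by positivity) ?_).trans
      (by gcongr; exact le_max_right _ _)
    have h1 := sum_le_of_support (f := fun j : ℕ => ‖((besselShift c j : ℝ) : ℂ)‖ ^ 2) (X := K + 1)
      (b := (D / K ^ 4) ^ 2) n (by positivity) (by positivity)
      (fun j => by
        rw [Complex.norm_real, Real.norm_eq_abs]
        exact pow_le_pow_left₀ (abs_nonneg _) (hs1 j) 2)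
      (fun j hj => by simp [hsz j hj])
    have h2 := sum_le_of_support
      (f := fun j : ℕ => ‖((besselShift c (j + 1) : ℝ) : ℂ) - ((besselShift c j : ℝ) : ℂ)‖ ^ 2)
      (X := K + 1) (b := (D / K ^ 5) ^ 2) n (by positivity) (by positivity)
      (fun j => by
        rw [← Complex.ofReal_sub, Complex.norm_real, Real.norm_eq_abs]
        exact pow_le_pow_left₀ (abs_nonneg _) (hs2 j) 2)
      (fun j hj => by simp [hsz j hj, hsz (j + 1) (by push_cast; linarith)])
    calc _ ≤ (K + 1 + 1) * (D / K ^ 4) ^ 2 + K ^ 2 * ((K + 1 + 1) * (D / K ^ 5) ^ 2) := by gcongr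
      _ = (K + 2) * (2 * (D / K ^ 4) ^ 2) := by field_simp; ring
      _ ≤ (3 * K) * (2 * (D / K ^ 4) ^ 2) := by gcongr; linarith
      _ ≤ (3 * K) * (3 * (D / K ^ 4) ^ 2) := by gcongr; norm_num
      _ = _ := by ring

/-! ### Additive twists of the Fourier coefficients -/

/-- Each coefficient is a Fourier integral of `F` along the line of height `y`. Summing under the
integral pairs `F(u + iy) = O(y^(-k₀/2))` with a trigonometric polynomial. The twist `α` merely
translates that polynomial, hence costs nothing. -/
lemma exists_norm_twisted_sum_le {k₀ : ℤ} (F : CuspForm 𝒮ℒ k₀) : ∃ C : ℝ, 0 ≤ C ∧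
    ∀ (y : ℝ), 0 < y → ∀ (α : ℝ) (D : ℕ → ℂ) (n : ℕ),
      ‖∑ m ∈ Finset.range n, (qExpansion 1 F).coeff m * e (m * α) * D m‖ ≤
        C * y ^ (-(k₀ : ℝ) / 2) * ∫ u in (0 : ℝ)..1, ‖∑ m ∈ Finset.range n,
          (D m * (Real.exp (2 * Real.pi * (m * y)) : ℂ)) * e (m * (α - u))‖ := by
  obtain ⟨C, hC⟩ := CuspFormClass.exists_bound F
  have hC0 : 0 ≤ C := by
    have := (norm_nonneg _).trans (hC UpperHalfPlane.I)
    simpa using this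
  refine ⟨C, hC0, fun y hy α D n => ?_⟩
  have he := continuous_e
  have hcoeff : ∀ m : ℕ, (qExpansion 1 F).coeff m = ∫ u in (0 : ℝ)..1,
      (Real.exp (2 * Real.pi * (m * y)) : ℂ) * e (-(m * u)) *
        F ⟨(u : ℂ) + y * Complex.I, by simpa using hy⟩ := by
    intro m
    have h := ModularFormClass.qExpansion_coeff_eq_intervalIntegral F one_pos (by simp) m hy
    rw [h, Complex.ofReal_one, div_one, one_mul]
    refine intervalIntegral.integral_congr fun u _ => ?_
    congr 1
    rw [Function.Periodic.qParam, ← Complex.exp_nat_mul, one_div, ← Complex.exp_neg, e,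
      Complex.ofReal_exp, ← Complex.exp_add]
    congr 1
    push_cast
    linear_combination (-(2 * Real.pi * m * y : ℂ)) * Complex.I_sq
  have h1 : ∑ m ∈ Finset.range n, (qExpansion 1 F).coeff m * e (m * α) * D m =
      ∫ u in (0 : ℝ)..1, F ⟨(u : ℂ) + y * Complex.I, by simpa using hy⟩ * ∑ m ∈ Finset.range n,
          (D m * (Real.exp (2 * Real.pi * (m * y)) : ℂ)) * e (m * (α - u)) := by
    simp_rw [Finset.mul_sum]
    rw [intervalIntegral.integral_finsetSum]
    swap
    · intro m _
      exact (by fun_prop : Continuous _).intervalIntegrable _ _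
    refine Finset.sum_congr rfl fun m _ => ?_
    rw [hcoeff, mul_assoc, ← intervalIntegral.integral_mul_const]
    refine intervalIntegral.integral_congr fun u _ => ?_
    rw [show (m : ℝ) * (α - u) = m * α + -(m * u) by ring, e_add]
    ring
  rw [h1, ← intervalIntegral.integral_const_mul]
  apply intervalIntegral.norm_integral_le_of_norm_le zero_le_one
  · filter_upwards with u _
    rw [norm_mul]
    gcongr
    have := hC ⟨(u : ℂ) + y * Complex.I, by simpa using hy⟩
    refine this.trans (le_of_eq ?_)
    have him : UpperHalfPlane.im ⟨(u : ℂ) + y * Complex.I, by simpa using hy⟩ = y := by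
      simp [← UpperHalfPlane.coe_im]
    rw [him, neg_div, Real.rpow_neg hy.le, div_eq_mul_inv]
  · exact (by fun_prop : Continuous _).intervalIntegrable _ _

lemma IsPlateau.eq_zero {B : ℕ → ℝ} {U : ℝ → ℝ} (hU : IsPlateau B U) {x : ℝ}
    (hx : x ∉ Set.Icc (1 / 2 : ℝ) 3) : U x = 0 := by
  by_contra h
  exact hx (hU.supp h)

lemma IsPlateau.deriv_eq_zero {B : ℕ → ℝ} {U : ℝ → ℝ} (hU : IsPlateau B U) {x : ℝ}
    (hx : x ∉ Set.Icc (1 / 2 : ℝ) 3) : deriv U x = 0 := by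
  have : U =ᶠ[nhds x] fun _ => 0 := by
    filter_upwards [isClosed_Icc.isOpen_compl.mem_nhds hx] with v hv
    exact hU.eq_zero hv
  rw [this.deriv_eq]; simp

/-- The weight in the `m`-sum, after rescaling, and its derivative. -/
lemma exists_weight_bound (κ : ℝ) : ∃ G : ℝ, 0 ≤ G ∧ ∀ s ∈ Set.Icc (1 / 2 : ℝ) 3,
    |s ^ κ * Real.exp (2 * Real.pi * s)| ≤ G ∧
    |κ * s ^ (κ - 1) * Real.exp (2 * Real.pi * s) +
      s ^ κ * (Real.exp (2 * Real.pi * s) * (2 * Real.pi))| ≤ G := by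
  have hpos : ∀ s ∈ Set.Icc (1 / 2 : ℝ) 3, s ≠ 0 := fun s hs => by
    have := hs.1; intro h; rw [h] at this; norm_num at this
  have h1 : ContinuousOn (fun s : ℝ => s ^ κ * Real.exp (2 * Real.pi * s)) (Set.Icc (1 / 2 : ℝ) 3) := by
    apply ContinuousOn.mul
    · exact ContinuousOn.rpow_const continuousOn_id fun s hs => Or.inl (hpos s hs)
    · fun_prop
  have h2 : ContinuousOn (fun s : ℝ => κ * s ^ (κ - 1) * Real.exp (2 * Real.pi * s) +
      s ^ κ * (Real.exp (2 * Real.pi * s) * (2 * Real.pi))) (Set.Icc (1 / 2 : ℝ) 3) := by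
    apply ContinuousOn.add
    · apply ContinuousOn.mul
      · exact continuousOn_const.mul
          (ContinuousOn.rpow_const continuousOn_id fun s hs => Or.inl (hpos s hs))
      · fun_prop
    · apply ContinuousOn.mul
      · exact ContinuousOn.rpow_const continuousOn_id fun s hs => Or.inl (hpos s hs)
      · fun_prop
  obtain ⟨G₁, hG₁⟩ := isCompact_Icc.exists_bound_of_continuousOn h1
  obtain ⟨G₂, hG₂⟩ := isCompact_Icc.exists_bound_of_continuousOn h2
  refine ⟨max 0 (max G₁ G₂), le_max_left _ _, fun s hs => ⟨?_, ?_⟩⟩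
  · exact (hG₁ s hs).trans ((le_max_left _ _).trans (le_max_right _ _))
  · exact (hG₂ s hs).trans ((le_max_right _ _).trans (le_max_right _ _))

/-- Additively twisted sums of `λ_F(m)` against a function `R` that varies on the scale `L`. -/
lemma exists_norm_smooth_twisted_sum_le {k₀ : ℤ} (F : CuspForm 𝒮ℒ k₀) (B : ℕ → ℝ) (a : ℕ) :
    ∃ C : ℝ, 0 ≤ C ∧ ∀ U : ℝ → ℝ, IsPlateau B U → ∀ (y L V : ℝ), 0 < y → 0 < L → 0 ≤ V →
      ∀ R R' : ℝ → ℂ, (∀ u, 0 < u → HasDerivAt R (R' u) u) →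
      (∀ u, 0 < u → y * u ≤ 3 → ‖R u‖ ≤ V) →
      (∀ u, 0 < u → 1 / 2 ≤ y * u → y * u ≤ 3 → ‖R' u‖ ≤ V / L) →
      ∀ (α : ℝ) (n : ℕ), 3 < y * n →
      ‖∑ m ∈ Finset.range n, fourierCoeff F m * e (m * α) * (U (m * y) : ℂ) * (m : ℂ) ^ a * R m‖ ≤
        C * (y ^ (-1 - a : ℝ) * L ^ (-(1 / 2) : ℝ) * (1 + L * y) * V) := by
  obtain ⟨C, hC0, hC⟩ := exists_norm_twisted_sum_le F
  set κ : ℝ := -((k₀ : ℝ) - 1) / 2 + a with hκ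
  obtain ⟨G, hG0, hG⟩ := exists_weight_bound κ
  set D : ℝ := |B 1| * G + 3 * |B 0| * G with hD
  refine ⟨C * (4 * D), by positivity, fun U hU y L V hy hL hV R R' hR hRb hRb' α n hn => ?_⟩
  have hB0 : ∀ s, |U s| ≤ |B 0| := fun s => by
    have := hU.deriv_le 0 s
    rw [iteratedDeriv_zero] at this
    exact this.trans (le_abs_self _)
  have hB1 : ∀ s, |deriv U s| ≤ |B 1| := fun s => by
    have := hU.deriv_le 1 s
    rw [iteratedDeriv_one] at this
    exact this.trans (le_abs_self _)
  -- The height `y` is also the reciprocal length of the `m`-sum, so with `s = y m` the factors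
  -- `s^κ` (normalisation and `m^a`) and `e^(2πs)` are bounded on the support of `U`.
  set g : ℝ → ℝ := fun s => s ^ κ * Real.exp (2 * Real.pi * s) with hg
  set g' : ℝ → ℝ := fun s => κ * s ^ (κ - 1) * Real.exp (2 * Real.pi * s) +
      s ^ κ * (Real.exp (2 * Real.pi * s) * (2 * Real.pi)) with hg'
  set d : ℝ → ℂ := fun u => ((U (y * u) * g (y * u) : ℝ) : ℂ) * R u with hd
  set d' : ℝ → ℂ := fun u => (((deriv U (y * u) * y) * g (y * u) + U (y * u) * (g' (y * u) * y) : ℝ) : ℂ)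
    * R u + ((U (y * u) * g (y * u) : ℝ) : ℂ) * R' u with hd'
  have hderiv : ∀ u, 0 < u → HasDerivAt d (d' u) u := by
    intro u hu
    have hyu : 0 < y * u := by positivity
    have hlin : HasDerivAt (fun u : ℝ => y * u) y u := by
      simpa using (hasDerivAt_id u).const_mul y
    have hU' : HasDerivAt (fun u => U (y * u)) (deriv U (y * u) * y) u :=
      HasDerivAt.comp u ((hU.smooth.differentiable (by simp)) (y * u)).hasDerivAt hlin
    have hgs : HasDerivAt g (g' (y * u)) (y * u) := by
      have h1 := Real.hasDerivAt_rpow_const (x := y * u) (p := κ) (Or.inl hyu.ne')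
      have h2 : HasDerivAt (fun s : ℝ => Real.exp (2 * Real.pi * s))
          (Real.exp (2 * Real.pi * (y * u)) * (2 * Real.pi)) (y * u) := by
        simpa using ((hasDerivAt_id (y * u)).const_mul (2 * Real.pi)).exp
      exact h1.mul h2
    have hgu : HasDerivAt (fun u => g (y * u)) (g' (y * u) * y) u := HasDerivAt.comp u hgs hlin
    exact (hU'.mul hgu).ofReal_comp.mul (hR u hu)
  have hdz : ∀ u, y * u ∉ Set.Icc (1 / 2 : ℝ) 3 → d u = 0 := fun u hu => by
    simp [hd, hU.eq_zero hu]
  have hdb : ∀ u, 0 < u → ‖d u‖ ≤ |B 0| * G * V := by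
    intro u hu
    by_cases hs : y * u ∈ Set.Icc (1 / 2 : ℝ) 3
    · simp only [hd]
      rw [norm_mul, Complex.norm_real, Real.norm_eq_abs, abs_mul]
      have := hB0 (y * u)
      have := (hG _ hs).1
      have := hRb u hu hs.2
      gcongr
    · rw [hdz u hs]; simp; positivity
  have hdb' : ∀ u, 0 < u → ‖d' u‖ ≤ V / L * (D * (1 + L * y)) := by
    intro u hu
    by_cases hs : y * u ∈ Set.Icc (1 / 2 : ℝ) 3
    · simp only [hd']
      have b0 := hB0 (y * u)
      have b1 := hB1 (y * u)
      have c0 : |g (y * u)| ≤ G := (hG _ hs).1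
      have c1 : |g' (y * u)| ≤ G := (hG _ hs).2
      have r0 := hRb u hu hs.2
      have r1 := hRb' u hu hs.1 hs.2
      refine (norm_add_le _ _).trans ?_
      rw [norm_mul, norm_mul, Complex.norm_real, Complex.norm_real, Real.norm_eq_abs,
        Real.norm_eq_abs]
      have e1 : |deriv U (y * u) * y * g (y * u) + U (y * u) * (g' (y * u) * y)| ≤
          |B 1| * y * G + |B 0| * (G * y) := by
        refine (abs_add_le _ _).trans ?_
        rw [abs_mul (deriv U (y * u) * y), abs_mul (deriv U (y * u)), abs_mul (U (y * u)),
          abs_mul (g' (y * u)), abs_of_pos hy]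
        gcongr
      have e2 : |U (y * u) * g (y * u)| ≤ |B 0| * G := by
        rw [abs_mul (U (y * u))]; gcongr
      calc _ ≤ (|B 1| * y * G + |B 0| * (G * y)) * V + |B 0| * G * (V / L) := by gcongr
        _ = V / L * ((|B 1| * G + |B 0| * G) * (L * y) + |B 0| * G) := by field_simp
        _ ≤ V / L * (D * (1 + L * y)) := by
          gcongr
          rw [hD]
          have p1 : 0 ≤ |B 1| * G := by positivity
          have p0 : 0 ≤ |B 0| * G := by positivity
          have p2 : 0 ≤ L * y := by positivity
          nlinarith [mul_nonneg p0 p2]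
    · simp only [hd', hU.eq_zero hs, hU.deriv_eq_zero hs]
      simp; positivity
  have hd0 : d 0 = 0 := hdz 0 (by norm_num)
  have hdiff : ∀ m : ℕ, ‖d ((m + 1 : ℕ) : ℝ) - d m‖ ≤ V / L * (D * (1 + L * y)) := by
    intro m
    -- The step from `0` to `1` is treated apart, as `R` is differentiable only for `u > 0`. It
    -- contributes only if `y ≥ 1/2`, and then the term `L y` covers it.
    rcases Nat.eq_zero_or_pos m with rfl | hm
    · rw [Nat.cast_zero, hd0, sub_zero, zero_add, Nat.cast_one]
      by_cases hs : y * 1 ∈ Set.Icc (1 / 2 : ℝ) 3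
      · refine (hdb 1 one_pos).trans ?_
        have hy2 : 1 / 2 ≤ y := by simpa using hs.1
        have p1 : 0 ≤ |B 1| * G := by positivity
        have p0 : 0 ≤ |B 0| * G := by positivity
        calc |B 0| * G * V = V / L * (|B 0| * G * L) := by field_simp
          _ ≤ V / L * (D * (1 + L * y)) := by
            apply mul_le_mul_of_nonneg_left _ (by positivity)
            rw [hD]
            nlinarith [mul_nonneg p1 (mul_pos hL hy).le, mul_nonneg p0 (mul_pos hL hy).le, mul_nonneg p0 hL.le]
      · rw [hdz 1 hs]; simp; positivity
    · have hm1 : (0 : ℝ) < m := by exact_mod_cast hm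
      have := Convex.norm_image_sub_le_of_norm_hasDerivWithin_le (f := d) (f' := d')
        (s := Set.Ioi 0) (x := (m : ℝ)) (y := ((m + 1 : ℕ) : ℝ)) (C := V / L * (D * (1 + L * y)))
        (fun u hu => (hderiv u hu).hasDerivWithinAt) (fun u hu => hdb' u hu) (convex_Ioi 0)
        hm1 (by simp only [Set.mem_Ioi]; positivity)
      simpa using this
  have hbig : ∀ m : ℕ, 3 / y < m → d m = 0 := fun m hm => hdz m fun h => by
    rw [div_lt_iff₀ hy] at hm; linarith [h.2]
  have hrew : ∑ m ∈ Finset.range n, fourierCoeff F m * e (m * α) * (U (m * y) : ℂ) * (m : ℂ) ^ a * R m =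
      ∑ m ∈ Finset.range n, (qExpansion 1 F).coeff m * e (m * α) *
        (((y ^ (-κ) * Real.exp (-(2 * Real.pi * (m * y))) : ℝ) : ℂ) * d m) := by
    refine Finset.sum_congr rfl fun m _ => ?_
    rcases Nat.eq_zero_or_pos m with rfl | hm
    · simp [hd0, hU.eq_zero (x := 0) (by norm_num)]
    · have hm0 : (0 : ℝ) < m := by exact_mod_cast hm
      have h1 : y ^ (-κ) * Real.exp (-(2 * Real.pi * (m * y))) * (U (y * m) * g (y * m)) =
          U (m * y) * (((m : ℝ) ^ (((k₀ : ℝ) - 1) / 2))⁻¹ * (m : ℝ) ^ a) := by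
        simp only [hg]
        rw [Real.mul_rpow hy.le hm0.le, Real.rpow_neg hy.le, Real.exp_neg,
          ← Real.rpow_natCast (m : ℝ) a, ← Real.rpow_neg hm0.le, ← Real.rpow_add hm0, mul_comm y m,
          show -(((k₀ : ℝ) - 1) / 2) + a = κ by rw [hκ]; ring]
        have h3 : Real.exp (2 * Real.pi * (m * y)) ≠ 0 := (Real.exp_pos _).ne'
        field_simp
      have h2 : ((y ^ (-κ) * Real.exp (-(2 * Real.pi * (m * y))) : ℝ) : ℂ) *
          ((U (y * m) * g (y * m) : ℝ) : ℂ) =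
          (U (m * y) : ℂ) * ((((m : ℝ) ^ (((k₀ : ℝ) - 1) / 2) : ℝ) : ℂ)⁻¹ * (m : ℂ) ^ a) := by
        rw [← Complex.ofReal_mul, h1]; push_cast; ring
      simp only [fourierCoeff, hd]
      rw [← mul_assoc (((y ^ (-κ) * Real.exp (-(2 * Real.pi * (m * y))) : ℝ) : ℂ)), h2]
      ring
  rw [hrew]
  refine (hC y hy α _ n).trans ?_
  have hsimp : ∀ m : ℕ, (((y ^ (-κ) * Real.exp (-(2 * Real.pi * (m * y))) : ℝ) : ℂ) * d m) *
      (Real.exp (2 * Real.pi * (m * y)) : ℂ) = ((y ^ (-κ) : ℝ) : ℂ) * d m := by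
    intro m
    rw [Real.exp_neg]
    have h3 : ((Real.exp (2 * Real.pi * (m * y)) : ℝ) : ℂ) ≠ 0 := by
      exact_mod_cast (Real.exp_pos _).ne'
    push_cast at h3 ⊢
    field_simp
  simp_rw [hsimp, mul_assoc, ← Finset.mul_sum, norm_mul]
  rw [intervalIntegral.integral_const_mul, Complex.norm_real,
    Real.norm_of_nonneg (Real.rpow_pos_of_pos hy _).le]
  have hyk : y ^ (-(k₀ : ℝ) / 2) * y ^ (-κ) = y ^ (-(1 / 2) - a : ℝ) := by
    rw [← Real.rpow_add hy]; congr 1; rw [hκ]; ring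
  have hint : ∫ u in (0 : ℝ)..1, ‖∑ m ∈ Finset.range n, d m * e (m * (α - u))‖ ≤
      4 * D * V * (1 + L * y) * (y ^ (-(1 / 2) : ℝ) * L ^ (-(1 / 2) : ℝ)) := by
    -- For `y > 3` no `m ≥ 1` meets the support of `U`; otherwise the number of `m` is at most `3/y
    -- + 1 ≤ 6/y`.
    rcases lt_or_ge 3 y with hy3 | hy3
    · have : ∀ m : ℕ, d m = 0 := by
        intro m
        rcases Nat.eq_zero_or_pos m with rfl | hm
        · simpa using hd0
        · apply hbig
          have : (1 : ℝ) ≤ m := by exact_mod_cast hm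
          have : 3 / y < 1 := by rw [div_lt_one hy]; exact hy3
          linarith
      simp only [this]
      simp; positivity
    · apply integral_norm_trigPoly_le (fun m : ℕ => d m) n (by simpa using hd0)
        (hbig n (by rw [div_lt_iff₀ hy]; linarith)) _ hL (by positivity)
      have h3y : 3 / y + 1 ≤ 6 / y := by
        rw [div_add_one hy.ne']; gcongr; linarith
      have h1 := sum_le_of_support (f := fun m : ℕ => ‖d m‖ ^ 2) (X := 3 / y)
        (b := (D * V) ^ 2) n (by positivity) (by positivity)
        (fun m => by
          apply pow_le_pow_left₀ (norm_nonneg _)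
          rcases Nat.eq_zero_or_pos m with rfl | hm
          · rw [Nat.cast_zero, hd0]; simp; positivity
          · refine (hdb m (by exact_mod_cast hm)).trans ?_
            gcongr
            rw [hD]
            have p1 : 0 ≤ |B 1| * G := by positivity
            have p0 : 0 ≤ |B 0| * G := by positivity
            linarith)
        (fun m hm => by simp [hbig m hm])
      have h2 := sum_le_of_support (f := fun m : ℕ => ‖d ((m + 1 : ℕ) : ℝ) - d m‖ ^ 2) (X := 3 / y)
        (b := (V / L * (D * (1 + L * y))) ^ 2) n (by positivity) (by positivity)
        (fun m => pow_le_pow_left₀ (norm_nonneg _) (hdiff m) 2)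
        (fun m hm => by
          rw [hbig m hm, hbig (m + 1) (by push_cast; linarith)]; simp)
      have hLs : (L ^ (-(1 / 2) : ℝ)) ^ 2 = 1 / L := by
        rw [← Real.rpow_natCast, ← Real.rpow_mul hL.le]; norm_num; exact Real.rpow_neg_one L
      have hys : (y ^ (-(1 / 2) : ℝ)) ^ 2 = 1 / y := by
        rw [← Real.rpow_natCast, ← Real.rpow_mul hy.le]; norm_num; exact Real.rpow_neg_one y
      calc _ ≤ (6 / y) * (D * V) ^ 2 + L ^ 2 * ((6 / y) * (V / L * (D * (1 + L * y))) ^ 2) := by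
            have h1' := h1.trans (mul_le_mul_of_nonneg_right h3y (by positivity))
            have h2' := h2.trans (mul_le_mul_of_nonneg_right h3y (by positivity))
            gcongr
        _ = (6 / y) * (D * V) ^ 2 * (1 + (1 + L * y) ^ 2) := by field_simp
        _ ≤ (6 / y) * (D * V) ^ 2 * (2 * (1 + L * y) ^ 2) := by
          gcongr
          have : 0 ≤ L * y := by positivity
          nlinarith
        _ = 12 * ((1 / y) * (D * V) ^ 2 * (1 + L * y) ^ 2) := by ring
        _ ≤ 16 * ((1 / y) * (D * V) ^ 2 * (1 + L * y) ^ 2) := by gcongr; norm_num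
        _ = _ := by
          simp only [mul_pow, hLs, hys]
          field_simp
          ring
  calc C * (y ^ (-(k₀ : ℝ) / 2) * (y ^ (-κ) * _))
      ≤ C * (y ^ (-(k₀ : ℝ) / 2) * (y ^ (-κ) *
        (4 * D * V * (1 + L * y) * (y ^ (-(1 / 2) : ℝ) * L ^ (-(1 / 2) : ℝ))))) := by gcongr
    _ = C * (4 * D) * ((y ^ (-(k₀ : ℝ) / 2) * y ^ (-κ)) * y ^ (-(1 / 2) : ℝ) * L ^ (-(1 / 2) : ℝ) *
        (1 + L * y) * V) := by ring
    _ = _ := by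
      rw [hyk, ← Real.rpow_add hy, show -(1 / 2) - (a : ℝ) + -(1 / 2) = -1 - a by ring]
      ring

/-! ### The sum over `n` -/

/-- Abel summation against a monotone weight. -/
lemma norm_sum_mul_le_of_monotone {w : ℕ → ℝ} (hw : Monotone w) (hw0 : 0 ≤ w 0) {f : ℕ → ℂ} {b : ℝ}
    {n : ℕ} (h : ∀ k ≤ n, ‖∑ i ∈ Finset.range k, f i‖ ≤ b) :
    ‖∑ i ∈ Finset.range n, (w i : ℂ) * f i‖ ≤ 2 * b * w n := by
  have hid : ∀ k, ∑ i ∈ Finset.range k, (w i : ℂ) * f i = w k * ∑ i ∈ Finset.range k, f i -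
      ∑ i ∈ Finset.range k, ((w (i + 1) - w i : ℝ) : ℂ) * ∑ j ∈ Finset.range (i + 1), f j := by
    intro k
    induction k with
    | zero => simp
    | succ k ih =>
      rw [Finset.sum_range_succ, ih, Finset.sum_range_succ _ k, Finset.sum_range_succ _ k,
        Finset.sum_range_succ _ k]
      push_cast; ring
  have hb : 0 ≤ b := (norm_nonneg _).trans (h 0 (Nat.zero_le _))
  have hwn : w 0 ≤ w n := hw (Nat.zero_le _)
  rw [hid]
  refine (norm_sub_le _ _).trans ?_
  have h1 : ‖(w n : ℂ) * ∑ i ∈ Finset.range n, f i‖ ≤ w n * b := by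
    rw [norm_mul, Complex.norm_real, Real.norm_of_nonneg (by linarith)]
    exact mul_le_mul_of_nonneg_left (h n le_rfl) (by linarith)
  have h2 : ‖∑ i ∈ Finset.range n, ((w (i + 1) - w i : ℝ) : ℂ) * ∑ j ∈ Finset.range (i + 1), f j‖ ≤
      (w n - w 0) * b := by
    rw [← Finset.sum_range_sub w n, Finset.sum_mul]
    refine (norm_sum_le _ _).trans (Finset.sum_le_sum fun i hi => ?_)
    have hi := Finset.mem_range.1 hi
    have := hw (Nat.le_succ i)
    rw [norm_mul, Complex.norm_real, Real.norm_of_nonneg (by simpa using this)]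
    exact mul_le_mul_of_nonneg_left (h (i + 1) hi) (by simpa using this)
  nlinarith

/-- The sum over `n`, as a function of a real variable `u` in place of `m`. -/
noncomputable def logSum (t N β ρ : ℝ) (h : ℤ) (b : ℕ) (u : ℝ) : ℂ :=
  ∑ n ∈ Finset.Ioc ⌊N⌋₊ ⌊2 * N⌋₊, ((√(((n : ℤ) + h : ℤ) : ℝ) ^ b : ℝ) : ℂ) *
    Complex.exp (Complex.I * ((t * Real.log (((n : ℤ) + h : ℤ) : ℝ) + β * (((n : ℤ) + h : ℤ) : ℝ) +
      ρ * √u * √(((n : ℤ) + h : ℤ) : ℝ) : ℝ) : ℂ))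

/-- Differentiation in `u` only brings down a factor `√r`, so the derivative is again a sum of the
same type and inherits the same cancellation over `n`. -/
lemma hasDerivAt_logSum (t N β ρ : ℝ) (h : ℤ) (b : ℕ) {u : ℝ} (hu : 0 < u) :
    HasDerivAt (logSum t N β ρ h b)
      (Complex.I * ((ρ / (2 * √u) : ℝ) : ℂ) * logSum t N β ρ h (b + 1) u) u := by
  simp only [logSum, Finset.mul_sum]
  apply HasDerivAt.fun_sum
  intro n _
  set r : ℝ := (((n : ℤ) + h : ℤ) : ℝ)
  have h1 : HasDerivAt (fun u : ℝ => t * Real.log r + β * r + ρ * √u * √r)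
      (ρ * (1 / (2 * √u)) * √r) u :=
    (((Real.hasDerivAt_sqrt hu.ne').const_mul ρ).mul_const _).const_add _
  have h2 := ((h1.ofReal_comp.const_mul Complex.I).cexp).const_mul ((√r ^ b : ℝ) : ℂ)
  refine h2.congr_deriv ?_
  push_cast
  ring

lemma norm_logSum_le_trivial {t N β ρ : ℝ} {h : ℤ} {b : ℕ} {u : ℝ} (hN : 1 ≤ N)
    (hh2 : (h : ℝ) ≤ 2 * N) : ‖logSum t N β ρ h b u‖ ≤ 2 * N * √(5 * N) ^ b := by
  refine (norm_sum_le _ _).trans ?_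
  have h1 : ∀ n ∈ Finset.Ioc ⌊N⌋₊ ⌊2 * N⌋₊, ‖((√(((n : ℤ) + h : ℤ) : ℝ) ^ b : ℝ) : ℂ) *
    Complex.exp (Complex.I * ((t * Real.log (((n : ℤ) + h : ℤ) : ℝ) + β * (((n : ℤ) + h : ℤ) : ℝ) +
      ρ * √u * √(((n : ℤ) + h : ℤ) : ℝ) : ℝ) : ℂ))‖ ≤ √(5 * N) ^ b := by
    intro n hn
    rw [norm_mul, mul_comm Complex.I, Complex.norm_exp_ofReal_mul_I, mul_one, Complex.norm_real,
      Real.norm_of_nonneg (by positivity)]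
    have h2 : (n : ℝ) ≤ 2 * N :=
      (Nat.le_floor_iff (by linarith)).1 (Finset.mem_Ioc.1 hn).2
    gcongr
    push_cast; linarith
  refine (Finset.sum_le_sum h1).trans ?_
  rw [Finset.sum_const, nsmul_eq_mul, Nat.card_Ioc]
  gcongr
  calc ((⌊2 * N⌋₊ - ⌊N⌋₊ : ℕ) : ℝ) ≤ (⌊2 * N⌋₊ : ℝ) := by exact_mod_cast Nat.sub_le _ _
    _ ≤ 2 * N := Nat.floor_le (by linarith)

lemma norm_logSum_le {t N β ρ : ℝ} {h : ℤ} {b : ℕ} {u : ℝ} (ht : 1 ≤ t) (hN : 1 ≤ N) (htN : √t ≤ N)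
    (hh : 0 ≤ h) (hh2 : (h : ℝ) ≤ 2 * N) (hρ : |ρ| * √u * √(5 * N) ≤ t / 2) :
    ‖logSum t N β ρ h b u‖ ≤ 264 * (√t + N / √t) * √(5 * N) ^ b := by
  have hfl : ⌊N⌋₊ ≤ ⌊2 * N⌋₊ := Nat.floor_le_floor (by linarith)
  have hf2 := Nat.lt_floor_add_one N
  have hf3 := Nat.floor_le (by linarith : 0 ≤ 2 * N)
  have hh' : (0 : ℝ) ≤ h := by exact_mod_cast hh
  set r₀ : ℝ := (⌊N⌋₊ : ℝ) + 1 + h with hr₀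
  set n := ⌊2 * N⌋₊ - ⌊N⌋₊ with hn
  have hncast : (n : ℝ) = (⌊2 * N⌋₊ : ℝ) - ⌊N⌋₊ := by rw [hn, Nat.cast_sub hfl]
  have hsum : logSum t N β ρ h b u = ∑ i ∈ Finset.range n, ((√(r₀ + i) ^ b : ℝ) : ℂ) *
      Complex.exp (Complex.I * ((t * Real.log (r₀ + i) + β * (r₀ + i) +
        (ρ * √u) * √(r₀ + i) : ℝ) : ℂ)) := by
    rw [logSum, ← Finset.Ico_add_one_add_one_eq_Ioc, Finset.sum_Ico_eq_sum_range]
    have hn' : ⌊2 * N⌋₊ + 1 - (⌊N⌋₊ + 1) = n := by omega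
    rw [hn']
    refine Finset.sum_congr rfl fun i _ => ?_
    have : (((((⌊N⌋₊ + 1 + i : ℕ) : ℤ) + h : ℤ)) : ℝ) = r₀ + i := by
      rw [hr₀]; push_cast; ring
    rw [this]
  rw [hsum]
  -- The factor `√r ^ b` increases with `r`, so Abel summation removes it at the cost of a factor
  -- `2`.
  have hw : Monotone fun i : ℕ => √(r₀ + i) ^ b := by
    intro i j hij
    have : (i : ℝ) ≤ j := by exact_mod_cast hij
    exact pow_le_pow_left₀ (Real.sqrt_nonneg _) (Real.sqrt_le_sqrt (by linarith)) b
  have := norm_sum_mul_le_of_monotone hw (by positivity) (n := n)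
    (b := 132 * (√t + N / √t)) (f := fun i : ℕ => Complex.exp (Complex.I *
      ((t * Real.log (r₀ + i) + β * (r₀ + i) + (ρ * √u) * √(r₀ + i) : ℝ) : ℂ)))
    (fun k hk => by
      have hkn : (k : ℝ) ≤ n := by exact_mod_cast hk
      apply exp_sum_log_phase ht hN htN (by rw [hr₀]; linarith)
      · have : (0 : ℝ) ≤ ⌊N⌋₊ := Nat.cast_nonneg _
        linarith
      · rw [hr₀]; linarith
      · rw [abs_mul, abs_of_nonneg (Real.sqrt_nonneg u)]; exact hρ)
  refine this.trans ?_
  have h5 : √(r₀ + n) ≤ √(5 * N) := Real.sqrt_le_sqrt (by rw [hr₀]; linarith)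
  calc 2 * (132 * (√t + N / √t)) * √(r₀ + n) ^ b ≤ 2 * (132 * (√t + N / √t)) * √(5 * N) ^ b := by
        gcongr
    _ = _ := by ring

/-! ### The sums over `m` and `n` -/

/-- The summand of the sum over `m`, `h` and `n`, without the Bessel factor. -/
noncomputable def amplitude {k₀ : ℤ} (F : CuspForm 𝒮ℒ k₀) (W U : ℝ → ℝ) (t N H l α β : ℝ)
    (s : ℕ × ℤ × ℕ) : ℂ :=
  fourierCoeff F s.1 * e (s.1 * α) * (U (s.1 * (l ^ 2 / N)) : ℂ) * (W (s.2.1 / H) : ℂ) *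
    Complex.exp (Complex.I * ((t * Real.log (((s.2.2 : ℤ) + s.2.1 : ℤ) : ℝ) +
      β * (((s.2.2 : ℤ) + s.2.1 : ℤ) : ℝ) : ℝ) : ℂ))

/-- The argument of the Bessel function. -/
noncomputable def besselArg (M : ℝ) (s : ℕ × ℤ × ℕ) : ℝ :=
  4 * Real.pi * √(s.1 * (((s.2.2 : ℤ) + s.2.1 : ℤ) : ℝ)) / M

/-- The range of summation. -/
noncomputable def sumRange (N H : ℝ) (n : ℕ) : Finset (ℕ × ℤ × ℕ) :=
  Finset.range n ×ˢ Finset.Icc (1 : ℤ) ⌊2 * H⌋ ×ˢ Finset.Ioc ⌊N⌋₊ ⌊2 * N⌋₊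

lemma sum_amplitude_eq {k₀ : ℤ} (F : CuspForm 𝒮ℒ k₀) (W U : ℝ → ℝ) {t N H l α β M σ : ℝ}
    (a n : ℕ) :
    ∑ s ∈ sumRange N H n, amplitude F W U t N H l α β s * ((besselArg M s : ℂ) ^ 2) ^ a *
        Complex.exp (Complex.I * ((σ * besselArg M s : ℝ) : ℂ)) =
      ∑ h ∈ Finset.Icc (1 : ℤ) ⌊2 * H⌋, (W (h / H) : ℂ) * ((4 * Real.pi / M : ℝ) : ℂ) ^ (2 * a) *
        ∑ m ∈ Finset.range n, fourierCoeff F m * e (m * α) * (U (m * (l ^ 2 / N)) : ℂ) *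
          (m : ℂ) ^ a * logSum t N β (4 * Real.pi * σ / M) h (2 * a) m := by
  rw [sumRange, Finset.sum_product,
    Finset.sum_comm' (t' := Finset.Icc (1 : ℤ) ⌊2 * H⌋ ×ˢ Finset.Ioc ⌊N⌋₊ ⌊2 * N⌋₊)
      (s' := fun _ => Finset.range n) (by simp), Finset.sum_product]
  refine Finset.sum_congr rfl fun h hh => ?_
  rw [Finset.sum_comm, Finset.mul_sum]
  refine Finset.sum_congr rfl fun m _ => ?_
  rw [logSum, Finset.mul_sum, Finset.mul_sum]
  refine Finset.sum_congr rfl fun n' _ => ?_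
  simp only [amplitude, besselArg]
  set r : ℝ := (((n' : ℤ) + h : ℤ) : ℝ)
  rw [Real.sqrt_mul (Nat.cast_nonneg _)]
  have h1 : ((((4 * Real.pi * (√(m : ℝ) * √r) / M : ℝ) : ℂ)) ^ 2) ^ a =
      ((4 * Real.pi / M : ℝ) : ℂ) ^ (2 * a) * (m : ℂ) ^ a * ((√r ^ (2 * a) : ℝ) : ℂ) := by
    have h2 : ((4 * Real.pi * (√(m : ℝ) * √r) / M) ^ 2) ^ a =
        (4 * Real.pi / M) ^ (2 * a) * (m : ℝ) ^ a * (√r ^ (2 * a)) := by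
      rw [pow_mul, pow_mul, ← mul_pow, ← mul_pow]
      congr 1
      have : √(m : ℝ) ^ 2 = m := Real.sq_sqrt (Nat.cast_nonneg _)
      linear_combination ((4 * Real.pi / M) ^ 2 * √r ^ 2) * this
    exact_mod_cast congrArg (fun x : ℝ => (x : ℂ)) h2
  have h3 : Complex.exp (Complex.I * ((t * Real.log r + β * r + 4 * Real.pi * σ / M * √(m : ℝ) * √r : ℝ) : ℂ))
      = Complex.exp (Complex.I * ((t * Real.log r + β * r : ℝ) : ℂ)) *
        Complex.exp (Complex.I * ((σ * (4 * Real.pi * (√(m : ℝ) * √r) / M) : ℝ) : ℂ)) := by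
    rw [← Complex.exp_add]; congr 1; push_cast; ring
  rw [h1, h3]
  ring

/-- The bound for the sums over `m` and `n` with an exponential in place of the Bessel function. -/
lemma exists_norm_sum_exp_le {k₀ : ℤ} (F : CuspForm 𝒮ℒ k₀) (B : ℕ → ℝ) (N₀ : ℝ) (a : ℕ) :
    ∃ C : ℝ, 0 ≤ C ∧ ∀ W U : ℝ → ℝ, IsBump B W → IsPlateau B U → ∀ t N H M l : ℝ, 1 ≤ t → 1 ≤ N →
      √t ≤ N → 0 < H → H ≤ N → 0 < M → 1 ≤ l → (100 * N ≤ t * M ∨ N ≤ N₀) →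
      ∀ (α β : ℝ) (n : ℕ), 3 < (l ^ 2 / N) * n → ∀ σ ∈ Set.Icc (-1 : ℝ) 1,
      ‖∑ s ∈ sumRange N H n, amplitude F W U t N H l α β s * ((besselArg M s : ℂ) ^ 2) ^ a *
        Complex.exp (Complex.I * ((σ * besselArg M s : ℝ) : ℂ))‖ ≤
      C * (H * (√t + N / √t) * (N / l ^ 2) * ((N / (l * M)) ^ 2) ^ a * (M / l) ^ (-(1 / 2) : ℝ) *
        (1 + M * l / N)) := by
  obtain ⟨C, hC0, hC⟩ := exists_norm_smooth_twisted_sum_le F B a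
  -- One constant for both cases: `264` from the second derivative test, `2 N₀` from the trivial
  -- bound when `N ≤ N₀`.
  set C₁ : ℝ := max 264 (2 * N₀) with hC₁
  have hC₁0 : 0 < C₁ := lt_of_lt_of_le (by norm_num) (le_max_left _ _)
  refine ⟨2 * |B 0| * (C * (20 * C₁) * (80 * Real.pi ^ 2) ^ a), by positivity, ?_⟩
  intro W U hW hU t N H M l ht hN htN hH hHN hM hl hcase α β n hn σ hσ
  rw [sum_amplitude_eq]
  have hpi' := Real.pi_lt_d2
  have hN0 : 0 < N := by linarith
  set y : ℝ := l ^ 2 / N with hy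
  have hy0 : 0 < y := by positivity
  set V : ℝ := √t + N / √t with hV
  have hst1 : 1 ≤ √t := by rw [← Real.sqrt_one]; exact Real.sqrt_le_sqrt ht
  have hV1 : 1 ≤ V := by
    have : 0 ≤ N / √t := by positivity
    linarith
  set ρ : ℝ := 4 * Real.pi * σ / M with hρ
  have hρb : |ρ| ≤ 4 * Real.pi / M := by
    rw [hρ, abs_div, abs_of_pos hM, abs_mul, abs_of_pos (by positivity : 0 < 4 * Real.pi)]
    have := abs_le.2 hσ
    rw [div_le_div_iff_of_pos_right hM]
    exact mul_le_of_le_one_right (by positivity) this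
  have hRb : ∀ h ∈ Finset.Icc (1 : ℤ) ⌊2 * H⌋, ∀ (b : ℕ) (u : ℝ), 0 < u → y * u ≤ 3 →
      ‖logSum t N β ρ h b u‖ ≤ C₁ * V * √(5 * N) ^ b := by
    intro h hh b u hu hyu
    obtain ⟨hh1, hh2⟩ := Finset.mem_Icc.1 hh
    have hh2' : (h : ℝ) ≤ 2 * N := by
      have : (h : ℝ) ≤ 2 * H := Int.le_floor.1 hh2
      linarith
    rcases hcase with hc | hc
    · refine (norm_logSum_le ht hN htN (by omega) hh2' ?_).trans ?_
      · have hu3 : u ≤ 3 * N := by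
          rw [hy, div_mul_eq_mul_div, div_le_iff₀ hN0] at hyu
          nlinarith [one_le_pow₀ hl (n := 2)]
        -- The support of `U` gives `u ≤ 3N`, and `√15 < 3.9`. Then `15.6 π < 50`, and `100 N ≤ t M`
        -- yields the smallness of the square root phase.
        have h1 : √u * √(5 * N) ≤ 3.9 * N := by
          rw [← Real.sqrt_mul hu.le]
          apply Real.sqrt_le_iff.2 ⟨by positivity, by nlinarith⟩
        calc |ρ| * √u * √(5 * N) = |ρ| * (√u * √(5 * N)) := by ring
          _ ≤ (4 * Real.pi / M) * (3.9 * N) := by gcongr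
          _ = (15.6 * Real.pi) * N / M := by ring
          _ ≤ 50 * N / M := by gcongr; linarith
          _ ≤ t / 2 := by rw [div_le_iff₀ hM]; linarith
      · gcongr
        exact le_max_left _ _
    · refine (norm_logSum_le_trivial hN hh2').trans ?_
      apply mul_le_mul_of_nonneg_right _ (by positivity)
      calc 2 * N ≤ 2 * N₀ := by linarith
        _ ≤ C₁ := le_max_right _ _
        _ ≤ C₁ * V := le_mul_of_one_le_right hC₁0.le hV1
  set V' : ℝ := 20 * (C₁ * V * (5 * N) ^ a) with hV'
  have hsq : √(5 * N) ^ (2 * a) = (5 * N) ^ a := by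
    rw [pow_mul, Real.sq_sqrt (by positivity)]
  have hm : ∀ h ∈ Finset.Icc (1 : ℤ) ⌊2 * H⌋,
      ‖∑ m ∈ Finset.range n, fourierCoeff F m * e (m * α) * (U (m * y) : ℂ) *
          (m : ℂ) ^ a * logSum t N β ρ h (2 * a) m‖ ≤
      C * (y ^ (-1 - a : ℝ) * (M / l) ^ (-(1 / 2) : ℝ) * (1 + (M / l) * y) * V') := by
    intro h hh
    apply hC U hU y (M / l) V' hy0 (by positivity) (by positivity) (logSum t N β ρ h (2 * a)) _
      (fun u hu => hasDerivAt_logSum t N β ρ h (2 * a) hu)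
    · intro u hu hyu
      refine (hRb h hh (2 * a) u hu hyu).trans ?_
      rw [hsq, hV']
      have : 0 ≤ C₁ * V * (5 * N) ^ a := by positivity
      linarith
    · intro u hu hyu hyu3
      rw [norm_mul, norm_mul, Complex.norm_I, one_mul, Complex.norm_real, Real.norm_eq_abs]
      have h1 := hRb h hh (2 * a + 1) u hu hyu3
      have h2 : |ρ / (2 * √u)| ≤ (4 * Real.pi / M) / (2 * √u) := by
        rw [abs_div, abs_of_pos (by positivity : 0 < 2 * √u)]; gcongr
      -- On the support `N ≤ 2 l² u`, and `10 < 3.17²`. Hence the derivative in `u` costs `O(l/M)`,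
      -- which identifies the scale `L = M/l`; `6.34 π < 20` explains the constant in `V'`.
      have h3 : √(5 * N) ≤ 3.17 * l * √u := by
        apply Real.sqrt_le_iff.2 ⟨by positivity, ?_⟩
        rw [mul_pow, Real.sq_sqrt hu.le]
        rw [hy, div_mul_eq_mul_div, le_div_iff₀ hN0] at hyu
        nlinarith
      calc |ρ / (2 * √u)| * ‖logSum t N β ρ h (2 * a + 1) u‖
          ≤ ((4 * Real.pi / M) / (2 * √u)) * (C₁ * V * √(5 * N) ^ (2 * a + 1)) := by gcongr
        _ = ((4 * Real.pi / M) / (2 * √u)) * (C₁ * V * (5 * N) ^ a) * √(5 * N) := by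
          rw [pow_succ, hsq]; ring
        _ ≤ ((4 * Real.pi / M) / (2 * √u)) * (C₁ * V * (5 * N) ^ a) * (3.17 * l * √u) := by gcongr
        _ = (6.34 * Real.pi) * (C₁ * V * (5 * N) ^ a) / (M / l) := by field_simp; ring
        _ ≤ 20 * (C₁ * V * (5 * N) ^ a) / (M / l) := by gcongr; linarith
    · exact hn
  have hyr : y ^ (-1 - a : ℝ) = (N / l ^ 2) * (N / l ^ 2) ^ a := by
    rw [show (-1 - a : ℝ) = -((1 + a : ℕ) : ℝ) by push_cast; ring, Real.rpow_neg hy0.le,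
      Real.rpow_natCast, ← inv_pow, hy, inv_div, pow_add, pow_one]
  set T : ℝ := C * (y ^ (-1 - a : ℝ) * (M / l) ^ (-(1 / 2) : ℝ) * (1 + (M / l) * y) * V') with hT
  have hterm : ∀ h ∈ Finset.Icc (1 : ℤ) ⌊2 * H⌋,
      ‖(W (h / H) : ℂ) * ((4 * Real.pi / M : ℝ) : ℂ) ^ (2 * a) *
        ∑ m ∈ Finset.range n, fourierCoeff F m * e (m * α) * (U (m * y) : ℂ) *
          (m : ℂ) ^ a * logSum t N β ρ h (2 * a) m‖ ≤
      |B 0| * (4 * Real.pi / M) ^ (2 * a) * T := by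
    intro h hh
    rw [norm_mul, norm_mul, norm_pow, Complex.norm_real, Complex.norm_real, Real.norm_eq_abs,
      Real.norm_of_nonneg (by positivity : 0 ≤ 4 * Real.pi / M)]
    have h1 := (hW.abs_le (h / H)).trans (le_abs_self _)
    have h2 := hm h hh
    gcongr
  refine (norm_sum_le _ _).trans ((Finset.sum_le_sum hterm).trans ?_)
  rw [Finset.sum_const, nsmul_eq_mul, Int.card_Icc]
  have hcard : ((⌊2 * H⌋ + 1 - 1).toNat : ℝ) ≤ 2 * H := by
    rw [add_sub_cancel_right]
    have h0 : 0 ≤ ⌊2 * H⌋ := Int.floor_nonneg.2 (by positivity)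
    have h1 : ((⌊2 * H⌋.toNat : ℤ) : ℝ) = (⌊2 * H⌋ : ℝ) := by rw [Int.toNat_of_nonneg h0]
    have h2 : ((⌊2 * H⌋.toNat : ℕ) : ℝ) = (⌊2 * H⌋ : ℝ) := by rw [← h1]; norm_cast
    rw [h2]; exact Int.floor_le _
  calc _ ≤ (2 * H) * (|B 0| * (4 * Real.pi / M) ^ (2 * a) * T) := by gcongr
    _ = _ := by
      rw [hT, hyr, hV', hy]
      have h1 : M / l * (l ^ 2 / N) = M * l / N := by field_simp
      have h2 : (4 * Real.pi / M) ^ (2 * a) * (N / l ^ 2) ^ a * (5 * N) ^ a =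
          (80 * Real.pi ^ 2) ^ a * ((N / (l * M)) ^ 2) ^ a := by
        rw [pow_mul, ← mul_pow, ← mul_pow, ← mul_pow]
        congr 1
        field_simp
        ring
      rw [h1]
      linear_combination (2 * H * |B 0| * C * (N / l ^ 2) * (M / l) ^ (-(1 / 2) : ℝ) *
        (1 + M * l / N) * 20 * C₁ * V) * h2

set_option maxHeartbeats 400000 in
/-- The bound for the sums over `k`, `m`, `h` and `n`. -/
lemma exists_norm_sum_bessel_le {k₀ : ℤ} (F : CuspForm 𝒮ℒ k₀) (B : ℕ → ℝ) (N₀ : ℝ) :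
    ∃ C : ℝ, 0 ≤ C ∧ ∀ W U : ℝ → ℝ, IsBump B W → IsPlateau B U → ∀ t N H K M l : ℝ, 1 ≤ t → 1 ≤ N →
      √t ≤ N → 0 < H → H ≤ N → 1 ≤ K → 0 < M → 1 ≤ l → (100 * N ≤ t * M ∨ N ≤ N₀) →
      ∀ (α β : ℝ) (n J : ℕ), 3 < (l ^ 2 / N) * n → K + 2 < J →
      ‖∑ s ∈ sumRange N H n, amplitude F W U t N H l α β s *
        ((∑ j ∈ Finset.range J, W (2 * j / K) * (-1) ^ j * besselJ (2 * j) (besselArg M s) : ℝ) : ℂ)‖ ≤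
      C * (H * (√t + N / √t) * N * l ^ (-(3 / 2) : ℝ) * M ^ (-(1 / 2) : ℝ) * min 1 (N / (M * K ^ 2))) := by
  obtain ⟨C₀, hC₀, h₀⟩ := exists_norm_sum_exp_le F B N₀ 0
  obtain ⟨C₁, hC₁, h₁⟩ := exists_norm_sum_exp_le F B N₀ 1
  obtain ⟨E, hE, hE'⟩ := exists_integral_norm_besselShift_le B
  set E₀ : ℝ := 2 * (|B 0| + 2 * |B 1|) with hE₀
  refine ⟨2 * (C₀ * E₀ + C₁ * E), by positivity, ?_⟩
  intro W U hW hU t N H K M l ht hN htN hH hHN hK hM hl hcase α β n J hn hJ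
  have hN0 : 0 < N := by linarith
  have hl0 : 0 < l := by linarith
  have hK0 : 0 < K := by linarith
  -- Two estimates for the same sum: `hb₀` uses the weights directly, `hb₁` the doubly shifted ones,
  -- with the extra `z²` attached to the amplitude and a gain of `K⁻⁴`.
  have hb₀ := norm_sum_besselJ_le (sumRange N H n) (amplitude F W U t N H l α β) (besselArg M)
    (fun σ hσ => by
      have := h₀ W U hW hU t N H M l ht hN htN hH hHN hM hl hcase α β n hn σ hσ
      simpa only [pow_zero, mul_one] using this)
    (fun j => W (2 * j / K)) J
    (E := E₀) (by
      rw [hE₀, abs_of_nonneg (hW.bound_nonneg 0), abs_of_nonneg (hW.bound_nonneg 1)]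
      exact integral_norm_bump_le hW hK (by linarith))
  have hb₁ := norm_sum_besselJ_le (sumRange N H n)
    (fun s => amplitude F W U t N H l α β s * ((besselArg M s : ℂ) ^ 2) ^ 1) (besselArg M)
    (fun σ hσ => h₁ W U hW hU t N H M l ht hN htN hH hHN hM hl hcase α β n hn σ hσ)
    (besselShift fun j => W (2 * j / K)) J (hE' W hW K hK J hJ.le)
  obtain ⟨J', rfl⟩ : ∃ J', J = J' + 1 := ⟨J - 1, by
    have : 0 < J := by
      have : (0 : ℝ) < J := by linarith
      exact_mod_cast this
    omega⟩
  have hshift : ∀ s, amplitude F W U t N H l α β s *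
      ((∑ j ∈ Finset.range (J' + 1), W (2 * j / K) * (-1) ^ j * besselJ (2 * j) (besselArg M s) : ℝ) : ℂ) =
      amplitude F W U t N H l α β s * ((besselArg M s : ℂ) ^ 2) ^ 1 *
      ((∑ j ∈ Finset.range (J' + 1), besselShift (fun j => W (2 * j / K)) j * (-1) ^ j *
        besselJ (2 * j) (besselArg M s) : ℝ) : ℂ) := by
    intro s
    rw [sum_besselJ_eq_shift (fun j => W (2 * j / K)) J' (hW.eq_zero_of_lt (by simp))
      (fun j hj => hW.eq_zero_of_gt ?_)]
    · push_cast; ring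
    · push_cast at hJ
      have : (J' : ℝ) ≤ j := by exact_mod_cast hj
      rw [lt_div_iff₀ hK0]; linarith
  simp_rw [← hshift] at hb₁
  set S := ‖∑ s ∈ sumRange N H n, amplitude F W U t N H l α β s *
        ((∑ j ∈ Finset.range (J' + 1), W (2 * j / K) * (-1) ^ j * besselJ (2 * j) (besselArg M s) : ℝ) : ℂ)‖
  set P : ℝ := H * (√t + N / √t) * N * l ^ (-(3 / 2) : ℝ) * M ^ (-(1 / 2) : ℝ) with hP
  have hPeq : H * (√t + N / √t) * (N / l ^ 2) * (M / l) ^ (-(1 / 2) : ℝ) = P := by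
    have h1 : l ^ (-(3 / 2) : ℝ) = (l ^ (-(1 / 2) : ℝ))⁻¹ / l ^ 2 := by
      rw [← Real.rpow_neg hl0.le, ← Real.rpow_natCast, ← Real.rpow_sub hl0]; norm_num
    rw [Real.div_rpow hM.le hl0.le, hP, h1]
    field_simp
  set X : ℝ := N / (M * K ^ 2) with hX
  set Xl : ℝ := N / (l * M * K ^ 2) with hXl
  have hXl0 : 0 < Xl := by positivity
  have hXlX : Xl ≤ X := by
    rw [hXl, hX]
    apply div_le_div_of_nonneg_left hN0.le (by positivity)
    have : M * K ^ 2 ≤ l * (M * K ^ 2) := le_mul_of_one_le_left (by positivity) hl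
    linarith
  have hMl : M * l / N ≤ 1 / Xl := by
    rw [hXl, one_div_div]
    apply div_le_div_of_nonneg_right _ hN0.le
    have : l * M ≤ l * M * K ^ 2 :=
      le_mul_of_one_le_right (by positivity) (one_le_pow₀ hK)
    linarith
  have hs0 : S ≤ C₀ * E₀ * (P * (1 + 1 / Xl)) := by
    refine hb₀.trans ?_
    rw [← hPeq]
    calc _ = C₀ * E₀ * (H * (√t + N / √t) * (N / l ^ 2) * (M / l) ^ (-(1 / 2) : ℝ) * (1 + M * l / N)) := by
          ring
      _ ≤ _ := by gcongr
  have hs1 : S ≤ C₁ * E * (P * (Xl ^ 2 * (1 + 1 / Xl))) := by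
    refine hb₁.trans ?_
    rw [← hPeq]
    calc _ = C₁ * E * (H * (√t + N / √t) * (N / l ^ 2) * (M / l) ^ (-(1 / 2) : ℝ) *
            (Xl ^ 2 * (1 + M * l / N))) := by
          rw [hXl]; field_simp
      _ ≤ _ := by gcongr
  have hpos0 : 0 ≤ C₀ * E₀ := by positivity
  have hpos1 : 0 ≤ C₁ * E := by positivity
  -- The two bounds are `P (1 + 1/Xl)` and `P (Xl² + Xl)` up to constants: the first is used for `Xl
  -- ≥ 1`, the second for `Xl ≤ 1`.
  rcases le_total 1 Xl with h1 | h1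
  · rw [min_eq_left (h1.trans hXlX), mul_one]
    have h2 : 1 / Xl ≤ 1 := by rw [div_le_one hXl0]; exact h1
    calc S ≤ C₀ * E₀ * (P * (1 + 1 / Xl)) := hs0
      _ ≤ C₀ * E₀ * (P * 2) := by gcongr; linarith
      _ = 2 * (C₀ * E₀) * P := by ring
      _ ≤ 2 * (C₀ * E₀ + C₁ * E) * P := by gcongr; linarith
  · have h2 : Xl ≤ min 1 X := le_min h1 hXlX
    have h3 : Xl ^ 2 * (1 + 1 / Xl) ≤ 2 * min 1 X := by
      have : Xl ^ 2 * (1 + 1 / Xl) = Xl ^ 2 + Xl := by field_simp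
      nlinarith
    calc S ≤ C₁ * E * (P * (Xl ^ 2 * (1 + 1 / Xl))) := hs1
      _ ≤ C₁ * E * (P * (2 * min 1 X)) := by gcongr
      _ = 2 * (C₁ * E) * (P * min 1 X) := by ring
      _ ≤ 2 * (C₀ * E₀ + C₁ * E) * (P * min 1 X) := by gcongr; linarith

/-! ### Finiteness of the outer sums -/

lemma tsum_pnat_eq_sum_range {f : ℕ → ℂ} {n : ℕ} (h0 : f 0 = 0) (hn : ∀ m, n ≤ m → f m = 0) :
    ∑' m : ℕ+, f m = ∑ m ∈ Finset.range n, f m := by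
  rw [PNat.coe_injective.tsum_eq (f := f), tsum_eq_sum]
  · intro m hm
    exact hn m (by simpa using hm)
  · intro m hm
    have : m ≠ 0 := fun h => hm (h ▸ h0)
    exact ⟨⟨m, Nat.pos_of_ne_zero this⟩, rfl⟩

lemma tsum_pnat_eq_sum_Ico {f : ℕ → ℂ} {n : ℕ} (hn : ∀ m, n ≤ m → f m = 0) :
    ∑' m : ℕ+, f m = ∑ m ∈ Finset.Ico 1 n, f m := by
  have h := tsum_pnat_eq_sum_range (f := fun m => if m = 0 then 0 else f m) (n := n) (by simp)
    (fun m hm => by simp [hn m hm])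
  have h1 : ∑' m : ℕ+, f m = ∑' m : ℕ+, (fun m => if m = 0 then 0 else f m) (m : ℕ) :=
    tsum_congr fun m => by simp
  rw [h1, h]
  symm
  apply Finset.sum_subset_zero_on_sdiff
  · intro m hm
    have := Finset.mem_Ico.1 hm
    exact Finset.mem_range.2 this.2
  · intro m hm
    simp only [Finset.mem_sdiff, Finset.mem_range, Finset.mem_Ico, not_and, not_lt] at hm
    have : m = 0 := by by_contra h0; omega
    simp [this]
  · intro m hm
    have := Finset.mem_Ico.1 hm
    simp [show m ≠ 0 by omega]

lemma tsum_odd_eq_sum {f : ℕ → ℂ} {J : ℕ} (h0 : f 0 = 0) (hJ : ∀ j, J ≤ j → f j = 0) :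
    ∑' k : ℕ, (if Odd k then f (k / 2) else 0) = ∑ j ∈ Finset.Ico 1 J, f j := by
  have hinj : Function.Injective (fun j : ℕ => 2 * j + 1) := fun a b h => by
    simp only at h; omega
  rw [← hinj.tsum_eq]
  · have : ∀ j : ℕ, (if Odd (2 * j + 1) then f ((2 * j + 1) / 2) else 0) = f j := fun j => by
      rw [if_pos ⟨j, rfl⟩]; congr 1; omega
    simp_rw [this]
    apply tsum_eq_sum
    intro j hj
    simp only [Finset.mem_Ico, not_and, not_lt] at hj
    by_cases h : j = 0
    · rw [h, h0]
    · exact hJ j (hj (by omega))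
  · intro k hk
    by_contra hk'
    refine hk (if_neg ?_)
    rintro ⟨j, hj⟩
    exact hk' ⟨j, hj.symm⟩

lemma norm_kloosterman_le {q : ℕ} (ψ : DirichletCharacter ℂ q) (a b : ℤ) (M : ℕ) :
    ‖kloosterman ψ a b M‖ ≤ M := by
  rw [kloosterman]
  refine (norm_sum_le_of_le (n := fun _ => (1 : ℝ)) _ fun x _ => ?_).trans ?_
  · rw [norm_mul, norm_e, mul_one]
    exact ψ.norm_le_one _
  · rw [Finset.sum_const, nsmul_eq_mul, mul_one]
    exact_mod_cast (Finset.card_filter_le _ _).trans (by simp)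

/-- The trivial Kloosterman bound cancels `1/(c q)`, and the Bessel function of order at least `2`
provides `c⁻²`. -/
lemma norm_peterssonTerm_le {q : ℕ} (hq : 1 ≤ q) (ψ : DirichletCharacter ℂ q) (j : ℕ) (r : ℤ) (m : ℕ)
    {c : ℕ} (hc : 1 ≤ c) :
    ‖peterssonTerm ψ (2 * (j + 1) + 1) r m c‖ ≤ (4 * Real.pi * √(m * r)) ^ 2 * ((c : ℝ) ^ 2)⁻¹ := by
  have hq' : (1 : ℝ) ≤ q := by exact_mod_cast hq
  have hM : (0 : ℝ) < (c * q : ℕ) := by exact_mod_cast Nat.mul_pos hc hq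
  have hI : ‖Complex.I ^ (-((2 * (j + 1) + 1 : ℕ) : ℤ))‖ = 1 := by simp
  rw [peterssonTerm, norm_mul, norm_div, norm_mul, hI, one_mul, Complex.norm_natCast]
  have h1 : ‖kloosterman ψ r m (c * q)‖ / (c * q : ℕ) ≤ 1 := by
    rw [div_le_one hM]; exact norm_kloosterman_le _ _ _ _
  have h2 : ‖((besselJ (2 * (j + 1) + 1 - 1) (4 * Real.pi * √(m * r) / (c * q)) : ℝ) : ℂ)‖ ≤
      (4 * Real.pi * √(m * r)) ^ 2 * ((c : ℝ) ^ 2)⁻¹ := by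
    rw [Complex.norm_real, Real.norm_eq_abs, show 2 * (j + 1) + 1 - 1 = 2 * j + 2 by omega]
    refine (abs_besselJ_add_two_le _ (by positivity)).trans ?_
    rw [div_pow, div_eq_mul_inv]
    gcongr
    exact le_mul_of_one_le_right (by positivity) hq'
  calc _ ≤ 1 * ((4 * Real.pi * √(m * r)) ^ 2 * ((c : ℝ) ^ 2)⁻¹) := by gcongr
    _ = _ := one_mul _

lemma summable_pnat_inv_sq : Summable fun c : ℕ+ => (((c : ℕ) : ℝ) ^ 2)⁻¹ :=
  (Real.summable_nat_pow_inv.2 (by norm_num : 1 < 2)).comp_injective PNat.coe_injective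

lemma summable_peterssonTerm {q : ℕ} (hq : 1 ≤ q) (ψ : DirichletCharacter ℂ q) {j : ℕ} (hj : 1 ≤ j)
    (r : ℤ) (m : ℕ) : Summable fun c : ℕ+ => peterssonTerm ψ (2 * j + 1) r m c := by
  obtain ⟨i, rfl⟩ : ∃ i, j = i + 1 := ⟨j - 1, by omega⟩
  exact Summable.of_norm_bounded (summable_pnat_inv_sq.mul_left _)
    fun c => norm_peterssonTerm_le hq ψ i r m c.pos

/-! ### Odd characters -/

/-- The finite set of odd characters modulo `q`. -/
noncomputable def oddCharacters (q : ℕ) : Finset (DirichletCharacter ℂ q) :=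
  (Set.toFinite {ψ : DirichletCharacter ℂ q | ψ.Odd}).toFinset

lemma finsum_odd_eq_sum {q : ℕ} (f : DirichletCharacter ℂ q → ℂ) :
    ∑ᶠ (ψ : DirichletCharacter ℂ q) (_ : ψ.Odd), f ψ = ∑ ψ ∈ oddCharacters q, f ψ :=
  finsum_mem_eq_finite_toFinset_sum f (Set.toFinite {ψ : DirichletCharacter ℂ q | ψ.Odd})

/-- Twice the odd part of `∑ ψ(a)` is `∑ ψ(a) - ∑ ψ(-a)` over all characters; then orthogonality. -/
lemma norm_sum_oddCharacters_le {q : ℕ} [NeZero q] (a : ZMod q) :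
    ‖∑ ψ ∈ oddCharacters q, ψ a‖ ≤
      q / 2 * ((if a = 1 then 1 else 0) + (if a = -1 then 1 else 0)) := by
  have h : 2 * ∑ ψ ∈ oddCharacters q, ψ a =
      ∑ ψ : DirichletCharacter ℂ q, ψ a - ∑ ψ : DirichletCharacter ℂ q, ψ (-a) := by
    rw [Finset.mul_sum, ← Finset.sum_sub_distrib]
    apply Finset.sum_subset_zero_on_sdiff (Finset.subset_univ _)
    · intro ψ hψ
      have : ¬ ψ.Odd := by simpa [oddCharacters] using hψ
      have he : ψ.Even := ψ.even_or_odd.resolve_right this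
      rw [he.eval_neg, sub_self]
    · intro ψ hψ
      have ho : ψ.Odd := by simpa [oddCharacters] using hψ
      rw [ho.eval_neg]; ring
  rw [DirichletCharacter.sum_characters_eq, DirichletCharacter.sum_characters_eq] at h
  have htot : ((q.totient : ℕ) : ℝ) ≤ q := by exact_mod_cast Nat.totient_le q
  have hn : ∀ P : Prop, [Decidable P] →
      ‖(if P then (q.totient : ℂ) else 0)‖ ≤ q * (if P then 1 else 0) := by
    intro P _
    split_ifs <;> simp [htot]
  have h2 : 2 * ‖∑ ψ ∈ oddCharacters q, ψ a‖ ≤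
      q * (if a = 1 then 1 else 0) + q * (if -a = 1 then 1 else 0) := by
    calc _ = ‖2 * ∑ ψ ∈ oddCharacters q, ψ a‖ := by rw [norm_mul]; norm_num
      _ ≤ _ := by rw [h]; exact (norm_sub_le _ _).trans (add_le_add (hn _) (hn _))
  have h3 : (-a = 1) ↔ (a = -1) := neg_eq_iff_eq_neg
  simp only [h3] at h2
  linarith

/-- As `u² = 1`, the condition `l x = u` fixes `x` modulo `q`, leaving at most `c` lifts modulo `c
q`. -/
lemma card_mul_eq_le {q : ℕ} (c : ℕ) (l u : ZMod q) (hu : u * u = 1) :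
    (((Finset.range (c * q)).filter fun x : ℕ => l * (x : ZMod q) = u).card : ℝ) ≤ c := by
  have : ((Finset.range (c * q)).filter fun x : ℕ => l * (x : ZMod q) = u).card ≤
      (Finset.range c).card := by
    apply Finset.card_le_card_of_injOn (fun x => x / q)
    · intro x hx
      have hx := (Finset.mem_filter.1 hx).1
      simp only [Finset.coe_range, Set.mem_Iio]
      exact Nat.div_lt_of_lt_mul (by rw [mul_comm]; exact Finset.mem_range.1 hx)
    · intro x hx y hy hxy
      have hx := (Finset.mem_filter.1 hx).2
      have hy := (Finset.mem_filter.1 hy).2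
      have h1 : (x : ZMod q) = y := by
        calc (x : ZMod q) = x * (u * u) := by rw [hu, mul_one]
          _ = x * (l * y) * u := by rw [hy]; ring
          _ = (l * x) * y * u := by ring
          _ = y * (u * u) := by rw [hx]; ring
          _ = y := by rw [hu, mul_one]
      have h2 := (ZMod.natCast_eq_natCast_iff' x y q).1 h1
      simp only at hxy
      rw [← Nat.div_add_mod x q, ← Nat.div_add_mod y q, hxy, h2]
  rw [Finset.card_range] at this
  exact_mod_cast this

/-- The character sum lives on the classes `l x = ±1`, at most `c` lifts each, with weight `q/2`.
The resulting mass `c q` is exactly offset by the normalisation of the Kloosterman sum. -/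
lemma sum_norm_sum_oddCharacters_le {q : ℕ} [NeZero q] (c : ℕ) (l : ZMod q) (p : ℕ → Prop)
    [DecidablePred p] :
    ∑ x ∈ (Finset.range (c * q)).filter p, ‖∑ ψ ∈ oddCharacters q, ψ l * ψ (x : ZMod q)‖ ≤
      c * q := by
  have h1 := card_mul_eq_le c l 1 (by ring)
  have h2 := card_mul_eq_le c l (-1) (by ring)
  calc ∑ x ∈ (Finset.range (c * q)).filter p, ‖∑ ψ ∈ oddCharacters q, ψ l * ψ (x : ZMod q)‖
      ≤ ∑ x ∈ Finset.range (c * q), ‖∑ ψ ∈ oddCharacters q, ψ l * ψ (x : ZMod q)‖ :=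
        Finset.sum_le_sum_of_subset_of_nonneg (Finset.filter_subset _ _) fun _ _ _ => norm_nonneg _
    _ ≤ ∑ x ∈ Finset.range (c * q), (q / 2 : ℝ) *
          ((if l * (x : ZMod q) = 1 then 1 else 0) + (if l * (x : ZMod q) = -1 then 1 else 0)) := by
        refine Finset.sum_le_sum fun x _ => ?_
        simp_rw [← map_mul]
        exact norm_sum_oddCharacters_le _
    _ = q / 2 * (((Finset.range (c * q)).filter fun x : ℕ => l * (x : ZMod q) = 1).card +
          ((Finset.range (c * q)).filter fun x : ℕ => l * (x : ZMod q) = -1).card) := by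
        rw [← Finset.mul_sum, Finset.sum_add_distrib, Finset.sum_boole, Finset.sum_boole]
    _ ≤ q / 2 * (c + c) := by gcongr
    _ = c * q := by ring

/-! ### Interchanging the sums -/

lemma sum_reorder {ι₁ ι₂ ι₃ ι₄ ι₅ ι₆ ι₇ : Type*} (s₁ : Finset ι₁) (s₂ : Finset ι₂) (s₃ : Finset ι₃)
    (s₄ : Finset ι₄) (s₅ : Finset ι₅) (s₆ : Finset ι₆) (s₇ : Finset ι₇)
    (f : ι₁ → ι₂ → ι₃ → ι₄ → ι₅ → ι₆ → ι₇ → ℂ) :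
    ∑ j ∈ s₁, ∑ ψ ∈ s₂, ∑ m ∈ s₃, ∑ l ∈ s₄, ∑ n ∈ s₅, ∑ h ∈ s₆, ∑ x ∈ s₇, f j ψ m l n h x =
      ∑ l ∈ s₄, ∑ x ∈ s₇, ∑ m ∈ s₃, ∑ h ∈ s₆, ∑ n ∈ s₅, ∑ j ∈ s₁, ∑ ψ ∈ s₂, f j ψ m l n h x := by
  have : ∑ p ∈ s₁ ×ˢ s₂ ×ˢ s₃ ×ˢ s₄ ×ˢ s₅ ×ˢ s₆ ×ˢ s₇,
        f p.1 p.2.1 p.2.2.1 p.2.2.2.1 p.2.2.2.2.1 p.2.2.2.2.2.1 p.2.2.2.2.2.2 =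
      ∑ p ∈ s₄ ×ˢ s₇ ×ˢ s₃ ×ˢ s₆ ×ˢ s₅ ×ˢ s₁ ×ˢ s₂,
        f p.2.2.2.2.2.1 p.2.2.2.2.2.2 p.2.2.1 p.1 p.2.2.2.2.1 p.2.2.2.1 p.2.1 := by
    refine Finset.sum_nbij'
      (fun p => (p.2.2.2.1, p.2.2.2.2.2.2, p.2.2.1, p.2.2.2.2.2.1, p.2.2.2.2.1, p.1, p.2.1))
      (fun p => (p.2.2.2.2.2.1, p.2.2.2.2.2.2, p.2.2.1, p.1, p.2.2.2.2.1, p.2.2.2.1, p.2.1))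
      ?_ ?_ ?_ ?_ ?_
    · rintro ⟨a, b, c, d, e, f, g⟩ h
      simp only [Finset.mem_product] at h ⊢
      tauto
    · rintro ⟨a, b, c, d, e, f, g⟩ h
      simp only [Finset.mem_product] at h ⊢
      tauto
    all_goals intros; rfl
  simpa only [Finset.sum_product] using this

lemma I_zpow_neg_odd (j : ℕ) : Complex.I ^ (-((2 * j + 1 : ℕ) : ℤ)) = -Complex.I * (-1) ^ j := by
  rw [zpow_neg, zpow_natCast, pow_succ, pow_mul, Complex.I_sq, mul_inv, Complex.inv_I]
  have : (((-1 : ℂ) ^ j)⁻¹) = (-1) ^ j := by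
    rw [← inv_pow]; norm_num
  rw [this]; ring

lemma intCast_cpow_I_mul {r : ℤ} (hr : 0 < r) (t : ℝ) :
    (r : ℂ) ^ (Complex.I * (t : ℂ)) = Complex.exp (Complex.I * ((t * Real.log r : ℝ) : ℂ)) := by
  have hr' : (0 : ℝ) < r := by exact_mod_cast hr
  rw [Complex.cpow_def_of_ne_zero (by exact_mod_cast hr.ne'), ← Complex.ofReal_intCast,
    ← Complex.ofReal_log hr'.le]
  push_cast
  congr 1; ring

/-- The part of the off-diagonal belonging to a modulus `c q`. -/
noncomputable def modulusPart {k₀ : ℤ} (F : CuspForm 𝒮ℒ k₀) (W U : ℝ → ℝ) (t N H K : ℝ) (n J q c : ℕ) :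
    ℂ :=
  ∑ j ∈ Finset.Ico 1 J, (W (2 * j / K) : ℂ) * ∑ ψ ∈ oddCharacters q,
    ∑ m ∈ Finset.range n, ∑ l ∈ Finset.Ico 1 n, fourierCoeff F m * ψ (l : ZMod q) *
      (U ((m : ℝ) * (l : ℝ) ^ 2 / N) : ℂ) *
        ∑ ν ∈ Finset.Ioc ⌊N⌋₊ ⌊2 * N⌋₊, ∑ h ∈ Finset.Icc (1 : ℤ) ⌊2 * H⌋,
          (((ν : ℤ) + h : ℤ) : ℂ) ^ (Complex.I * (t : ℂ)) * (W ((h : ℝ) / H) : ℂ) *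
            peterssonTerm ψ (2 * j + 1) ((ν : ℤ) + h) m c

lemma e_eq_exp_I_mul (x : ℝ) : e x = Complex.exp (Complex.I * ((2 * Real.pi * x : ℝ) : ℂ)) := by
  rw [e]; push_cast; congr 1; ring

/-- Opening the Kloosterman sum isolates the characters in a coefficient depending on `l` and `x`
alone. What remains is the amplitude with `α = x̄/M`, `β = 2πx/M`, and `i^(-k)` becomes `-i (-1)^j`.
-/
lemma modulusPart_eq {k₀ : ℤ} (F : CuspForm 𝒮ℒ k₀) {W U : ℝ → ℝ} (hW0 : W 0 = 0) (t N H K : ℝ)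
    (n J q c : ℕ) :
    modulusPart F W U t N H K n J q c = ∑ l ∈ Finset.Ico 1 n,
      ∑ x ∈ (Finset.range (c * q)).filter (fun x => Nat.Coprime x (c * q)),
        (∑ ψ ∈ oddCharacters q, ψ (l : ZMod q) * ψ (x : ZMod q)) * (-Complex.I / ((c * q : ℕ) : ℂ)) *
          ∑ s ∈ sumRange N H n,
            amplitude F W U t N H l ((((x : ZMod (c * q))⁻¹).val : ℝ) / (c * q : ℕ))
              (2 * Real.pi * x / (c * q : ℕ)) s *
            ((∑ j ∈ Finset.range J,
              W (2 * j / K) * (-1) ^ j * besselJ (2 * j) (besselArg (c * q : ℕ) s) : ℝ) : ℂ) := by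
  have hJ : ∀ s, (∑ j ∈ Finset.range J,
      W (2 * j / K) * (-1) ^ j * besselJ (2 * j) (besselArg (c * q : ℕ) s) : ℝ) =
      ∑ j ∈ Finset.Ico 1 J,
        W (2 * j / K) * (-1) ^ j * besselJ (2 * j) (besselArg (c * q : ℕ) s) := by
    intro s
    symm
    apply Finset.sum_subset
    · intro j hj
      exact Finset.mem_range.2 (Finset.mem_Ico.1 hj).2
    · intro j hj hj'
      have := Finset.mem_range.1 hj
      have : j = 0 := by
        by_contra h
        exact hj' (Finset.mem_Ico.2 ⟨by omega, this⟩)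
      simp [this, hW0]
  simp_rw [hJ]
  simp only [modulusPart, peterssonTerm, kloosterman, sumRange, Finset.sum_product, Complex.ofReal_sum,
    Finset.mul_sum, Finset.sum_mul, Finset.sum_div]
  rw [sum_reorder]
  refine Finset.sum_congr rfl fun l _ => Finset.sum_congr rfl fun x _ =>
    Finset.sum_congr rfl fun m _ => Finset.sum_congr rfl fun h hh => Finset.sum_congr rfl fun ν _ =>
    Finset.sum_congr rfl fun j _ => Finset.sum_congr rfl fun ψ _ => ?_
  have hr : 0 < (ν : ℤ) + h := by
    have := (Finset.mem_Icc.1 hh).1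
    omega
  have he : e ((((((ν : ℤ) + h : ℤ) : ℝ)) * x + ((m : ℤ) : ℝ) * (((x : ZMod (c * q))⁻¹).val : ℝ)) /
      (c * q : ℕ)) = e (m * ((((x : ZMod (c * q))⁻¹).val : ℝ) / (c * q : ℕ))) *
      Complex.exp (Complex.I * ((2 * Real.pi * x / (c * q : ℕ) * (((ν : ℤ) + h : ℤ) : ℝ) : ℝ) : ℂ)) := by
    rw [show 2 * Real.pi * x / (c * q : ℕ) * (((ν : ℤ) + h : ℤ) : ℝ) =
      2 * Real.pi * ((((ν : ℤ) + h : ℤ) : ℝ) * x / (c * q : ℕ)) by ring, ← e_eq_exp_I_mul, ← e_add]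
    congr 1
    rw [Int.cast_natCast]; ring
  have hU : (m : ℝ) * (l : ℝ) ^ 2 / N = m * ((l : ℝ) ^ 2 / N) := by ring
  have hexp : Complex.exp (Complex.I * ((t * Real.log (((ν : ℤ) + h : ℤ) : ℝ) +
      2 * Real.pi * x / (c * q : ℕ) * (((ν : ℤ) + h : ℤ) : ℝ) : ℝ) : ℂ)) =
      Complex.exp (Complex.I * ((t * Real.log (((ν : ℤ) + h : ℤ) : ℝ) : ℝ) : ℂ)) *
      Complex.exp (Complex.I * ((2 * Real.pi * x / (c * q : ℕ) * (((ν : ℤ) + h : ℤ) : ℝ) : ℝ) : ℂ)) := by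
    rw [← Complex.exp_add, ← mul_add, ← Complex.ofReal_add]
  have hb : besselArg (c * q : ℕ) (m, h, ν) =
      4 * Real.pi * √(m * (((ν : ℤ) + h : ℤ) : ℝ)) / (c * q) := by
    rw [besselArg, Nat.cast_mul]
  rw [hb, I_zpow_neg_odd, intCast_cpow_I_mul hr, he, hU]
  simp only [amplitude]
  rw [hexp]
  push_cast
  ring

/-- All sums except that over `c` are finite, so `c` may be moved outermost. The supports give `m l²
≤ 3N < n` and `j ≤ K < J`, and `j = 0` drops out because `W 0 = 0`. -/
lemma hasSum_modulusPart {k₀ : ℤ} (F : CuspForm 𝒮ℒ k₀) {B : ℕ → ℝ} {W U : ℝ → ℝ} (hW : IsBump B W)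
    (hU : IsPlateau B U) {t N H K : ℝ} (hN : 0 < N) (hH : 0 < H) (hK : 0 < K) {n J : ℕ}
    (hn : 3 * N < n) (hJ : K < J) (𝒬 : Finset ℕ) (h𝒬 : ∀ q ∈ 𝒬, 1 ≤ q) :
    HasSum (fun c : ℕ+ => ∑ q ∈ 𝒬, modulusPart F W U t N H K n J q c)
      (offDiag F W U 𝒬 t N H K) := by
  have hW0 : W 0 = 0 := hW.eq_zero_of_lt (by norm_num)
  have hU0 : U 0 = 0 := hU.eq_zero (by norm_num)
  have hUbig : ∀ m l : ℕ, 1 ≤ m → 1 ≤ l → n ≤ m ∨ n ≤ l → U ((m : ℝ) * (l : ℝ) ^ 2 / N) = 0 := by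
    intro m l hm hl h
    apply hU.eq_zero
    have hm' : (1 : ℝ) ≤ m := by exact_mod_cast hm
    have hl' : (1 : ℝ) ≤ l := by exact_mod_cast hl
    have hge : (n : ℝ) ≤ m * (l : ℝ) ^ 2 := by
      rcases h with h | h
      · have h' : (n : ℝ) ≤ m := by exact_mod_cast h
        exact h'.trans (le_mul_of_one_le_right (Nat.cast_nonneg m) (one_le_pow₀ hl'))
      · have h' : (n : ℝ) ≤ l := by exact_mod_cast h
        nlinarith
    simp only [Set.mem_Icc, not_and, not_le]
    intro _
    rw [lt_div_iff₀ hN]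
    linarith
  have hWint : ∀ h : ℤ, h ∉ Finset.Icc (1 : ℤ) ⌊2 * H⌋ → W ((h : ℝ) / H) = 0 := by
    intro h hh
    simp only [Finset.mem_Icc, not_and, not_le] at hh
    by_cases h1 : 1 ≤ h
    · have h2 := Int.floor_lt.1 (hh h1)
      apply hW.eq_zero_of_gt
      rwa [lt_div_iff₀ hH]
    · apply hW.eq_zero_of_lt
      have : (h : ℝ) ≤ 0 := by exact_mod_cast (by omega : h ≤ 0)
      have : (h : ℝ) / H ≤ 0 := div_nonpos_of_nonpos_of_nonneg this hH.le
      linarith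
  have heq : offDiag F W U 𝒬 t N H K = ∑ j ∈ Finset.Ico 1 J, (W (2 * j / K) : ℂ) * ∑ q ∈ 𝒬,
      ∑ ψ ∈ oddCharacters q, ∑ m ∈ Finset.range n, ∑ l ∈ Finset.Ico 1 n,
        fourierCoeff F m * ψ (l : ZMod q) * (U ((m : ℝ) * (l : ℝ) ^ 2 / N) : ℂ) *
        ∑ ν ∈ Finset.Ioc ⌊N⌋₊ ⌊2 * N⌋₊, ∑ h ∈ Finset.Icc (1 : ℤ) ⌊2 * H⌋,
          (((ν : ℤ) + h : ℤ) : ℂ) ^ (Complex.I * (t : ℂ)) * (W ((h : ℝ) / H) : ℂ) *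
            ∑' c : ℕ+, peterssonTerm ψ (2 * j + 1) ((ν : ℤ) + h) m c := by
    rw [offDiag, ← tsum_odd_eq_sum]
    · refine tsum_congr fun k => ?_
      by_cases hk : Odd k
      · rw [if_pos hk, if_pos hk]
        obtain ⟨j, rfl⟩ := hk
        rw [show (2 * j + 1) / 2 = j by omega]
        congr 3
        · push_cast; ring
        · funext q
          rw [finsum_odd_eq_sum]
          refine Finset.sum_congr rfl fun ψ _ => ?_
          have hh : ∀ (ν m : ℕ), ∑' h : ℤ, (((ν : ℤ) + h : ℤ) : ℂ) ^ (Complex.I * (t : ℂ)) *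
              (W ((h : ℝ) / H) : ℂ) * ∑' c : ℕ+, peterssonTerm ψ (2 * j + 1) ((ν : ℤ) + h) m c =
              ∑ h ∈ Finset.Icc (1 : ℤ) ⌊2 * H⌋, (((ν : ℤ) + h : ℤ) : ℂ) ^ (Complex.I * (t : ℂ)) *
              (W ((h : ℝ) / H) : ℂ) * ∑' c : ℕ+, peterssonTerm ψ (2 * j + 1) ((ν : ℤ) + h) m c := by
            intro ν m
            apply tsum_eq_sum
            intro h hh
            rw [hWint h hh]; simp
          simp_rw [hh]
          rw [← tsum_pnat_eq_sum_range (f := fun m => ∑ l ∈ Finset.Ico 1 n,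
            fourierCoeff F m * ψ (l : ZMod q) * (U ((m : ℝ) * (l : ℝ) ^ 2 / N) : ℂ) *
            ∑ ν ∈ Finset.Ioc ⌊N⌋₊ ⌊2 * N⌋₊, ∑ h ∈ Finset.Icc (1 : ℤ) ⌊2 * H⌋,
              (((ν : ℤ) + h : ℤ) : ℂ) ^ (Complex.I * (t : ℂ)) * (W ((h : ℝ) / H) : ℂ) *
              ∑' c : ℕ+, peterssonTerm ψ (2 * j + 1) ((ν : ℤ) + h) m c)]
          · refine tsum_congr fun m => ?_
            apply tsum_pnat_eq_sum_Ico (f := fun l => fourierCoeff F m * ψ (l : ZMod q) *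
              (U ((m : ℝ) * (l : ℝ) ^ 2 / N) : ℂ) * _)
            intro l hl
            by_cases hl0 : l = 0
            · subst hl0; simp [hU0]
            · simp [hUbig m l m.pos (by omega) (Or.inr hl)]
          · simp [hU0]
          · intro m hm
            refine Finset.sum_eq_zero fun l hl => ?_
            have hl := Finset.mem_Ico.1 hl
            simp [hUbig m l (by omega) hl.1 (Or.inl hm)]
      · rw [if_neg hk, if_neg hk]
    · simp [hW0]
    · intro j hj
      have hj' : (J : ℝ) ≤ j := by exact_mod_cast hj
      rw [hW.eq_zero_of_gt, Complex.ofReal_zero, zero_mul]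
      rw [lt_div_iff₀ hK]
      linarith
  rw [heq]
  simp only [modulusPart]
  have hcomm : ∀ c : ℕ+, (∑ q ∈ 𝒬, ∑ j ∈ Finset.Ico 1 J, (W (2 * j / K) : ℂ) *
      ∑ ψ ∈ oddCharacters q, ∑ m ∈ Finset.range n, ∑ l ∈ Finset.Ico 1 n,
        fourierCoeff F m * ψ (l : ZMod q) * (U ((m : ℝ) * (l : ℝ) ^ 2 / N) : ℂ) *
        ∑ ν ∈ Finset.Ioc ⌊N⌋₊ ⌊2 * N⌋₊, ∑ h ∈ Finset.Icc (1 : ℤ) ⌊2 * H⌋,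
          (((ν : ℤ) + h : ℤ) : ℂ) ^ (Complex.I * (t : ℂ)) * (W ((h : ℝ) / H) : ℂ) *
            peterssonTerm ψ (2 * j + 1) ((ν : ℤ) + h) m c) =
      ∑ j ∈ Finset.Ico 1 J, (W (2 * j / K) : ℂ) * ∑ q ∈ 𝒬,
      ∑ ψ ∈ oddCharacters q, ∑ m ∈ Finset.range n, ∑ l ∈ Finset.Ico 1 n,
        fourierCoeff F m * ψ (l : ZMod q) * (U ((m : ℝ) * (l : ℝ) ^ 2 / N) : ℂ) *
        ∑ ν ∈ Finset.Ioc ⌊N⌋₊ ⌊2 * N⌋₊, ∑ h ∈ Finset.Icc (1 : ℤ) ⌊2 * H⌋,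
          (((ν : ℤ) + h : ℤ) : ℂ) ^ (Complex.I * (t : ℂ)) * (W ((h : ℝ) / H) : ℂ) *
            peterssonTerm ψ (2 * j + 1) ((ν : ℤ) + h) m c := by
    intro c
    rw [Finset.sum_comm]
    simp_rw [Finset.mul_sum]
  simp_rw [hcomm]
  exact hasSum_sum fun j hj => HasSum.mul_left _ <| hasSum_sum fun q hq => hasSum_sum fun ψ _ =>
    hasSum_sum fun m _ => hasSum_sum fun l _ => HasSum.mul_left _ <| hasSum_sum fun ν _ =>
    hasSum_sum fun h _ => HasSum.mul_left _
      (summable_peterssonTerm (h𝒬 q hq) ψ (Finset.mem_Ico.1 hj).1 _ m).hasSum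

/-! ### The bound for the off-diagonal -/

/-- The sum over `x` costs nothing after normalisation, and the sum over `l` converges because of
`l^(-3/2)`. -/
lemma exists_norm_modulusPart_le {k₀ : ℤ} (F : CuspForm 𝒮ℒ k₀) (B : ℕ → ℝ) (N₀ : ℝ) :
    ∃ C, 0 ≤ C ∧ ∀ W U : ℝ → ℝ, IsBump B W → IsPlateau B U →
      ∀ t N H K : ℝ, 1 ≤ t → 1 ≤ N → √t ≤ N → 0 < H → H ≤ N → 1 ≤ K →
      ∀ q c : ℕ, 1 ≤ q → 1 ≤ c → (100 * N ≤ t * (c * q : ℕ) ∨ N ≤ N₀) →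
      ∀ n J : ℕ, 3 * N < n → K + 2 < J →
        ‖modulusPart F W U t N H K n J q c‖ ≤
          C * (H * (√t + N / √t) * N * ((c * q : ℕ) : ℝ) ^ (-(1 / 2) : ℝ) *
            min 1 (N / ((c * q : ℕ) * K ^ 2))) := by
  obtain ⟨C, hC, hb⟩ := exists_norm_sum_bessel_le F B N₀
  have hsum : Summable fun l : ℕ => (l : ℝ) ^ (-(3 / 2) : ℝ) :=
    Real.summable_nat_rpow.2 (by norm_num)
  set Z := ∑' l : ℕ, (l : ℝ) ^ (-(3 / 2) : ℝ) with hZ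
  refine ⟨Z * C, by positivity, ?_⟩
  intro W U hW hU t N H K ht hN htN hH hHN hK q c hq hc hcase n J hn hJ
  have : NeZero q := ⟨by omega⟩
  have hN0 : 0 < N := by linarith
  have hMpos : 0 < c * q := Nat.mul_pos hc hq
  have hM : (0 : ℝ) < (c * q : ℕ) := by exact_mod_cast hMpos
  set P : ℝ := H * (√t + N / √t) * N with hP
  set R : ℝ := ((c * q : ℕ) : ℝ) ^ (-(1 / 2) : ℝ) * min 1 (N / ((c * q : ℕ) * K ^ 2)) with hR
  rw [modulusPart_eq F (hW.eq_zero_of_lt (by norm_num))]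
  have hterm : ∀ l ∈ Finset.Ico 1 n,
      ‖∑ x ∈ (Finset.range (c * q)).filter (fun x => Nat.Coprime x (c * q)),
        (∑ ψ ∈ oddCharacters q, ψ (l : ZMod q) * ψ (x : ZMod q)) * (-Complex.I / ((c * q : ℕ) : ℂ)) *
          ∑ s ∈ sumRange N H n,
            amplitude F W U t N H l ((((x : ZMod (c * q))⁻¹).val : ℝ) / (c * q : ℕ))
              (2 * Real.pi * x / (c * q : ℕ)) s *
            ((∑ j ∈ Finset.range J,
              W (2 * j / K) * (-1) ^ j * besselJ (2 * j) (besselArg (c * q : ℕ) s) : ℝ) : ℂ)‖ ≤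
        C * P * R * (l : ℝ) ^ (-(3 / 2) : ℝ) := by
    intro l hl
    have hl1 : (1 : ℝ) ≤ l := by exact_mod_cast (Finset.mem_Ico.1 hl).1
    have hln : 3 < (l : ℝ) ^ 2 / N * n := by
      rw [div_mul_eq_mul_div, lt_div_iff₀ hN0]
      have : (n : ℝ) ≤ (l : ℝ) ^ 2 * n :=
        le_mul_of_one_le_left (Nat.cast_nonneg n) (one_le_pow₀ hl1)
      linarith
    refine (norm_sum_le _ _).trans ?_
    calc _ ≤ ∑ x ∈ (Finset.range (c * q)).filter (fun x => Nat.Coprime x (c * q)),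
          ‖∑ ψ ∈ oddCharacters q, ψ (l : ZMod q) * ψ (x : ZMod q)‖ * (1 / ((c * q : ℕ) : ℝ)) *
            (C * (P * (l : ℝ) ^ (-(3 / 2) : ℝ) * ((c * q : ℕ) : ℝ) ^ (-(1 / 2) : ℝ) *
              min 1 (N / ((c * q : ℕ) * K ^ 2)))) := by
          refine Finset.sum_le_sum fun x _ => ?_
          rw [norm_mul, norm_mul, norm_div, norm_neg, Complex.norm_I, Complex.norm_natCast]
          gcongr
          exact hb W U hW hU t N H K _ l ht hN htN hH hHN hK hM hl1 hcase _ _ n J hln hJ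
      _ = (∑ x ∈ (Finset.range (c * q)).filter (fun x => Nat.Coprime x (c * q)),
          ‖∑ ψ ∈ oddCharacters q, ψ (l : ZMod q) * ψ (x : ZMod q)‖) * ((1 / ((c * q : ℕ) : ℝ)) *
            (C * P * R * (l : ℝ) ^ (-(3 / 2) : ℝ))) := by
          rw [Finset.sum_mul]
          refine Finset.sum_congr rfl fun x _ => ?_
          rw [hR]; ring
      _ ≤ ((c * q : ℕ) : ℝ) * ((1 / ((c * q : ℕ) : ℝ)) *
            (C * P * R * (l : ℝ) ^ (-(3 / 2) : ℝ))) := by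
          gcongr
          rw [Nat.cast_mul]
          exact sum_norm_sum_oddCharacters_le c _ _
      _ = _ := by field_simp
  calc _ ≤ ∑ l ∈ Finset.Ico 1 n, C * P * R * (l : ℝ) ^ (-(3 / 2) : ℝ) := norm_sum_le_of_le _ hterm
    _ = C * P * R * ∑ l ∈ Finset.Ico 1 n, (l : ℝ) ^ (-(3 / 2) : ℝ) := by rw [Finset.mul_sum]
    _ ≤ C * P * R * Z := by
        gcongr
        exact hsum.sum_le_tsum _ fun l _ => by positivity
    _ = _ := by rw [hR]; ring

/-- Interpolating `min(1, x) ≤ x^s` leaves `c^(-1/2-s)`, summable exactly for `s > 1/2`. The sum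
over `q` is trivial, with at most `3Q` terms. The exponent `s` is left free because the two ranges
of `N` need different values. -/
theorem exists_norm_offDiag_le {k₀ : ℤ} (F : CuspForm 𝒮ℒ k₀) (B : ℕ → ℝ) (N₀ : ℝ) {s : ℝ}
    (hs : 1 / 2 < s) (hs1 : s ≤ 1) :
    ∃ C, 0 ≤ C ∧ ∀ W U : ℝ → ℝ, IsBump B W → IsPlateau B U →
      ∀ t N H K Q : ℝ, 1 ≤ t → 1 ≤ N → √t ≤ N → 0 < H → H ≤ N → 1 ≤ K → 1 ≤ Q →
      (100 * N ≤ t * Q ∨ N ≤ N₀) →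
      ∀ 𝒬 : Finset ℕ, (∀ q ∈ 𝒬, Q ≤ (q : ℝ) ∧ (q : ℝ) ≤ 2 * Q) →
        ‖offDiag F W U 𝒬 t N H K‖ ≤
          C * (H * (√t + N / √t) * N * Q ^ (1 / 2 : ℝ) * (N / (Q * K ^ 2)) ^ s) := by
  obtain ⟨C, hC, hb⟩ := exists_norm_modulusPart_le F B N₀
  have hsum : Summable fun c : ℕ+ => ((c : ℕ) : ℝ) ^ (-(1 / 2) - s) :=
    (Real.summable_nat_rpow.2 (by linarith)).comp_injective PNat.coe_injective
  set Z := ∑' c : ℕ+, ((c : ℕ) : ℝ) ^ (-(1 / 2) - s) with hZ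
  refine ⟨3 * C * Z, by positivity, ?_⟩
  intro W U hW hU t N H K Q ht hN htN hH hHN hK hQ hcase 𝒬 h𝒬
  have hN0 : 0 < N := by linarith
  have hK0 : 0 < K := by linarith
  have hQ0 : 0 < Q := by linarith
  have hq1 : ∀ q ∈ 𝒬, 1 ≤ q := fun q hq => by
    have : (1 : ℝ) ≤ q := hQ.trans (h𝒬 q hq).1
    exact_mod_cast this
  obtain ⟨n, hn⟩ := exists_nat_gt (3 * N)
  obtain ⟨J, hJ⟩ := exists_nat_gt (K + 2)
  have hS := hasSum_modulusPart F hW hU (t := t) hN0 hH hK0 hn (by linarith) 𝒬 hq1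
  rw [← hS.tsum_eq]
  set P : ℝ := H * (√t + N / √t) * N with hP
  set X : ℝ := N / (Q * K ^ 2) with hX
  have hX0 : 0 < X := by positivity
  have hcard : (𝒬.card : ℝ) ≤ 3 * Q := by
    have h1 : 𝒬.card ≤ (Finset.range (⌊2 * Q⌋₊ + 1)).card := by
      refine Finset.card_le_card fun q hq => ?_
      exact Finset.mem_range.2 (Nat.lt_succ_of_le (Nat.le_floor (h𝒬 q hq).2))
    rw [Finset.card_range] at h1
    have h2 : (𝒬.card : ℝ) ≤ (⌊2 * Q⌋₊ : ℝ) + 1 := by exact_mod_cast h1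
    have h3 := Nat.floor_le (show (0 : ℝ) ≤ 2 * Q by positivity)
    linarith
  have hc : ∀ c : ℕ+, ‖∑ q ∈ 𝒬, modulusPart F W U t N H K n J q c‖ ≤
      3 * C * (P * Q ^ (1 / 2 : ℝ) * X ^ s) * ((c : ℕ) : ℝ) ^ (-(1 / 2) - s) := by
    intro c
    have hc1 : (1 : ℝ) ≤ (c : ℕ) := by exact_mod_cast c.pos
    have hc0 : (0 : ℝ) < (c : ℕ) := by linarith
    have hq : ∀ q ∈ 𝒬, ‖modulusPart F W U t N H K n J q c‖ ≤
        C * (P * (((c : ℕ) : ℝ) * Q) ^ (-(1 / 2) : ℝ) * (X / (c : ℕ)) ^ s) := by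
      intro q hq
      have hQq := (h𝒬 q hq).1
      have hcq : ((c : ℕ) : ℝ) * Q ≤ ((c * q : ℕ) : ℝ) := by
        push_cast; gcongr
      have hQcq : Q ≤ ((c * q : ℕ) : ℝ) := (le_mul_of_one_le_left hQ0.le hc1).trans hcq
      refine (hb W U hW hU t N H K ht hN htN hH hHN hK q c (hq1 q hq) c.pos ?_ n J hn hJ).trans ?_
      · refine hcase.imp_left fun h => h.trans ?_
        gcongr
      · have h1 : ((c * q : ℕ) : ℝ) ^ (-(1 / 2) : ℝ) ≤ (((c : ℕ) : ℝ) * Q) ^ (-(1 / 2) : ℝ) :=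
          Real.rpow_le_rpow_of_nonpos (by positivity) hcq (by norm_num)
        have h2 : N / ((c * q : ℕ) * K ^ 2) ≤ X / (c : ℕ) := by
          rw [hX, div_div]
          apply div_le_div_of_nonneg_left hN0.le (by positivity)
          calc Q * K ^ 2 * (c : ℕ) = (c : ℕ) * Q * K ^ 2 := by ring
            _ ≤ _ := by gcongr
        have hXc : 0 < X / (c : ℕ) := by positivity
        have h3 : min 1 (N / ((c * q : ℕ) * K ^ 2)) ≤ (X / (c : ℕ)) ^ s := by
          rcases le_total 1 (X / (c : ℕ)) with h | h
          · exact (min_le_left _ _).trans (Real.one_le_rpow h (by linarith))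
          · refine (min_le_right _ _).trans (h2.trans ?_)
            calc X / (c : ℕ) = (X / (c : ℕ)) ^ (1 : ℝ) := (Real.rpow_one _).symm
              _ ≤ _ := Real.rpow_le_rpow_of_exponent_ge hXc h hs1
        gcongr
    calc _ ≤ ∑ q ∈ 𝒬, C * (P * (((c : ℕ) : ℝ) * Q) ^ (-(1 / 2) : ℝ) * (X / (c : ℕ)) ^ s) :=
          norm_sum_le_of_le _ hq
      _ = 𝒬.card * (C * (P * (((c : ℕ) : ℝ) * Q) ^ (-(1 / 2) : ℝ) * (X / (c : ℕ)) ^ s)) := by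
          rw [Finset.sum_const, nsmul_eq_mul]
      _ ≤ 3 * Q * (C * (P * (((c : ℕ) : ℝ) * Q) ^ (-(1 / 2) : ℝ) * (X / (c : ℕ)) ^ s)) := by
          gcongr
      _ = _ := by
          rw [Real.mul_rpow hc0.le hQ0.le, Real.div_rpow hX0.le hc0.le, Real.rpow_sub hc0,
            show (1 / 2 : ℝ) = 1 + -(1 / 2) by norm_num, Real.rpow_add hQ0, Real.rpow_one]
          norm_num
          ring
  refine (tsum_of_norm_bounded (hsum.hasSum.mul_left _) hc).trans (le_of_eq ?_)
  ring

/-! ### The parameters -/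

section parameters

variable {δ t N : ℝ}

lemma paramK_pos (ht : 0 < t) (hN : 0 < N) : 0 < paramK δ t N :=
  lt_min (Real.rpow_pos_of_pos ht _) (mul_pos hN (Real.rpow_pos_of_pos ht _))

lemma paramQ_pos (ht : 0 < t) (hN : 0 < N) : 0 < paramQ δ t N := by
  have := paramK_pos (δ := δ) ht hN
  rw [paramQ]; positivity

lemma one_le_paramK (hδ : δ ≤ 1 / 12) (ht : 1 ≤ t) (hN : t ^ (2 / 3 - 2 * δ) ≤ N) :
    1 ≤ paramK δ t N := by
  have ht0 : 0 < t := by linarith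
  refine le_min (Real.one_le_rpow ht (by linarith)) ?_
  calc (1 : ℝ) ≤ t ^ (1 / 3 - 4 * δ) := Real.one_le_rpow ht (by linarith)
    _ = t ^ (2 / 3 - 2 * δ) * t ^ (-(1 / 3) - 2 * δ) := by
        rw [← Real.rpow_add ht0]; congr 1; ring
    _ ≤ _ := by gcongr

lemma rpow_le_paramQ (hδ₀ : 0 ≤ δ) (ht : 1 ≤ t) (hN : t ^ (2 / 3 - 2 * δ) ≤ N) :
    t ^ (1 / 15 : ℝ) ≤ paramQ δ t N := by
  have ht0 : 0 < t := by linarith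
  have hN0 : 0 < N := (Real.rpow_pos_of_pos ht0 _).trans_le hN
  have hK := paramK_pos (δ := δ) ht0 hN0
  have h1 : t ^ (2 / 5 - 6 * δ / 5) ≤ N ^ (3 / 5 : ℝ) := by
    calc t ^ (2 / 5 - 6 * δ / 5) = (t ^ (2 / 3 - 2 * δ)) ^ (3 / 5 : ℝ) := by
          rw [← Real.rpow_mul ht0.le]; congr 1; ring
      _ ≤ _ := by gcongr
  have h2 : t ^ (-(2 / 5) + 12 * δ / 5) ≤ paramK δ t N ^ (-(6 / 5) : ℝ) := by
    calc t ^ (-(2 / 5) + 12 * δ / 5) = (t ^ (1 / 3 - 2 * δ)) ^ (-(6 / 5) : ℝ) := by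
          rw [← Real.rpow_mul ht0.le]; congr 1; ring
      _ ≤ _ := Real.rpow_le_rpow_of_nonpos hK (min_le_left _ _) (by norm_num)
  calc t ^ (1 / 15 : ℝ) ≤ t ^ (1 / 15 + 8 * δ / 5) :=
        Real.rpow_le_rpow_of_exponent_le ht (by linarith)
    _ = t ^ (2 / 5 - 6 * δ / 5) * t ^ (1 / 15 + 2 * δ / 5) * t ^ (-(2 / 5) + 12 * δ / 5) := by
        rw [← Real.rpow_add ht0, ← Real.rpow_add ht0]; congr 1; ring
    _ ≤ _ := by rw [paramQ]; gcongr

/-- The relation that dictates the choice of `Q`: it equates the bound for `s = 1` with the target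
when `N ≤ t`, up to a constant. -/
lemma paramQ_rpow_mul_paramK_pow (ht : 0 < t) (hN : 0 < N) :
    paramQ δ t N ^ (5 / 2 : ℝ) * paramK δ t N ^ 3 = N ^ (3 / 2 : ℝ) * t ^ (1 / 6 + δ) := by
  have hK := paramK_pos (δ := δ) ht hN
  rw [paramQ, Real.mul_rpow (by positivity) (by positivity), Real.mul_rpow (by positivity) (by positivity),
    ← Real.rpow_mul hN.le, ← Real.rpow_mul ht.le, ← Real.rpow_mul hK.le, ← Real.rpow_natCast, mul_assoc,
    ← Real.rpow_add hK]
  norm_num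
  left
  congr 1; ring

lemma bound_eq (ht : 0 < t) (hN : 0 < N) (H : ℝ) :
    H * (√t + N / √t) * N * paramQ δ t N ^ (1 / 2 : ℝ) * (N / (paramQ δ t N * paramK δ t N ^ 2)) =
      √N * H * paramQ δ t N ^ 2 * paramK δ t N * t ^ (1 / 3 - δ) * (1 + N / t) := by
  have hK := paramK_pos (δ := δ) ht hN
  have hQ := paramQ_pos (δ := δ) ht hN
  have hid := paramQ_rpow_mul_paramK_pow (δ := δ) ht hN
  generalize paramK δ t N = K at *
  generalize paramQ δ t N = Q at *
  have hp : t ^ (1 / 6 + δ) * t ^ (1 / 3 - δ) = √t := by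
    rw [← Real.rpow_add ht, Real.sqrt_eq_rpow]; congr 1; ring
  have h5 : Q ^ (5 / 2 : ℝ) = √Q ^ 5 := by
    rw [Real.sqrt_eq_rpow, ← Real.rpow_natCast, ← Real.rpow_mul hQ.le]; norm_num
  have h3 : N ^ (3 / 2 : ℝ) = √N ^ 3 := by
    rw [Real.sqrt_eq_rpow, ← Real.rpow_natCast, ← Real.rpow_mul hN.le]; norm_num
  rw [h5, h3] at hid
  rw [← Real.sqrt_eq_rpow]
  -- Passing to square roots of `Q`, `N` and `t` turns the claim into a rational identity, reduced
  -- to `key`.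
  obtain ⟨u, hu, rfl⟩ : ∃ u, 0 < u ∧ Q = u ^ 2 := ⟨√Q, Real.sqrt_pos.2 hQ, (Real.sq_sqrt hQ.le).symm⟩
  obtain ⟨v, hv, rfl⟩ : ∃ v, 0 < v ∧ N = v ^ 2 := ⟨√N, Real.sqrt_pos.2 hN, (Real.sq_sqrt hN.le).symm⟩
  obtain ⟨w, hw, hw'⟩ : ∃ w, 0 < w ∧ t = w ^ 2 := ⟨√t, Real.sqrt_pos.2 ht, (Real.sq_sqrt ht.le).symm⟩
  have hsw : √t = w := by rw [hw', Real.sqrt_sq hw.le]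
  rw [Real.sqrt_sq hu.le, Real.sqrt_sq hv.le] at *
  rw [hsw]
  rw [hsw] at hp
  generalize t ^ (1 / 3 - δ) = p at *
  rw [hw']
  have key : v ^ 3 * w = u ^ 5 * K ^ 3 * p := by rw [hid, ← hp]; ring
  field_simp
  linear_combination H * key

/-- Here `Q K² = N^(3/5) t^(1/15+2δ/5) K^(4/5)`, and `K ≤ t^(1/3-2δ)` bounds the part after
`N^(3/5)` by `t^(1/3)`; since `t ≤ N`, a factor `t^(1/15)` is left over. -/
lemma rpow_le_div_paramQ (ht : 1 ≤ t) (hδ₀ : 0 ≤ δ) (hN : t ≤ N) :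
    t ^ (1 / 15 : ℝ) ≤ N / (paramQ δ t N * paramK δ t N ^ 2) := by
  have ht0 : 0 < t := by linarith
  have hN0 : 0 < N := by linarith
  have hK := paramK_pos (δ := δ) ht0 hN0
  have hQ := paramQ_pos (δ := δ) ht0 hN0
  rw [le_div_iff₀ (by positivity)]
  have h1 : paramQ δ t N * paramK δ t N ^ 2 =
      N ^ (3 / 5 : ℝ) * t ^ (1 / 15 + 2 * δ / 5) * paramK δ t N ^ (4 / 5 : ℝ) := by
    rw [paramQ, mul_assoc, ← Real.rpow_natCast, ← Real.rpow_add hK]; norm_num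
  have h2 : paramK δ t N ^ (4 / 5 : ℝ) ≤ t ^ (4 / 15 - 8 * δ / 5) := by
    calc paramK δ t N ^ (4 / 5 : ℝ) ≤ (t ^ (1 / 3 - 2 * δ)) ^ (4 / 5 : ℝ) := by
          gcongr; exact min_le_left _ _
      _ = _ := by rw [← Real.rpow_mul ht0.le]; congr 1; ring
  rw [h1]
  calc t ^ (1 / 15 : ℝ) * (N ^ (3 / 5 : ℝ) * t ^ (1 / 15 + 2 * δ / 5) * paramK δ t N ^ (4 / 5 : ℝ))
      ≤ t ^ (1 / 15 : ℝ) * (N ^ (3 / 5 : ℝ) * t ^ (1 / 15 + 2 * δ / 5) * t ^ (4 / 15 - 8 * δ / 5)) := by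
        gcongr
    _ = N ^ (3 / 5 : ℝ) * t ^ (2 / 5 - 6 * δ / 5) := by
        rw [show t ^ (2 / 5 - 6 * δ / 5) =
          t ^ (1 / 15 : ℝ) * t ^ (1 / 15 + 2 * δ / 5) * t ^ (4 / 15 - 8 * δ / 5) by
            rw [← Real.rpow_add ht0, ← Real.rpow_add ht0]; congr 1; ring]
        ring
    _ ≤ N ^ (3 / 5 : ℝ) * t ^ (2 / 5 : ℝ) := by
        gcongr
        linarith
    _ ≤ N ^ (3 / 5 : ℝ) * N ^ (2 / 5 : ℝ) := by gcongr
    _ = N := by rw [← Real.rpow_add hN0]; norm_num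

/-- If `t^(1/20) ≥ 100A`, then `100N ≤ t^(1/20+1+1/60) = t^(1+1/15) ≤ t Q`. Otherwise `t` is bounded
in terms of `A`, and hence so is `N`. -/
lemma modulus_large_or_bounded {A : ℝ} (hδ₀ : 0 ≤ δ) (ht : 1 ≤ t) (hN : t ^ (2 / 3 - 2 * δ) ≤ N)
    (hA : N ≤ A * t ^ (1 + 1 / 60 : ℝ)) :
    100 * N ≤ t * paramQ δ t N ∨ N ≤ A * (100 * A) ^ 40 := by
  have ht0 : 0 < t := by linarith
  have hN0 : 0 < N := (Real.rpow_pos_of_pos ht0 _).trans_le hN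
  have hA0 : 0 < A := pos_of_mul_pos_left (hN0.trans_le hA) (by positivity)
  rcases le_total (100 * A) (t ^ (1 / 20 : ℝ)) with h | h
  · left
    calc 100 * N ≤ 100 * A * t ^ (1 + 1 / 60 : ℝ) := by linarith
      _ ≤ t ^ (1 / 20 : ℝ) * t ^ (1 + 1 / 60 : ℝ) := by gcongr
      _ = t * t ^ (1 / 15 : ℝ) := by
          rw [← Real.rpow_add ht0, ← Real.rpow_one_add' ht0.le (by norm_num)]; norm_num
      _ ≤ _ := by gcongr; exact rpow_le_paramQ hδ₀ ht hN
  · right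
    refine hA.trans ?_
    gcongr
    calc t ^ (1 + 1 / 60 : ℝ) ≤ t ^ (2 : ℝ) :=
          Real.rpow_le_rpow_of_exponent_le ht (by norm_num)
      _ = (t ^ (1 / 20 : ℝ)) ^ 40 := by
          rw [← Real.rpow_natCast, ← Real.rpow_mul ht0.le]; norm_num
      _ ≤ _ := by gcongr

end parameters

end OffDiagonal

theorem proposition1 (δ : ℝ) (hδ₀ : 0 < δ) (hδ : δ < 1 / 42) :
    ∃ ε₀ : ℝ, 0 < ε₀ ∧
      ∀ (k₀ : ℤ) (F : CuspForm 𝒮ℒ k₀), OffDiagonal.IsHeckeCuspForm F →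
      ∀ (A : ℝ) (B : ℕ → ℝ), ∃ C : ℝ,
      ∀ W U : ℝ → ℝ, OffDiagonal.IsBump B W → OffDiagonal.IsPlateau B U →
      ∀ t N : ℝ, 1 < t → t ^ (2 / 3 - 2 * δ) < N → N ≤ A * t ^ (1 + ε₀) →
      ∀ 𝒬 : Finset ℕ,
        (∀ q ∈ 𝒬, q.Prime ∧ OffDiagonal.paramQ δ t N ≤ q ∧ (q : ℝ) ≤ 2 * OffDiagonal.paramQ δ t N) →
        ‖OffDiagonal.offDiag F W U 𝒬 t N (OffDiagonal.paramH t N) (OffDiagonal.paramK δ t N)‖ ≤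
          C * (Real.sqrt N * OffDiagonal.paramH t N * OffDiagonal.paramQ δ t N ^ 2 *
            OffDiagonal.paramK δ t N * t ^ (1 / 3 - δ)) := by
  -- `1/60 = (1/4)(1/15)`: the saving `X^(-1/4)` with `X ≥ t^(1/15)`, obtained from `s = 3/4` in
  -- place of `s = 1`.
  refine ⟨1 / 60, by norm_num, fun k₀ F _ A B => ?_⟩
  obtain ⟨C₁, hC₁, hb₁⟩ := OffDiagonal.exists_norm_offDiag_le F B (A * (100 * A) ^ 40)
    (s := 1) (by norm_num) le_rfl
  obtain ⟨C₂, hC₂, hb₂⟩ := OffDiagonal.exists_norm_offDiag_le F B (A * (100 * A) ^ 40)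
    (s := 3 / 4) (by norm_num) (by norm_num)
  refine ⟨max (2 * C₁) (C₂ * (1 + A)), fun W U hW hU t N ht hNt hNA 𝒬 h𝒬 => ?_⟩
  have ht0 : 0 < t := by linarith
  have hN0 : 0 < N := (Real.rpow_pos_of_pos ht0 _).trans hNt
  have hN1 : 1 ≤ N := (Real.one_le_rpow ht.le (by linarith)).trans hNt.le
  have htN : √t ≤ N := by
    rw [Real.sqrt_eq_rpow]
    exact (Real.rpow_le_rpow_of_exponent_le ht.le (by linarith)).trans hNt.le
  have hH : 0 < OffDiagonal.paramH t N := by rw [OffDiagonal.paramH]; positivity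
  have hHN : OffDiagonal.paramH t N ≤ N :=
    div_le_self hN0.le (Real.one_le_rpow ht.le (by norm_num))
  have hK := OffDiagonal.one_le_paramK (by linarith) ht.le hNt.le
  have hQt := OffDiagonal.rpow_le_paramQ hδ₀.le ht.le hNt.le
  have hQ : 1 ≤ OffDiagonal.paramQ δ t N := (Real.one_le_rpow ht.le (by norm_num)).trans hQt
  have hcase := OffDiagonal.modulus_large_or_bounded hδ₀.le ht.le hNt.le hNA
  have hbound := OffDiagonal.bound_eq (δ := δ) ht0 hN0 (OffDiagonal.paramH t N)
  set H := OffDiagonal.paramH t N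
  have hbig := fun h => OffDiagonal.rpow_le_div_paramQ (δ := δ) (N := N) ht.le hδ₀.le h
  set K := OffDiagonal.paramK δ t N
  set Q := OffDiagonal.paramQ δ t N
  set X := N / (Q * K ^ 2) with hX
  have hX0 : 0 < X := by positivity
  set R := √N * H * Q ^ 2 * K * t ^ (1 / 3 - δ)
  -- For `N ≤ t` the factor `1 + N/t` is at most `2` and `s = 1` suffices. For `N ≥ t` the exponent
  -- `3/4` saves `t^(-1/60)`, which compensates `N/t ≤ A t^(1/60)`.
  rcases le_total N t with h | h
  · have h1 : N / t ≤ 1 := (div_le_one ht0).2 h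
    calc _ ≤ C₁ * (H * (√t + N / √t) * N * Q ^ (1 / 2 : ℝ) * X ^ (1 : ℝ)) :=
          hb₁ W U hW hU t N H K Q ht.le hN1 htN hH hHN hK hQ hcase 𝒬 fun q hq => (h𝒬 q hq).2
      _ = C₁ * (R * (1 + N / t)) := by rw [Real.rpow_one, hbound]
      _ ≤ C₁ * (R * (1 + 1)) := by gcongr
      _ = 2 * C₁ * R := by ring
      _ ≤ _ := by gcongr; exact le_max_left _ _
  · have h1 : X ^ (-(1 / 4) : ℝ) ≤ t ^ (-(1 / 60) : ℝ) := by
      calc X ^ (-(1 / 4) : ℝ) ≤ (t ^ (1 / 15 : ℝ)) ^ (-(1 / 4) : ℝ) :=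
            Real.rpow_le_rpow_of_nonpos (by positivity) (hbig h) (by norm_num)
        _ = _ := by rw [← Real.rpow_mul ht0.le]; norm_num
    have h2 : X ^ (3 / 4 : ℝ) = X * X ^ (-(1 / 4) : ℝ) := by
      rw [← Real.rpow_one_add' hX0.le (by norm_num)]; norm_num
    have h3 : (1 + N / t) * t ^ (-(1 / 60) : ℝ) ≤ 1 + A := by
      have h4 : t ^ (-(1 / 60) : ℝ) ≤ 1 := Real.rpow_le_one_of_one_le_of_nonpos ht.le (by norm_num)
      have h5 : N / t * t ^ (-(1 / 60) : ℝ) ≤ A := by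
        calc N / t * t ^ (-(1 / 60) : ℝ) ≤ A * t ^ (1 + 1 / 60 : ℝ) / t * t ^ (-(1 / 60) : ℝ) := by
              gcongr
          _ = A := by
              rw [Real.rpow_add ht0, Real.rpow_one, Real.rpow_neg ht0.le]
              field_simp
      linarith
    calc _ ≤ C₂ * (H * (√t + N / √t) * N * Q ^ (1 / 2 : ℝ) * X ^ (3 / 4 : ℝ)) :=
          hb₂ W U hW hU t N H K Q ht.le hN1 htN hH hHN hK hQ hcase 𝒬 fun q hq => (h𝒬 q hq).2
      _ = C₂ * (R * (1 + N / t) * X ^ (-(1 / 4) : ℝ)) := by rw [h2, ← hbound]; ring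
      _ ≤ C₂ * (R * (1 + N / t) * t ^ (-(1 / 60) : ℝ)) := by gcongr
      _ = C₂ * (R * ((1 + N / t) * t ^ (-(1 / 60) : ℝ))) := by ring
      _ ≤ C₂ * (R * (1 + A)) := by gcongr
      _ = C₂ * (1 + A) * R := by ring
      _ ≤ _ := by gcongr; exact le_max_right _ _
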